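/- **Setting.** Let $U\subset\mathbb R^d$ be a measurable region with Lebesgue measure $du$. For a finite measure $\lambda$ on $U$ let $\mathrm{Po}(\lambda)$ be the law on $\bigcup_{n\ge 0}U^n$ of the Poisson process with intensity measure $\lambda$: the number of points $N$ is Poisson with mean $w=\lambda(U)$ and, given $N$, the points are i.i.d. from $\overline\lambda=\lambda/w$. Let $s,t>0$ be known. One observes $\boldsymbol x\sim \mathrm{Po}(s\lambda)$, and $\boldsymbol y\sim \mathrm{Po}(t\lambda)$ is independent of $\boldsymbol x$. The parameter $\lambda$ ranges over a set $\Lambda$ of finite measures on $U$ that are mutually absolutely continuous with respect to Lebesgue measure, and $\Lambda$ is closed under multiplication by positive constants. **Prior.** Let $k:U\times U\to[0,\infty)$ be measurable with $\int_U k(y,u)\,dy=1$ for every $u$, and let $k(y,\overline\mu)=\int k(y,u)\,\overline\mu(du)$. Let $\alpha$ be a nonzero finite measure on $U$ with total mass $|\alpha|$, and let $\mathrm{Di}(\alpha)$ be the Dirichlet process with parameter $\alpha$. Assume that for $\mathrm{Di}(\alpha)$-almost every $\overline\mu$ the measure $k(y,\overline\mu)\,dy$ belongs to $\Lambda$. For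 $\gamma<|\alpha|$ let $\pi_{\alpha,\gamma}$ be the improper prior $$\pi_{\alpha,\gamma}(dw\,d\overline\mu)=\mathrm{Di}(\alpha)(d\overline\mu)\;w^{|\alpha|-\gamma-1}\,dw,\qquad w>0,$$ where $(w,\overline\mu)$ stands for the intensity $\lambda(y)=w\,k(y,\overline\mu)$. **Procedures and risks.** * A predictive density is a measurable map $\boldsymbol x\mapsto q_{\boldsymbol x}$ such that, for almost every $\boldsymbol x$, $q_{\boldsymbol x}$ is a probability distribution on $\bigcup_m U^m$ that has a density and gives positive probability to each $U^m$. Its risk is $\mathrm E_\lambda[D(\mathrm{Po}(t\lambda),q_{\boldsymbol x})]$, where $D$ is the Kullback–Leibler divergence. * An intensity estimator is a measurable map $\boldsymbol x\mapsto\widehat\lambda_{\boldsymbol x}$ such that, for almost every $\boldsymbol x$, $\widehat\lambda_{\boldsymbol x}$ is a finite measure mutually absolutely continuous with respect to Lebesgue measure. Its risk is $\mathrm E_\lambda[D(\mathrm{Po}(t\lambda),\mathrm{Po}(t\widehat\lambda_{\boldsymbol x}))]$. * A procedure is admissible if there is no other procedure of the same kind whose risk is at most as large for every $\lambda\in\Lambda$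 and strictly smaller for some $\lambda\in\Lambda$. * The Bayesian predictive density and the generalized Bayes estimator $\lambda_{\alpha,\gamma,\boldsymbol x}$ based on $\pi_{\alpha,\gamma}$ are the posterior means, given $\boldsymbol x$, of the density of $\mathrm{Po}(t\lambda)$ and of the intensity $\lambda(\cdot)$, respectively. **Theorem.** Let $|\alpha|-1\le\gamma<|\alpha|$. 1. If the Bayesian predictive density based on $\pi_{\alpha,\gamma}$ has finite Kullback–Leibler risk at $\pi_{\alpha,\gamma}$-almost every parameter, then it is a predictive density and is admissible under the Kullback–Leibler loss. 2. If the generalized Bayes estimator $\lambda_{\alpha,\gamma,\boldsymbol x}$ based on $\pi_{\alpha,\gamma}$ has finite Kullback–Leibler risk at $\pi_{\alpha,\gamma}$-almost every parameter, then it is an intensity estimator and is admissible under the Kullback–Leibler loss. -/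

import Mathlib

open MeasureTheory ProbabilityTheory
open scoped ENNReal NNReal

noncomputable section

namespace PoissonAdmissibility

/-- The sample space `⋃ₙ Uⁿ` of realizations `(N, x₁, …, x_N)` of a finite point process on `U`. -/
abbrev Config (U : Type*) : Type _ := Σ n : ℕ, (Fin n → U)

variable {U : Type*} [MeasurableSpace U]

/-! ### Poisson processes -/

/-- The reference measure on `⋃ₙ Uⁿ`: the `n`-fold product of `ν` on each `Uⁿ`
(a unit point mass for `n = 0`). -/
def configMeasure (ν : Measure U) : Measure (Config U) :=
  Measure.sum fun n : ℕ =>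
    (Measure.pi fun _ : Fin n => ν).map fun z => (⟨n, z⟩ : Config U)

/-- The law of the (nonhomogeneous) Poisson process with finite intensity measure `κ`: the number of
points is Poisson with mean `κ(U)` and, given that number, the points are i.i.d. from `κ / κ(U)`.
That is, it equals `exp (-κ(U)) (1/n!) κ^{⊗ n}` on `Uⁿ`. -/
def poissonProcess (κ : Measure U) : Measure (Config U) :=
  ENNReal.ofReal (Real.exp (-(κ Set.univ).toReal)) •
    Measure.sum fun n : ℕ =>
      ((Nat.factorial n : ℝ≥0∞)⁻¹) •
        (Measure.pi fun _ : Fin n => κ).map fun z => (⟨n, z⟩ : Config U)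

/-- The density `{∏ᵢ f(xᵢ)} (sw)ᴺ / N! exp(-sw)` of the Poisson process with intensity function
`s w f` (where `f` is a probability density), with respect to `configMeasure`. -/
def poissonDensity (s w : ℝ) (f : U → ℝ≥0∞) (x : Config U) : ℝ≥0∞ :=
  (∏ i, f (x.2 i)) *
    ENNReal.ofReal ((s * w) ^ x.1 / (Nat.factorial x.1 : ℝ) * Real.exp (-(s * w)))

/-! ### The Dirichlet process -/

/-- The gamma distribution with shape `a ≥ 0` and unit scale; for `a = 0` it is the point mass
at `0`. -/
def unitGamma (a : ℝ) : Measure ℝ :=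
  if a = 0 then Measure.dirac 0 else gammaMeasure a 1

/-- The Dirichlet distribution with parameters `a i ≥ 0`, not all zero: the law of
`(G i / ∑ j, G j)ᵢ` for independent `G i` with gamma distributions of shapes `a i`. A component
with parameter `0` vanishes almost surely. -/
def dirichletDist {n : ℕ} (a : Fin n → ℝ) : Measure (Fin n → ℝ) :=
  (Measure.pi fun i => unitGamma (a i)).map fun g i => g i / ∑ j, g j

/-- `D` is the law of the Dirichlet process with parameter measure `α`: for every finite measurable
partition `(B₁, …, Bₙ)` of `U`, the vector `(m(B₁), …, m(Bₙ))` has under `D` the Dirichlet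
distribution with parameters `(α(B₁), …, α(Bₙ))`. -/
def IsDirichletProcess (α : Measure U) (D : Measure (ProbabilityMeasure U)) : Prop :=
  ∀ (n : ℕ) (B : Fin n → Set U), (∀ i, MeasurableSet (B i)) →
    Pairwise (fun i j => Disjoint (B i) (B j)) → (⋃ i, B i) = Set.univ →
      D.map (fun (m : ProbabilityMeasure U) i => ((m : Measure U) (B i)).toReal) =
        dirichletDist fun i => (α (B i)).toReal

/-! ### Kernel mixtures, priors and posteriors -/

/-- A kernel function: jointly measurable, nonnegative, with `∫ k(y, u) dy = 1` for every `u`. -/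
structure IsKernelFunction (ν : Measure U) (k : U → U → ℝ≥0) : Prop where
  measurable : Measurable (Function.uncurry k)
  lintegral_eq_one : ∀ u, ∫⁻ y, (k y u : ℝ≥0∞) ∂ν = 1

/-- The mixture density `k(y, m) = ∫ k(y, u) m(du)`. -/
def mixture (k : U → U → ℝ≥0) (m : ProbabilityMeasure U) (y : U) : ℝ≥0∞ :=
  ∫⁻ u, (k y u : ℝ≥0∞) ∂(m : Measure U)

/-- The improper prior `w ^ (|α| - γ - 1) dw ⊗ Di(α)(dm)` on pairs `θ = (w, m)`, where `w > 0` and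
`m` is a probability measure; `D` is the law of the Dirichlet process with parameter `α`. The pair
stands for the mixing measure `w • m`. -/
def improperPrior (α : Measure U) (γ : ℝ) (D : Measure (ProbabilityMeasure U)) :
    Measure (ℝ × ProbabilityMeasure U) :=
  ((volume.restrict (Set.Ioi (0 : ℝ))).withDensity
    fun w => ENNReal.ofReal (w ^ ((α Set.univ).toReal - γ - 1))).prod D

/-- The intensity function `y ↦ w k(y, m)` with parameter `θ = (w, m)`. -/
def intensity (k : U → U → ℝ≥0) (θ : ℝ × ProbabilityMeasure U) (y : U) : ℝ≥0∞ :=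
  ENNReal.ofReal θ.1 * mixture k θ.2 y

/-- The posterior distribution of `θ = (w, m)` for the (possibly improper) prior `π`, given the
observation `x` of the Poisson process with intensity function `s w k(·, m)`. -/
def posterior (k : U → U → ℝ≥0) (s : ℝ) (π : Measure (ℝ × ProbabilityMeasure U)) (x : Config U) :
    Measure (ℝ × ProbabilityMeasure U) :=
  (∫⁻ θ, poissonDensity s θ.1 (mixture k θ.2) x ∂π)⁻¹ •
    π.withDensity fun θ => poissonDensity s θ.1 (mixture k θ.2) x

/-- The Bayesian predictive distribution of an independent Poisson process with intensity function
`t w k(·, m)`, given `x`: its density is the posterior mean of the density. -/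
def bayesPredictive (ν : Measure U) (k : U → U → ℝ≥0) (s t : ℝ)
    (π : Measure (ℝ × ProbabilityMeasure U)) (x : Config U) : Measure (Config U) :=
  (configMeasure ν).withDensity fun y =>
    ∫⁻ θ, poissonDensity t θ.1 (mixture k θ.2) y ∂(posterior k s π x)

/-- The (generalized) Bayes estimator of the intensity, given `x`: its density is the posterior
mean of the intensity function. -/
def bayesEstimator (ν : Measure U) (k : U → U → ℝ≥0) (s : ℝ)
    (π : Measure (ℝ × ProbabilityMeasure U)) (x : Config U) : Measure U :=
  ν.withDensity fun y => ∫⁻ θ, intensity k θ y ∂(posterior k s π x)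

/-! ### The decision problems -/

/-- Finite measures on `U` that are mutually absolutely continuous with respect to `ν`
(the action space for estimation). -/
def finiteEquivMeasures (ν : Measure U) : Set (Measure U) :=
  {κ | IsFiniteMeasure κ ∧ κ ≪ ν ∧ ν ≪ κ}

/-- Probability measures on `⋃ₘ Uᵐ` with a density, giving positive probability to each `Uᵐ`
(the action space for prediction). -/
def predictiveMeasures (ν : Measure U) : Set (Measure (Config U)) :=
  {Q | IsProbabilityMeasure Q ∧ Q ≪ configMeasure ν ∧
    ∀ m : ℕ, Q {y : Config U | y.1 = m} ≠ 0}

/-- A parameter space: a set of finite measures equivalent to `ν`, closed under positive scaling. -/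
structure IsParameterSpace (ν : Measure U) (Λ : Set (Measure U)) : Prop where
  subset : Λ ⊆ finiteEquivMeasures ν
  smul_mem : ∀ κ ∈ Λ, ∀ c : ℝ≥0, 0 < c → c • κ ∈ Λ

/-- Decision rules with actions in `𝒜`: measurable maps from the sample space to measures, with
values in `𝒜` for almost every observation. -/
def decisionRules {V : Type*} [MeasurableSpace V] (ν : Measure U) (𝒜 : Set (Measure V)) :
    Set (Config U → Measure V) :=
  {δ | Measurable δ ∧ ∀ᵐ x ∂(configMeasure ν), δ x ∈ 𝒜}

/-- The Kullback–Leibler risk `E_κ D(Po(tκ), q_x)` of a predictive distribution `q`, where `x` is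
distributed according to `Po(sκ)`. -/
def predictionRisk (s t : ℝ) (κ : Measure U) (q : Config U → Measure (Config U)) : ℝ≥0∞ :=
  ∫⁻ x, InformationTheory.klDiv (poissonProcess (ENNReal.ofReal t • κ)) (q x)
    ∂(poissonProcess (ENNReal.ofReal s • κ))

/-- The Kullback–Leibler risk `E_κ D(Po(tκ), Po(t δ_x))` of an intensity estimator `δ`, where `x` is
distributed according to `Po(sκ)`. -/
def estimationRisk (s t : ℝ) (κ : Measure U) (δ : Config U → Measure U) : ℝ≥0∞ :=
  ∫⁻ x, InformationTheory.klDiv (poissonProcess (ENNReal.ofReal t • κ))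
    (poissonProcess (ENNReal.ofReal t • δ x)) ∂(poissonProcess (ENNReal.ofReal s • κ))

/-- `δ` is admissible among the decision rules `𝒟` over the parameter space `Λ` for the risk
function `R`: it belongs to `𝒟` and no rule in `𝒟` dominates it. -/
def IsAdmissible {Δ : Type*} (Λ : Set (Measure U)) (𝒟 : Set Δ) (R : Measure U → Δ → ℝ≥0∞)
    (δ : Δ) : Prop :=
  δ ∈ 𝒟 ∧ ¬ ∃ δ' ∈ 𝒟, (∀ κ ∈ Λ, R κ δ' ≤ R κ δ) ∧ ∃ κ ∈ Λ, R κ δ' < R κ δ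

/-- Lebesgue measure on a region `U` of `ℝᵈ`. -/
abbrev lebesgue {d : ℕ} (U : Set (EuclideanSpace ℝ (Fin d))) : Measure U :=
  Measure.comap Subtype.val volume

end PoissonAdmissibility

end

open PoissonAdmissibility

namespace PoissonAdmissibility

open Set Filter Topology InformationTheory

/-! Put $a=|\alpha|-\gamma$, so that $0<a\le 1$ and the prior is $w^{a-1}dw\otimes D$. The proof is
Blyth's method: the improper prior is multiplied by weights $h(w)$ of the total mass alone, bounded
below on $(0,1]$ and making the prior finite, for which the loss incurred by ignoring the weight is
arbitrarily small. The likelihood of $x=(x_1,\dots,x_n)$ splits into a Poisson weight in $(w,n)$ and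
a product of mixture densities, so given $x$ the mass $w$ is gamma distributed with law depending on
$n$ only, and is independent of the mixing measure. Hence the problem reduces to one about Poisson
counts and $w$.

The weight is $h=1/\varphi$ with $\varphi(w)=1+\beta\log(1+w)+(\kappa w)^3$. The cube gives
integrability. The logarithm makes $h$ vary so slowly that its cost, the integral of
$E_n[(h(w)-h(v_n))^2/h(v_n)]$ against $w^{a-1}dw$ with $v_n=(n+1)/s$, is of order $\beta$ once
$\kappa$ is small enough depending on $\beta$ (`exists_isBlythWeight_weightCost_lt`). The condition
$a\le 1$ enters as $w^{a-1}\le 1$ for $w\ge 1$, and $a>0$ as integrability at $0$.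

Let $q$ be the Bayes action and $q'$ a competitor with no larger risk. Comparing both with their
average shows that the expectation of $\log\frac{q+q'}{2\sqrt{qq'}}\ge 0$ is at most that of
$\log\frac{q+q'}{2q}$, up to total-mass terms. Weight by $h$ and apply the inequality $h\log u\le
(h-c)^2/c+c(u-1)$ with $u=\frac{q+q'}{2q}$. In prediction $c=h(v_n)$; the linear term integrates to
zero since $q$ is the posterior mean and both densities have mass one, so only the cost of $h$ is
left (`lintegral_mul_gapRisk_le`).

In estimation the actions have varying mass, and cancellation of the linear terms forces $c$ to be
the posterior mean of $h$, while the intensity factor $w$ replaces $h$ by its size-biased posterior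
mean (`two_mul_lintegral_mul_gapRisk_le`). Their difference is a posterior covariance of $w$ and
$h(w)$, and Cauchy–Schwarz bounds the resulting cost by $16/s$ times the previous one
(`IsBlythWeight.size_bias_cost_le`). The cancellation needs an integrable total mass of the
competitor, so the competitor is first capped at $K(n+1)$; this raises its risk by at most $w/(sK)$
(`klRisk_capDensity_le`).

Letting the cost tend to zero (and $K\to\infty$ in estimation) makes the nonnegative gap vanish at
some parameter, whence $q'=q$ almost everywhere. Then the two procedures have the same risk on all
of $\Lambda$, and no strict improvement is possible. -/

lemma sq_log_le {x : ℝ} (hx : 0 < x) : (Real.log x) ^ 2 ≤ (x - 1) ^ 2 / x := by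
  -- With $y=\frac12\log x$, the claim is $|y|\le|\sinh y|$ squared, since $4\sinh^2 y=(x-1)^2/x$.
  have h1 : |Real.log x / 2| ≤ |Real.sinh (Real.log x / 2)| := by
    rw [Real.abs_sinh]
    exact Real.self_le_sinh_iff.2 (abs_nonneg _)
  have h2 := sq_le_sq.2 h1
  have h3 : Real.sinh (Real.log x / 2) ^ 2 = (x - 1) ^ 2 / x / 4 := by
    have hx2 : Real.exp (Real.log x / 2) ^ 2 = x := by
      rw [← Real.exp_nat_mul]
      push_cast
      rw [mul_div_cancel₀ _ (two_ne_zero), Real.exp_log hx]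
    have hpos := Real.exp_pos (Real.log x / 2)
    rw [Real.sinh_eq, Real.exp_neg]
    set r := Real.exp (Real.log x / 2)
    rw [← hx2]
    field_simp
    ring
  rw [h3] at h2
  linarith

/-! ### Moments of the Poisson distribution. -/

/-- The probability that a Poisson variable with mean `μ` equals `n`. -/
noncomputable def poissonWeight (μ : ℝ) (n : ℕ) : ℝ :=
  μ ^ n / (Nat.factorial n : ℝ) * Real.exp (-μ)

lemma poissonWeight_nonneg {μ : ℝ} (hμ : 0 ≤ μ) (n : ℕ) : 0 ≤ poissonWeight μ n := by
  unfold poissonWeight; positivity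

lemma measurable_poissonWeight (n : ℕ) : Measurable fun μ => poissonWeight μ n := by
  unfold poissonWeight; fun_prop

lemma poissonWeight_succ (μ : ℝ) (n : ℕ) :
    ((n : ℝ) + 1) * poissonWeight μ (n + 1) = μ * poissonWeight μ n := by
  unfold poissonWeight
  rw [Nat.factorial_succ]
  push_cast
  field_simp
  ring

lemma hasSum_poissonWeight (μ : ℝ) : HasSum (poissonWeight μ) 1 := by
  have h := (NormedSpace.expSeries_div_hasSum_exp (𝔸 := ℝ) μ).mul_right (Real.exp (-μ))
  rw [← Real.exp_eq_exp_ℝ, ← Real.exp_add, add_neg_cancel, Real.exp_zero] at h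
  exact h

lemma hasSum_of_eq {f g : ℕ → ℝ} {a b : ℝ} (h : HasSum f a) (hf : ∀ n, g n = f n) (hb : b = a) :
    HasSum g b := by
  rw [hb, funext hf]
  exact h

lemma hasSum_of_shift {f : ℕ → ℝ} {c : ℝ} (h0 : f 0 = 0) (h : HasSum (fun n => f (n + 1)) c) :
    HasSum f c := by
  have := (hasSum_nat_add_iff (f := f) 1).1 h
  simpa [h0] using this

/-- The Stein identity $E[Nf(N)]=\mu E[f(N+1)]$, by shifting the index in $(n+1)p_{n+1}=\mu p_n$. It
produces the moments below one degree at a time. -/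
lemma hasSum_mul_poissonWeight {μ c : ℝ} {f : ℕ → ℝ}
    (h : HasSum (fun n => f (n + 1) * poissonWeight μ n) c) :
    HasSum (fun n : ℕ => n * f n * poissonWeight μ n) (μ * c) := by
  refine hasSum_of_shift (by simp) ?_
  have h2 := h.mul_left μ
  refine hasSum_of_eq h2 (fun n => ?_) rfl
  have := poissonWeight_succ μ n
  push_cast
  linear_combination f (n + 1) * this

lemma hasSum_nat_mul_poissonWeight (μ : ℝ) :
    HasSum (fun n : ℕ => (n : ℝ) * poissonWeight μ n) μ :=
  hasSum_of_eq (hasSum_mul_poissonWeight (f := fun _ => 1) (c := 1)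
    (by simpa using hasSum_poissonWeight μ)) (fun n => by ring) (by ring)

lemma hasSum_nat_sq_mul_poissonWeight (μ : ℝ) :
    HasSum (fun n : ℕ => (n : ℝ) ^ 2 * poissonWeight μ n) (μ ^ 2 + μ) := by
  have h : HasSum (fun n : ℕ => ((n + 1 : ℕ) : ℝ) * poissonWeight μ n) (μ + 1) :=
    hasSum_of_eq ((hasSum_nat_mul_poissonWeight μ).add (hasSum_poissonWeight μ))
      (fun n => by push_cast; ring) rfl
  exact hasSum_of_eq (hasSum_mul_poissonWeight (f := fun n => n) h) (fun n => by ring) (by ring)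

lemma hasSum_nat_cube_mul_poissonWeight (μ : ℝ) :
    HasSum (fun n : ℕ => (n : ℝ) ^ 3 * poissonWeight μ n) (μ ^ 3 + 3 * μ ^ 2 + μ) := by
  have h : HasSum (fun n : ℕ => ((n + 1 : ℕ) : ℝ) ^ 2 * poissonWeight μ n)
      (μ ^ 2 + μ + 2 * μ + 1) :=
    hasSum_of_eq (((hasSum_nat_sq_mul_poissonWeight μ).add
      ((hasSum_nat_mul_poissonWeight μ).mul_left 2)).add (hasSum_poissonWeight μ))
      (fun n => by push_cast; ring) rfl
  exact hasSum_of_eq (hasSum_mul_poissonWeight (f := fun n => (n : ℝ) ^ 2) h) (fun n => by ring)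
    (by ring)

lemma hasSum_succ_mul_sq_sub_mul_poissonWeight (μ : ℝ) :
    HasSum (fun n : ℕ => ((n : ℝ) + 1) * (μ - (n + 1)) ^ 2 * poissonWeight μ n)
      (μ ^ 2 + 5 * μ + 1) :=
  hasSum_of_eq ((((hasSum_nat_cube_mul_poissonWeight μ).add
    ((hasSum_nat_sq_mul_poissonWeight μ).mul_left (3 - 2 * μ))).add
    ((hasSum_nat_mul_poissonWeight μ).mul_left (3 - 4 * μ + μ ^ 2))).add
    ((hasSum_poissonWeight μ).mul_left (1 - 2 * μ + μ ^ 2))) (fun n => by ring) (by ring)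

/-- The chi-square type distance between $\mu$ and $N+1$ is bounded uniformly in $\mu$; comparing
with $N+1$ instead of $N$ keeps the denominator positive. After expansion the term $\mu^2/(n+1)$
turns $p_n$ into $\mu p_{n+1}$. -/
lemma hasSum_sq_sub_div_succ_mul_poissonWeight (μ : ℝ) :
    HasSum (fun n : ℕ => (μ - (n + 1)) ^ 2 / ((n : ℝ) + 1) * poissonWeight μ n)
      (1 - μ * Real.exp (-μ)) := by
  have h : HasSum (fun n : ℕ => poissonWeight μ (n + 1)) (1 - Real.exp (-μ)) := by
    have h1 := (hasSum_nat_add_iff' (f := poissonWeight μ) 1).2 (hasSum_poissonWeight μ)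
    simpa [poissonWeight] using h1
  refine hasSum_of_eq (((hasSum_nat_mul_poissonWeight μ).add
    ((hasSum_poissonWeight μ).mul_left (1 - 2 * μ))).add (h.mul_left μ)) (fun n => ?_) (by ring)
  have h2 := poissonWeight_succ μ n
  have h3 : poissonWeight μ (n + 1) = μ * poissonWeight μ n / ((n : ℝ) + 1) := by
    rw [← h2]; field_simp
  rw [h3]
  field_simp
  ring

/-! ### Slowly varying weights and their cost. -/

/-- The reciprocal of a slowly varying weight, which decays like a cube at infinity. -/
noncomputable def slowInv (β κ w : ℝ) : ℝ := 1 + β * Real.log (1 + |w|) + (κ * |w|) ^ 3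

lemma one_add_log_le_slowInv {β κ : ℝ} (hκ : 0 ≤ κ) (w : ℝ) :
    1 + β * Real.log (1 + |w|) ≤ slowInv β κ w := by
  unfold slowInv
  have : 0 ≤ (κ * |w|) ^ 3 := by positivity
  linarith

lemma one_add_cube_le_slowInv {β κ : ℝ} (hβ : 0 ≤ β) (w : ℝ) :
    1 + (κ * |w|) ^ 3 ≤ slowInv β κ w := by
  unfold slowInv
  have : 0 ≤ Real.log (1 + |w|) := Real.log_nonneg (by simp)
  nlinarith [mul_nonneg hβ this]

lemma one_le_slowInv {β κ : ℝ} (hβ : 0 ≤ β) (hκ : 0 ≤ κ) (w : ℝ) : 1 ≤ slowInv β κ w := by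
  have := one_add_cube_le_slowInv (κ := κ) hβ w
  have : 0 ≤ (κ * |w|) ^ 3 := by positivity
  linarith

lemma slowInv_pos {β κ : ℝ} (hβ : 0 ≤ β) (hκ : 0 ≤ κ) (w : ℝ) : 0 < slowInv β κ w :=
  one_pos.trans_le (one_le_slowInv hβ hκ w)

/-- The factor $8=2^3$ is the doubling constant of the cube; the logarithm at most doubles because
$1+2v\le(1+v)^2$. -/
lemma slowInv_two_mul_le {β κ : ℝ} (hβ : 0 ≤ β) {v : ℝ} (hv : 0 ≤ v) :
    slowInv β κ (2 * v) ≤ 8 * slowInv β κ v := by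
  unfold slowInv
  rw [abs_of_nonneg hv, abs_of_nonneg (by positivity)]
  have h0 : 0 ≤ Real.log (1 + v) := Real.log_nonneg (by linarith)
  have h1 : Real.log (1 + 2 * v) ≤ 2 * Real.log (1 + v) := by
    rw [← Real.log_rpow (by positivity)]
    apply Real.log_le_log (by positivity)
    norm_num
    nlinarith
  have := mul_le_mul_of_nonneg_left h1 hβ
  nlinarith [mul_nonneg hβ h0]

lemma slowInv_mono {β κ : ℝ} (hβ : 0 ≤ β) (hκ : 0 ≤ κ) {u v : ℝ} (hu : 0 ≤ u)
    (huv : u ≤ v) : slowInv β κ u ≤ slowInv β κ v := by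
  unfold slowInv
  rw [abs_of_nonneg hu, abs_of_nonneg (hu.trans huv)]
  have : Real.log (1 + u) ≤ Real.log (1 + v) := Real.log_le_log (by positivity) (by linarith)
  gcongr

/-- A lower bound affine in $w$, so that a posterior mean of the weight can be bounded below from
the posterior mean of $w$ alone. Up to $2v$ it follows from monotonicity and doubling; beyond $2v$
the left side is negative. -/
lemma inv_slowInv_lower_bound {β κ : ℝ} (hβ : 0 ≤ β) (hκ : 0 ≤ κ)
    {v w : ℝ} (hv : 0 < v) (hw : 0 ≤ w) :
    (slowInv β κ v)⁻¹ / 8 * (1 - w / (2 * v)) ≤ (slowInv β κ w)⁻¹ := by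
  have hp := slowInv_pos hβ hκ v
  have hp' := slowInv_pos hβ hκ w
  rcases le_or_gt w (2 * v) with h | h
  · have h1 : slowInv β κ w ≤ 8 * slowInv β κ v :=
      (slowInv_mono hβ hκ hw h).trans (slowInv_two_mul_le hβ hv.le)
    have h2 : (slowInv β κ v)⁻¹ / 8 ≤ (slowInv β κ w)⁻¹ := by
      rw [← one_div, ← one_div, div_div]
      exact one_div_le_one_div_of_le hp' (by linarith)
    refine le_trans (mul_le_of_le_one_right (by positivity) ?_) h2
    have : 0 ≤ w / (2 * v) := by positivity
    linarith
  · have : 1 < w / (2 * v) := by rwa [one_lt_div (by positivity)]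
    refine le_trans (mul_nonpos_of_nonneg_of_nonpos (by positivity) (by linarith)) (by positivity)

/-- With $\varphi$ for `slowInv`, the left side is
$(\varphi(w)-\varphi(v))^2/(\varphi(v)\varphi(w)^2)$. The logarithmic part uses `sq_log_le` and
$\varphi(v)\ge1$. The cubic part produces $w^4$ and $v^4$; dividing by $\varphi(v)\ge\kappa v$ in
the first and by $\varphi(v)\ge(\kappa v)^3$ in the second leaves only $(w-v)^2/v$ and $v(w-v)^2$,
whose Poisson means at $v=(n+1)/s$ are explicit. -/
lemma sq_sub_inv_slowInv_le {β κ : ℝ} (hβ : 0 ≤ β) (hκ : 0 ≤ κ) {v w : ℝ}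
    (hv : 0 < v) (hw : 0 < w) :
    ((slowInv β κ w)⁻¹ - (slowInv β κ v)⁻¹) ^ 2 / (slowInv β κ v)⁻¹ ≤
      ((2 * β ^ 2 / (1 + w) + 9 * κ ^ 5 * w ^ 4) * ((w - v) ^ 2 / v) +
        9 * κ ^ 3 * (v * (w - v) ^ 2)) / slowInv β κ w ^ 2 := by
  have hp := slowInv_pos hβ hκ v
  have hp' := slowInv_pos hβ hκ w
  have hp1 := one_le_slowInv hβ hκ v
  have e : ((slowInv β κ w)⁻¹ - (slowInv β κ v)⁻¹) ^ 2 / (slowInv β κ v)⁻¹ =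
      ((slowInv β κ w - slowInv β κ v) ^ 2 / slowInv β κ v) / slowInv β κ w ^ 2 := by
    field_simp
    ring
  rw [e]
  refine div_le_div_of_nonneg_right ?_ (by positivity)
  have hcube := one_add_cube_le_slowInv (κ := κ) hβ v
  rw [abs_of_pos hv] at hcube
  have hlin : κ * v ≤ slowInv β κ v := by
    have : 0 ≤ κ * v := by positivity
    nlinarith [sq_nonneg (κ * v - 1), mul_nonneg this (sq_nonneg (κ * v - 1)), sq_nonneg (κ * v)]
  have hc3 : (κ * v) ^ 3 ≤ slowInv β κ v := by linarith
  have hd : slowInv β κ w - slowInv β κ v =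
      β * Real.log ((1 + w) / (1 + v)) + κ ^ 3 * (w ^ 3 - v ^ 3) := by
    unfold slowInv
    rw [abs_of_pos hv, abs_of_pos hw, Real.log_div (by positivity) (by positivity)]
    ring
  have h1 : (slowInv β κ w - slowInv β κ v) ^ 2 ≤
      2 * β ^ 2 * Real.log ((1 + w) / (1 + v)) ^ 2 + 2 * κ ^ 6 * (w ^ 3 - v ^ 3) ^ 2 := by
    rw [hd]
    nlinarith [sq_nonneg (β * Real.log ((1 + w) / (1 + v)) - κ ^ 3 * (w ^ 3 - v ^ 3))]
  have h2 : Real.log ((1 + w) / (1 + v)) ^ 2 ≤ (w - v) ^ 2 / v / (1 + w) := by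
    refine (sq_log_le (by positivity)).trans ?_
    have : ((1 + w) / (1 + v) - 1) ^ 2 / ((1 + w) / (1 + v)) = (w - v) ^ 2 / (1 + v) / (1 + w) := by
      field_simp
      ring
    rw [this]
    gcongr
    linarith
  have h3 : (w ^ 3 - v ^ 3) ^ 2 ≤ 9 / 2 * (w - v) ^ 2 * (w ^ 4 + v ^ 4) := by
    have e3 : (w ^ 3 - v ^ 3) ^ 2 = (w - v) ^ 2 * (w ^ 2 + w * v + v ^ 2) ^ 2 := by ring
    rw [e3]
    have : (w ^ 2 + w * v + v ^ 2) ^ 2 ≤ 9 / 2 * (w ^ 4 + v ^ 4) := by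
      have a1 : w * v ≤ (w ^ 2 + v ^ 2) / 2 := by nlinarith [sq_nonneg (w - v)]
      have a2 : 0 ≤ w * v := by positivity
      have a3 : (w ^ 2 + w * v + v ^ 2) ^ 2 ≤ (3 / 2 * (w ^ 2 + v ^ 2)) ^ 2 := by
        apply pow_le_pow_left₀ (by positivity); linarith
      nlinarith [sq_nonneg (w ^ 2 - v ^ 2)]
    nlinarith [mul_le_mul_of_nonneg_left this (sq_nonneg (w - v))]
  have h4 : κ ^ 6 * w ^ 4 / slowInv β κ v ≤ κ ^ 5 * w ^ 4 / v := by
    rw [div_le_div_iff₀ hp hv]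
    have : 0 ≤ κ ^ 5 * w ^ 4 := by positivity
    nlinarith [mul_le_mul_of_nonneg_left hlin this]
  have h5 : κ ^ 6 * v ^ 4 / slowInv β κ v ≤ κ ^ 3 * v := by
    rw [div_le_iff₀ hp]
    have : 0 ≤ κ ^ 3 * v := by positivity
    nlinarith [mul_le_mul_of_nonneg_left hc3 this]
  have h6 : 2 * β ^ 2 * Real.log ((1 + w) / (1 + v)) ^ 2 / slowInv β κ v ≤
      2 * β ^ 2 / (1 + w) * ((w - v) ^ 2 / v) := by
    refine (div_le_self (by positivity) hp1).trans ?_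
    calc _ ≤ 2 * β ^ 2 * ((w - v) ^ 2 / v / (1 + w)) := by gcongr
      _ = _ := by ring
  calc (slowInv β κ w - slowInv β κ v) ^ 2 / slowInv β κ v
      ≤ (2 * β ^ 2 * Real.log ((1 + w) / (1 + v)) ^ 2 +
          2 * κ ^ 6 * (9 / 2 * (w - v) ^ 2 * (w ^ 4 + v ^ 4))) / slowInv β κ v := by
        gcongr
        refine h1.trans ?_
        gcongr
    _ = 2 * β ^ 2 * Real.log ((1 + w) / (1 + v)) ^ 2 / slowInv β κ v +
        9 * (w - v) ^ 2 * (κ ^ 6 * w ^ 4 / slowInv β κ v) +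
        9 * (w - v) ^ 2 * (κ ^ 6 * v ^ 4 / slowInv β κ v) := by ring
    _ ≤ 2 * β ^ 2 / (1 + w) * ((w - v) ^ 2 / v) + 9 * (w - v) ^ 2 * (κ ^ 5 * w ^ 4 / v) +
        9 * (w - v) ^ 2 * (κ ^ 3 * v) := by gcongr
    _ = _ := by ring

lemma measurable_slowInv (β κ : ℝ) : Measurable (slowInv β κ) := by
  unfold slowInv; fun_prop

lemma tsum_ofReal_poissonWeight_mul_le {μ c : ℝ} (hμ : 0 ≤ μ) {f g : ℕ → ℝ} (hf : ∀ n, 0 ≤ f n)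
    (hfg : ∀ n, f n ≤ g n) (hg : HasSum (fun n => g n * poissonWeight μ n) c) :
    ∑' n, ENNReal.ofReal (poissonWeight μ n) * ENNReal.ofReal (f n) ≤ ENNReal.ofReal c := by
  rw [← hg.tsum_eq, ENNReal.ofReal_tsum_of_nonneg
    (fun n => mul_nonneg ((hf n).trans (hfg n)) (poissonWeight_nonneg hμ n)) hg.summable]
  refine ENNReal.tsum_le_tsum fun n => ?_
  rw [mul_comm, ← ENNReal.ofReal_mul (hf n)]
  exact ENNReal.ofReal_le_ofReal
    (mul_le_mul_of_nonneg_right (hfg n) (poissonWeight_nonneg hμ n))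

lemma hasSum_sq_sub_div_mul_poissonWeight {s : ℝ} (hs : 0 < s) (w : ℝ) :
    HasSum (fun n : ℕ => (w - (n + 1) / s) ^ 2 / (((n : ℝ) + 1) / s) * poissonWeight (s * w) n)
      ((1 - s * w * Real.exp (-(s * w))) / s) :=
  hasSum_of_eq ((hasSum_sq_sub_div_succ_mul_poissonWeight (s * w)).mul_left (1 / s))
    (fun n => by field_simp) (by ring)

lemma hasSum_mul_sq_sub_mul_poissonWeight {s : ℝ} (hs : 0 < s) (w : ℝ) :
    HasSum (fun n : ℕ => ((n : ℝ) + 1) / s * (w - (n + 1) / s) ^ 2 * poissonWeight (s * w) n)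
      (((s * w) ^ 2 + 5 * (s * w) + 1) / s ^ 3) :=
  hasSum_of_eq ((hasSum_succ_mul_sq_sub_mul_poissonWeight (s * w)).mul_left (1 / s ^ 3))
    (fun n => by field_simp) (by ring)

lemma tsum_slowInv_cost_le {β κ s w : ℝ} (hβ : 0 ≤ β) (hκ : 0 ≤ κ) (hs : 0 < s) (hw : 0 < w) :
    ∑' n : ℕ, ENNReal.ofReal (poissonWeight (s * w) n) *
        ENNReal.ofReal (((slowInv β κ w)⁻¹ - (slowInv β κ ((n + 1) / s))⁻¹) ^ 2 /
          (slowInv β κ ((n + 1) / s))⁻¹) ≤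
      ENNReal.ofReal (((2 * β ^ 2 / (1 + w) + 9 * κ ^ 5 * w ^ 4) / s +
        9 * κ ^ 3 * (((s * w) ^ 2 + 5 * (s * w) + 1) / s ^ 3)) / slowInv β κ w ^ 2) := by
  have h0 := slowInv_pos hβ hκ
  have hA : 0 ≤ 2 * β ^ 2 / (1 + w) + 9 * κ ^ 5 * w ^ 4 := by positivity
  refine (tsum_ofReal_poissonWeight_mul_le (by positivity)
    (fun n => div_nonneg (sq_nonneg _) (inv_nonneg.2 (h0 _).le))
    (fun n => sq_sub_inv_slowInv_le hβ hκ (v := ((n : ℝ) + 1) / s) (by positivity) hw)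
    (hasSum_of_eq ((((hasSum_sq_sub_div_mul_poissonWeight hs w).mul_left
      (2 * β ^ 2 / (1 + w) + 9 * κ ^ 5 * w ^ 4)).add
      ((hasSum_mul_sq_sub_mul_poissonWeight hs w).mul_left (9 * κ ^ 3))).mul_left
      (1 / slowInv β κ w ^ 2)) (fun n => by ring) rfl)).trans ?_
  refine ENNReal.ofReal_le_ofReal ?_
  rw [one_div, inv_mul_eq_div]
  refine div_le_div_of_nonneg_right ?_ (by have := h0 w; positivity)
  have h1 : (1 - s * w * Real.exp (-(s * w))) / s ≤ 1 / s := by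
    gcongr
    have : 0 < s * w * Real.exp (-(s * w)) := by positivity
    linarith
  have := mul_le_mul_of_nonneg_left h1 hA
  rw [mul_one_div] at this
  linarith

lemma lintegral_Ioi_inv_mul_log_sq_le {β : ℝ} (hβ : 0 < β) :
    ∫⁻ w in Ioi (0 : ℝ), ENNReal.ofReal (1 / ((1 + w) * (1 + β * Real.log (1 + w)) ^ 2)) ≤
      ENNReal.ofReal (1 / β) := by
  have hlog : ∀ w : ℝ, 0 ≤ w → 0 < 1 + β * Real.log (1 + w) := fun w hw => by
    have := mul_nonneg hβ.le (Real.log_nonneg (by linarith : (1 : ℝ) ≤ 1 + w))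
    linarith
  -- An antiderivative of the integrand that vanishes at infinity and equals $-1/\beta$ at $0$.
  let g : ℝ → ℝ := fun w => -(1 / β) * (1 + β * Real.log (1 + w))⁻¹
  have hderiv : ∀ w : ℝ, 0 ≤ w →
      HasDerivAt g (1 / ((1 + w) * (1 + β * Real.log (1 + w)) ^ 2)) w := fun w hw => by
    have h1 : HasDerivAt (fun w : ℝ => 1 + β * Real.log (1 + w)) (β * (1 / (1 + w))) w :=
      ((((hasDerivAt_id w).const_add 1).log (by simp; linarith)).const_mul β).const_add 1
    convert! (h1.inv (hlog w hw).ne').const_mul (-(1 / β)) using 1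
    have := hlog w hw
    field_simp
  have hnn : ∀ w ∈ Ioi (0 : ℝ), 0 ≤ 1 / ((1 + w) * (1 + β * Real.log (1 + w)) ^ 2) :=
    fun w hw => by
      have : (0 : ℝ) < w := hw
      positivity
  have hlim : Tendsto g atTop (𝓝 0) := by
    have h1 : Tendsto (fun w : ℝ => 1 + β * Real.log (1 + w)) atTop atTop :=
      tendsto_atTop_add_const_left _ _ ((Real.tendsto_log_atTop.comp
        (tendsto_atTop_add_const_left _ _ tendsto_id)).const_mul_atTop hβ)
    have h2 := h1.inv_tendsto_atTop.const_mul (-(1 / β))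
    rw [mul_zero] at h2
    exact h2
  have hcont : ContinuousWithinAt g (Ici 0) 0 := (hderiv 0 le_rfl).continuousAt.continuousWithinAt
  rw [← ofReal_integral_eq_lintegral_ofReal
    (integrableOn_Ioi_deriv_of_nonneg hcont (fun w hw => hderiv w (le_of_lt hw)) hnn hlim)
    ((ae_restrict_iff' measurableSet_Ioi).2 (ae_of_all _ hnn)),
    integral_Ioi_of_hasDerivAt_of_nonneg hcont (fun w hw => hderiv w (le_of_lt hw)) hnn hlim]
  simp [g]

lemma lintegral_Ioc_rpow {a : ℝ} (ha : 0 < a) :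
    ∫⁻ w in Ioc (0 : ℝ) 1, ENNReal.ofReal (w ^ (a - 1)) = ENNReal.ofReal (1 / a) := by
  rw [← ofReal_integral_eq_lintegral_ofReal]
  · rw [← intervalIntegral.integral_of_le zero_le_one, integral_rpow (Or.inl (by linarith))]
    simp [Real.zero_rpow ha.ne']
  · exact (intervalIntegrable_iff_integrableOn_Ioc_of_le zero_le_one).1
      (intervalIntegral.intervalIntegrable_rpow' (by linarith))
  · exact (ae_restrict_iff' measurableSet_Ioc).2
      (ae_of_all _ fun w hw => Real.rpow_nonneg hw.1.le _)

/-- The limiting profile of the cost at the scale where the cubic term takes over. -/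
noncomputable def tailCost (β κ x : ℝ) : ℝ :=
  (x ^ 4 + x ^ 2) / (1 + β * Real.log (1 + |x| / κ) + |x| ^ 3) ^ 2

/-- Dominated convergence as $\kappa=1/(n+1)\to0$ with $\beta$ fixed: $\log(1+x/\kappa)\to\infty$
for each $x>0$, and dropping the logarithm gives an integrable bound independent of $\kappa$. -/
lemma tendsto_lintegral_tailCost {β : ℝ} (hβ : 0 < β) :
    Tendsto (fun n : ℕ => ∫⁻ x in Ioi (0 : ℝ), ENNReal.ofReal (tailCost β (1 / ((n : ℝ) + 1)) x))
      atTop (𝓝 0) := by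
  have hlog : ∀ (n : ℕ) (x : ℝ), 0 ≤ β * Real.log (1 + |x| / (1 / ((n : ℝ) + 1))) := fun n x =>
    mul_nonneg hβ.le (Real.log_nonneg (by
      have : 0 ≤ |x| / (1 / ((n : ℝ) + 1)) := by positivity
      linarith))
  have key := tendsto_lintegral_of_dominated_convergence (μ := volume.restrict (Ioi (0 : ℝ)))
    (F := fun (n : ℕ) x => ENNReal.ofReal (tailCost β (1 / ((n : ℝ) + 1)) x)) (f := fun _ => 0)
    (fun x => ENNReal.ofReal (2 * (1 + x ^ 2)⁻¹)) ?_ ?_ ?_ ?_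
  · simpa using key
  · intro n
    unfold tailCost
    fun_prop
  · intro n
    refine (ae_restrict_iff' measurableSet_Ioi).2 (ae_of_all _ fun x hx => ?_)
    have hx' : (0 : ℝ) < x := hx
    refine ENNReal.ofReal_le_ofReal ?_
    have h1 : (1 + x ^ 3) ^ 2 ≤ (1 + β * Real.log (1 + |x| / (1 / ((n : ℝ) + 1))) + |x| ^ 3) ^ 2 := by
      have := hlog n x
      rw [abs_of_pos hx'] at this ⊢
      gcongr
      linarith
    unfold tailCost
    refine (div_le_div_of_nonneg_left (by positivity) (by positivity) h1).trans ?_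
    rw [← div_eq_mul_inv, div_le_div_iff₀ (by positivity) (by positivity)]
    have : 2 * x ^ 2 ≤ 2 + 4 * x ^ 3 := by
      nlinarith [mul_nonneg hx'.le (sq_nonneg (x - 1)), sq_nonneg (x - 1)]
    nlinarith [sq_nonneg (x ^ 3 - x), this]
  · have hi : Integrable (fun x : ℝ => 2 * (1 + x ^ 2)⁻¹) (volume.restrict (Ioi (0 : ℝ))) :=
      (integrable_inv_one_add_sq.const_mul 2).restrict
    exact ((hasFiniteIntegral_iff_ofReal (ae_of_all _ fun x => by positivity)).1 hi.2).ne
  · refine (ae_restrict_iff' measurableSet_Ioi).2 (ae_of_all _ fun x hx => ?_)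
    have hx' : (0 : ℝ) < x := hx
    rw [show (0 : ℝ≥0∞) = ENNReal.ofReal 0 by simp]
    refine ENNReal.tendsto_ofReal ?_
    unfold tailCost
    refine Tendsto.div_atTop tendsto_const_nhds ?_
    refine (tendsto_pow_atTop two_ne_zero).comp ?_
    refine tendsto_atTop_add_const_right _ _ (tendsto_atTop_add_const_left _ _ ?_)
    refine (Real.tendsto_log_atTop.comp (tendsto_atTop_add_const_left _ _ ?_)).const_mul_atTop hβ
    have : (fun n : ℕ => |x| / (1 / ((n : ℝ) + 1))) = fun n : ℕ => |x| * ((n : ℝ) + 1) := by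
      funext n; field_simp
    rw [this]
    exact (tendsto_atTop_add_const_right _ _ tendsto_natCast_atTop_atTop).const_mul_atTop
      (abs_pos.2 hx'.ne')

lemma lintegral_Ioi_comp_mul_left (f : ℝ → ℝ≥0∞) {c : ℝ} (hc : 0 < c) :
    ENNReal.ofReal c * ∫⁻ x in Ioi (0 : ℝ), f (c * x) = ∫⁻ x in Ioi (0 : ℝ), f x := by
  have hemb : MeasurableEmbedding (fun x : ℝ => c * x) :=
    (Homeomorph.mulLeft₀ c hc.ne').measurableEmbedding
  conv_rhs => rw [← Real.smul_map_volume_mul_left hc.ne', abs_of_pos hc, Measure.restrict_smul,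
    lintegral_smul_measure, hemb.restrict_map, hemb.lintegral_map, smul_eq_mul,
    show (fun x : ℝ => c * x) ⁻¹' Ioi 0 = Ioi 0 by ext x; simp [hc]]

/-- The cost of the weight `h` in the comparison of Bayes risks. -/
noncomputable def weightCost (a s : ℝ) (h : ℝ → ℝ) : ℝ≥0∞ :=
  ∫⁻ w in Ioi (0 : ℝ), ENNReal.ofReal (w ^ (a - 1)) *
    ∑' n : ℕ, ENNReal.ofReal (poissonWeight (s * w) n) *
      ENNReal.ofReal ((h w - h ((n + 1) / s)) ^ 2 / h ((n + 1) / s))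

lemma rpow_sub_one_le_one {a w : ℝ} (ha : a ≤ 1) (hw : 1 ≤ w) : w ^ (a - 1) ≤ 1 :=
  Real.rpow_le_one_of_one_le_of_nonpos hw (by linarith)

/-- The integral is split at $w=1$. Near zero $w^{a-1}$ has integral $1/a$ and the other factor is
$O(\beta+\kappa)$. Beyond $1$ the factor $w^{a-1}$ is at most $1$; the logarithmic part contributes
$\beta^2\cdot\beta^{-1}$ and the cubic part becomes `tailCost` after the substitution $x=\kappa w$.
-/
lemma weightCost_slowInv_le {a s β κ : ℝ} (ha : 0 < a) (ha1 : a ≤ 1) (hs : 0 < s) (hβ : 0 < β)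
    (hβ1 : β ≤ 1) (hκ : 0 < κ) (hκ1 : κ ≤ 1) :
    weightCost a s (fun w => (slowInv β κ w)⁻¹) ≤
      ENNReal.ofReal (β * (2 / s / a + 2 / s) +
        κ * ((9 / s + 9 * (s ^ 2 + 5 * s + 1) / s ^ 3) / a)) +
      ENNReal.ofReal (9 / s + 9 * (s ^ 2 + 5 * s + 1) / s ^ 3) *
        ∫⁻ x in Ioi (0 : ℝ), ENNReal.ofReal (tailCost β κ x) := by
  set C := 9 / s + 9 * (s ^ 2 + 5 * s + 1) / s ^ 3 with hC
  have hCpos : 0 ≤ C := by positivity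
  have hφ := one_le_slowInv hβ.le hκ.le
  have hβ2 : β ^ 2 ≤ β := by nlinarith
  have hlog : ∀ w : ℝ, 0 ≤ w → 0 ≤ β * Real.log (1 + w) := fun w hw =>
    mul_nonneg hβ.le (Real.log_nonneg (by linarith))
  have hsmall : ∫⁻ w in Ioc (0 : ℝ) 1, ENNReal.ofReal (w ^ (a - 1)) *
      ∑' n : ℕ, ENNReal.ofReal (poissonWeight (s * w) n) *
        ENNReal.ofReal (((slowInv β κ w)⁻¹ - (slowInv β κ ((n + 1) / s))⁻¹) ^ 2 /
          (slowInv β κ ((n + 1) / s))⁻¹) ≤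
      ENNReal.ofReal (1 / a) * ENNReal.ofReal (β * (2 / s) + κ * C) := by
    rw [← lintegral_Ioc_rpow ha, ← lintegral_mul_const' _ _ ENNReal.ofReal_ne_top]
    refine setLIntegral_mono' measurableSet_Ioc fun w hw => ?_
    have hw0 := hw.1
    have hw1 := hw.2
    gcongr
    refine (tsum_slowInv_cost_le hβ.le hκ.le hs hw0).trans (ENNReal.ofReal_le_ofReal ?_)
    refine (div_le_self (by positivity) (one_le_pow₀ (hφ w))).trans ?_
    have h1 : 2 * β ^ 2 / (1 + w) ≤ 2 * β :=
      (div_le_self (by positivity) (by linarith)).trans (by linarith)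
    have h2 : κ ^ 5 * w ^ 4 ≤ κ * 1 :=
      mul_le_mul (pow_le_of_le_one hκ.le hκ1 (by norm_num)) (pow_le_one₀ hw0.le hw1)
        (by positivity) hκ.le
    have h3 : κ ^ 3 ≤ κ := pow_le_of_le_one hκ.le hκ1 (by norm_num)
    calc (2 * β ^ 2 / (1 + w) + 9 * κ ^ 5 * w ^ 4) / s +
          9 * κ ^ 3 * (((s * w) ^ 2 + 5 * (s * w) + 1) / s ^ 3)
        ≤ (2 * β + 9 * κ) / s + 9 * κ * (((s * 1) ^ 2 + 5 * (s * 1) + 1) / s ^ 3) := by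
          have h4 : 2 * β ^ 2 / (1 + w) + 9 * κ ^ 5 * w ^ 4 ≤ 2 * β + 9 * κ := by linarith
          refine add_le_add (div_le_div_of_nonneg_right h4 hs.le) ?_
          gcongr
      _ = β * (2 / s) + κ * C := by rw [hC]; ring
  have hlarge : ∫⁻ w in Ioi (1 : ℝ), ENNReal.ofReal (w ^ (a - 1)) *
      ∑' n : ℕ, ENNReal.ofReal (poissonWeight (s * w) n) *
        ENNReal.ofReal (((slowInv β κ w)⁻¹ - (slowInv β κ ((n + 1) / s))⁻¹) ^ 2 /
          (slowInv β κ ((n + 1) / s))⁻¹) ≤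
      ENNReal.ofReal (2 * β ^ 2 / s) * ENNReal.ofReal (1 / β) +
        ENNReal.ofReal C * ∫⁻ x in Ioi (0 : ℝ), ENNReal.ofReal (tailCost β κ x) := by
    calc _ ≤ ∫⁻ w in Ioi (1 : ℝ), (ENNReal.ofReal (2 * β ^ 2 / s) *
            ENNReal.ofReal (1 / ((1 + w) * (1 + β * Real.log (1 + w)) ^ 2)) +
            ENNReal.ofReal C * (ENNReal.ofReal κ * ENNReal.ofReal (tailCost β κ (κ * w)))) := by
          refine setLIntegral_mono' measurableSet_Ioi fun w hw => ?_
          have hw1 : (1 : ℝ) < w := hw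
          have hw0 : 0 < w := by linarith
          refine (mul_le_of_le_one_left zero_le ?_).trans
            ((tsum_slowInv_cost_le hβ.le hκ.le hs hw0).trans ?_)
          · rw [← ENNReal.ofReal_one]
            exact ENNReal.ofReal_le_ofReal (rpow_sub_one_le_one ha1 hw1.le)
          have hL := hlog w hw0.le
          have hT : tailCost β κ (κ * w) = ((κ * w) ^ 4 + (κ * w) ^ 2) / slowInv β κ w ^ 2 := by
            unfold tailCost slowInv
            rw [abs_of_pos hw0, abs_of_pos (by positivity), mul_div_cancel_left₀ _ hκ.ne']
          have hlow : (1 + β * Real.log (1 + w)) ^ 2 ≤ slowInv β κ w ^ 2 := by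
            have := one_add_log_le_slowInv (β := β) hκ.le w
            rw [abs_of_pos hw0] at this
            gcongr
          have hp := slowInv_pos hβ.le hκ.le w
          rw [← ENNReal.ofReal_mul (by positivity), ← ENNReal.ofReal_mul hκ.le,
            ← ENNReal.ofReal_mul hCpos, ← ENNReal.ofReal_add (by positivity)
              (by rw [hT]; positivity)]
          refine ENNReal.ofReal_le_ofReal ?_
          rw [hT]
          have h2 : 9 * κ ^ 3 * (((s * w) ^ 2 + 5 * (s * w) + 1) / s ^ 3) ≤
              9 * (s ^ 2 + 5 * s + 1) / s ^ 3 * (κ * (κ * w) ^ 2) := by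
            have : (s * w) ^ 2 + 5 * (s * w) + 1 ≤ (s ^ 2 + 5 * s + 1) * w ^ 2 := by
              have e1 : s * w ≤ s * w ^ 2 := by gcongr; nlinarith
              nlinarith
            calc _ ≤ 9 * κ ^ 3 * ((s ^ 2 + 5 * s + 1) * w ^ 2 / s ^ 3) := by gcongr
              _ = _ := by ring
          have h3 : 9 * (s ^ 2 + 5 * s + 1) / s ^ 3 * (κ * (κ * w) ^ 2) + 9 * κ ^ 5 * w ^ 4 / s ≤
              C * (κ * ((κ * w) ^ 4 + (κ * w) ^ 2)) := by
            have e2 : C * (κ * ((κ * w) ^ 4 + (κ * w) ^ 2)) =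
              9 * (s ^ 2 + 5 * s + 1) / s ^ 3 * (κ * (κ * w) ^ 2) + 9 * κ ^ 5 * w ^ 4 / s +
              (9 / s * (κ * (κ * w) ^ 2) +
                9 * (s ^ 2 + 5 * s + 1) / s ^ 3 * (κ * (κ * w) ^ 4)) := by
              rw [hC]; ring
            rw [e2]
            have : 0 ≤ 9 / s * (κ * (κ * w) ^ 2) +
                9 * (s ^ 2 + 5 * s + 1) / s ^ 3 * (κ * (κ * w) ^ 4) := by positivity
            linarith
          calc ((2 * β ^ 2 / (1 + w) + 9 * κ ^ 5 * w ^ 4) / s +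
                9 * κ ^ 3 * (((s * w) ^ 2 + 5 * (s * w) + 1) / s ^ 3)) / slowInv β κ w ^ 2
              ≤ (2 * β ^ 2 / s / (1 + w) + C * (κ * ((κ * w) ^ 4 + (κ * w) ^ 2))) /
                  slowInv β κ w ^ 2 := by
                refine div_le_div_of_nonneg_right ?_ (by positivity)
                have : (2 * β ^ 2 / (1 + w) + 9 * κ ^ 5 * w ^ 4) / s =
                  2 * β ^ 2 / s / (1 + w) + 9 * κ ^ 5 * w ^ 4 / s := by ring
                rw [this]
                linarith
            _ = 2 * β ^ 2 / s / (1 + w) / slowInv β κ w ^ 2 +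
                  C * (κ * (((κ * w) ^ 4 + (κ * w) ^ 2) / slowInv β κ w ^ 2)) := by ring
            _ ≤ 2 * β ^ 2 / s / (1 + w) / (1 + β * Real.log (1 + w)) ^ 2 +
                  C * (κ * (((κ * w) ^ 4 + (κ * w) ^ 2) / slowInv β κ w ^ 2)) := by gcongr
            _ = _ := by
                congr 1
                field_simp
      _ ≤ ∫⁻ w in Ioi (0 : ℝ), (ENNReal.ofReal (2 * β ^ 2 / s) *
            ENNReal.ofReal (1 / ((1 + w) * (1 + β * Real.log (1 + w)) ^ 2)) +
            ENNReal.ofReal C * (ENNReal.ofReal κ * ENNReal.ofReal (tailCost β κ (κ * w)))) :=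
          lintegral_mono_set (Ioi_subset_Ioi zero_le_one)
      _ ≤ _ := by
          rw [lintegral_add_left (by fun_prop), lintegral_const_mul' _ _ ENNReal.ofReal_ne_top,
            lintegral_const_mul' _ _ ENNReal.ofReal_ne_top,
            lintegral_const_mul' _ _ ENNReal.ofReal_ne_top,
            lintegral_Ioi_comp_mul_left (fun x => ENNReal.ofReal (tailCost β κ x)) hκ]
          gcongr
          exact lintegral_Ioi_inv_mul_log_sq_le hβ
  unfold weightCost
  rw [← Ioc_union_Ioi_eq_Ioi (zero_le_one' ℝ)]
  refine (lintegral_union_le _ _ _).trans ((add_le_add hsmall hlarge).trans ?_)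
  rw [Ioc_union_Ioi_eq_Ioi (zero_le_one' ℝ), ← add_assoc, ← ENNReal.ofReal_mul (by positivity),
    ← ENNReal.ofReal_mul (by positivity), ← ENNReal.ofReal_add (by positivity) (by positivity)]
  refine le_of_eq ?_
  congr 2
  have : 2 * β ^ 2 / s * (1 / β) = 2 / s * β := by field_simp
  rw [this]
  ring

/-- The factor $1+w$ is there because estimation needs the weighted prior to have a finite mean of
$w$; the cubic decay still leaves $w^{-2}$ at infinity. -/
lemma lintegral_rpow_mul_inv_slowInv_lt_top {a β κ : ℝ} (ha : 0 < a) (ha1 : a ≤ 1) (hβ : 0 ≤ β)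
    (hκ : 0 < κ) :
    ∫⁻ w in Ioi (0 : ℝ), ENNReal.ofReal (w ^ (a - 1)) *
      ENNReal.ofReal ((1 + w) * (slowInv β κ w)⁻¹) < ∞ := by
  rw [← Ioc_union_Ioi_eq_Ioi (zero_le_one' ℝ)]
  refine (lintegral_union_le _ _ _).trans_lt (ENNReal.add_lt_top.2 ⟨?_, ?_⟩)
  · refine lt_of_le_of_lt (b := ∫⁻ w in Ioc (0 : ℝ) 1, ENNReal.ofReal (w ^ (a - 1)) * 2)
      (setLIntegral_mono' measurableSet_Ioc fun w hw => ?_) ?_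
    · gcongr
      rw [show (2 : ℝ≥0∞) = ENNReal.ofReal 2 by simp]
      refine ENNReal.ofReal_le_ofReal ?_
      have h1 : (slowInv β κ w)⁻¹ ≤ 1 := inv_le_one_of_one_le₀ (one_le_slowInv hβ hκ.le w)
      have := slowInv_pos hβ hκ.le w
      have hw0 := hw.1
      have hw1 := hw.2
      nlinarith [inv_pos.2 this]
    · rw [lintegral_mul_const' _ _ (by simp), lintegral_Ioc_rpow ha]
      exact ENNReal.mul_lt_top ENNReal.ofReal_lt_top (by simp)
  · refine lt_of_le_of_lt (b := ∫⁻ w in Ioi (1 : ℝ), ENNReal.ofReal (2 / κ ^ 3 * w ^ (-2 : ℝ)))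
      (setLIntegral_mono' measurableSet_Ioi fun w hw => ?_) ?_
    · have hw1 : (1 : ℝ) < w := hw
      have hw0 : 0 < w := by linarith
      refine (mul_le_of_le_one_left zero_le ?_).trans (ENNReal.ofReal_le_ofReal ?_)
      · rw [← ENNReal.ofReal_one]
        exact ENNReal.ofReal_le_ofReal (rpow_sub_one_le_one ha1 hw1.le)
      have h1 : (κ * w) ^ 3 ≤ slowInv β κ w := by
        have := one_add_cube_le_slowInv (κ := κ) hβ w
        rw [abs_of_pos hw0] at this
        linarith
      have hp : 0 < (κ * w) ^ 3 := by positivity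
      calc (1 + w) * (slowInv β κ w)⁻¹ ≤ (2 * w) * ((κ * w) ^ 3)⁻¹ :=
            mul_le_mul (by linarith) (inv_anti₀ hp h1) (inv_nonneg.2 (hp.le.trans h1))
              (by positivity)
        _ = 2 / κ ^ 3 * w ^ (-2 : ℝ) := by
            rw [Real.rpow_neg hw0.le, Real.rpow_ofNat]
            field_simp
    · have hi : IntegrableOn (fun w : ℝ => 2 / κ ^ 3 * w ^ (-2 : ℝ)) (Ioi 1) :=
        (integrableOn_Ioi_rpow_of_lt (by norm_num) one_pos).const_mul _
      refine (hasFiniteIntegral_iff_ofReal ?_).1 hi.2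
      refine (ae_restrict_iff' measurableSet_Ioi).2 (ae_of_all _ fun w hw => ?_)
      have hw0 : (0 : ℝ) < w := one_pos.trans hw
      exact mul_nonneg (by positivity) (Real.rpow_nonneg hw0.le _)

/-- Weights on the half-line that are bounded below near the origin, decay fast enough for
integrability and change so slowly that the cost is arbitrarily small. -/
structure IsBlythWeight (a : ℝ) (h : ℝ → ℝ) : Prop where
  measurable : Measurable h
  pos : ∀ w, 0 < h w
  le_one : ∀ w, h w ≤ 1
  lower : ∀ w ∈ Ioc (0 : ℝ) 1, 1 / 3 ≤ h w
  chord : ∀ v w, 0 < v → 0 ≤ w → h v / 8 * (1 - w / (2 * v)) ≤ h w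
  integrable : ∫⁻ w in Ioi (0 : ℝ), ENNReal.ofReal (w ^ (a - 1)) *
    ENNReal.ofReal ((1 + w) * h w) < ∞

lemma isBlythWeight_inv_slowInv {a β κ : ℝ} (ha : 0 < a) (ha1 : a ≤ 1) (hβ : 0 ≤ β)
    (hβ1 : β ≤ 1) (hκ : 0 < κ) (hκ1 : κ ≤ 1) :
    IsBlythWeight a fun w => (slowInv β κ w)⁻¹ where
  measurable := (measurable_slowInv β κ).inv
  pos w := inv_pos.2 (slowInv_pos hβ hκ.le w)
  le_one w := inv_le_one_of_one_le₀ (one_le_slowInv hβ hκ.le w)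
  -- By monotonicity it suffices to look at $w=1$, where $1+\beta\log2+\kappa^3\le3$.
  lower w hw := by
    rw [one_div]
    refine inv_anti₀ (slowInv_pos hβ hκ.le w) ?_
    refine (slowInv_mono hβ hκ.le hw.1.le hw.2).trans ?_
    unfold slowInv
    have h1 : Real.log (1 + |1|) ≤ 1 := by
      have := Real.log_le_sub_one_of_pos (x := 1 + |1|) (by positivity)
      norm_num at this ⊢
      exact this
    have h2 : (κ * |1|) ^ 3 ≤ 1 := pow_le_one₀ (by positivity) (by simpa using hκ1)
    have h0 : 0 ≤ Real.log (1 + |1|) := Real.log_nonneg (by simp)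
    nlinarith
  chord v w hv hw := inv_slowInv_lower_bound hβ hκ.le hv hw
  integrable := lintegral_rpow_mul_inv_slowInv_lt_top ha ha1 hβ hκ

theorem exists_isBlythWeight_weightCost_lt {a s : ℝ} (ha : 0 < a) (ha1 : a ≤ 1) (hs : 0 < s)
    {ε : ℝ} (hε : 0 < ε) : ∃ h, IsBlythWeight a h ∧ weightCost a s h < ENNReal.ofReal ε := by
  set A := 2 / s / a + 2 / s
  have hA : 0 < A := by positivity
  set C := 9 / s + 9 * (s ^ 2 + 5 * s + 1) / s ^ 3
  have hC : 0 < C := by positivity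
  set β := min 1 (ε / (4 * A))
  have hβ : 0 < β := lt_min one_pos (by positivity)
  have hβ1 : β ≤ 1 := min_le_left _ _
  have hβA : β * A ≤ ε / 4 := by
    have : β ≤ ε / (4 * A) := min_le_right _ _
    calc β * A ≤ ε / (4 * A) * A := by gcongr
      _ = ε / 4 := by field_simp
  -- The parameter $\beta$ is fixed before $\kappa$, since the tail integral tends to zero only for
  -- fixed $\beta$. Each of the three contributions then gets $\varepsilon/4$.
  have e1 : ∀ᶠ n : ℕ in atTop,
      ∫⁻ x in Ioi (0 : ℝ), ENNReal.ofReal (tailCost β (1 / ((n : ℝ) + 1)) x) <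
        ENNReal.ofReal (ε / 4 / C) :=
    (tendsto_lintegral_tailCost hβ).eventually_lt_const (by simpa using by positivity)
  have e2 : ∀ᶠ n : ℕ in atTop, 1 / ((n : ℝ) + 1) < ε / 4 / (C / a) :=
    tendsto_one_div_add_atTop_nhds_zero_nat.eventually_lt_const (by positivity)
  obtain ⟨n, h1, h2⟩ := (e1.and e2).exists
  set κ := 1 / ((n : ℝ) + 1)
  have hκ : 0 < κ := by positivity
  have hκ1 : κ ≤ 1 := by
    rw [div_le_one (by positivity)]
    linarith [n.cast_nonneg (α := ℝ)]
  refine ⟨_, isBlythWeight_inv_slowInv ha ha1 hβ.le hβ1 hκ hκ1, ?_⟩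
  refine (weightCost_slowInv_le ha ha1 hs hβ hβ1 hκ hκ1).trans_lt ?_
  have hκC : κ * (C / a) ≤ ε / 4 := by
    rw [lt_div_iff₀ (by positivity)] at h2
    exact h2.le
  calc ENNReal.ofReal (β * A + κ * (C / a)) + ENNReal.ofReal C *
        ∫⁻ x in Ioi (0 : ℝ), ENNReal.ofReal (tailCost β κ x)
      ≤ ENNReal.ofReal (ε / 4 + ε / 4) + ENNReal.ofReal C * ENNReal.ofReal (ε / 4 / C) := by
        gcongr
    _ = ENNReal.ofReal (ε / 4 + ε / 4 + ε / 4) := by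
        rw [← ENNReal.ofReal_mul hC.le, mul_div_cancel₀ _ hC.ne',
          ← ENNReal.ofReal_add (by positivity) (by positivity)]
    _ < ENNReal.ofReal ε := by
        rw [ENNReal.ofReal_lt_ofReal_iff hε]
        linarith

/-! ### The gamma posterior of the total mass, and size-biased means. -/

/-- The unnormalized posterior density of the total mass `w` given the number `n` of points. -/
noncomputable def gammaWeight (a s : ℝ) (n : ℕ) (w : ℝ) : ℝ := w ^ (a - 1) * poissonWeight (s * w) n

lemma gammaWeight_nonneg {a s w : ℝ} (hs : 0 < s) (n : ℕ) (hw : 0 < w) : 0 ≤ gammaWeight a s n w :=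
  mul_nonneg (Real.rpow_nonneg hw.le _) (poissonWeight_nonneg (by positivity) n)

lemma integral_pow_mul_gammaWeight {a s : ℝ} (ha : 0 < a) (hs : 0 < s) (n j : ℕ) :
    ∫ w in Ioi (0 : ℝ), w ^ j * gammaWeight a s n w =
      s ^ n / (n.factorial : ℝ) * ((1 / s) ^ (n + a + j) * Real.Gamma (n + a + j)) := by
  rw [← Real.integral_rpow_mul_exp_neg_mul_Ioi (by positivity) hs, ← integral_const_mul]
  refine setIntegral_congr_fun measurableSet_Ioi fun w hw => ?_
  have hw0 : (0 : ℝ) < w := hw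
  have : w ^ ((n : ℝ) + a + j - 1) = w ^ (a - 1) * w ^ n * w ^ j := by
    rw [← Real.rpow_natCast, ← Real.rpow_natCast, ← Real.rpow_add hw0, ← Real.rpow_add hw0]
    congr 1; ring
  simp only [gammaWeight, poissonWeight, this, mul_pow]
  ring

lemma integral_pow_mul_gammaWeight_pos {a s : ℝ} (ha : 0 < a) (hs : 0 < s) (n j : ℕ) :
    0 < ∫ w in Ioi (0 : ℝ), w ^ j * gammaWeight a s n w := by
  rw [integral_pow_mul_gammaWeight ha hs]
  have := Real.Gamma_pos_of_pos (show 0 < (n : ℝ) + a + j by positivity)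
  positivity

/-- A Bochner integral with a nonzero value can only come from an integrable function, because the
integral is $0$ by default otherwise. -/
lemma integrableOn_pow_mul_gammaWeight {a s : ℝ} (ha : 0 < a) (hs : 0 < s) (n j : ℕ) :
    IntegrableOn (fun w => w ^ j * gammaWeight a s n w) (Ioi (0 : ℝ)) := by
  by_contra h
  exact (integral_pow_mul_gammaWeight_pos ha hs n j).ne' (integral_undef h)

lemma integral_pow_succ_mul_gammaWeight {a s : ℝ} (ha : 0 < a) (hs : 0 < s) (n j : ℕ) :
    ∫ w in Ioi (0 : ℝ), w ^ (j + 1) * gammaWeight a s n w =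
      (n + a + j) / s * ∫ w in Ioi (0 : ℝ), w ^ j * gammaWeight a s n w := by
  rw [integral_pow_mul_gammaWeight ha hs, integral_pow_mul_gammaWeight ha hs]
  push_cast
  have hb : 0 < (n : ℝ) + a + j := by positivity
  rw [← add_assoc, Real.Gamma_add_one hb.ne', Real.rpow_add_one (by positivity)]
  ring

/-- The total mass of `gammaWeight`. -/
noncomputable def gammaMass (a s : ℝ) (n : ℕ) : ℝ := ∫ w in Ioi (0 : ℝ), gammaWeight a s n w

/-- The posterior mean of `h w` given the number `n` of points. -/
noncomputable def gammaMean (a s : ℝ) (h : ℝ → ℝ) (n : ℕ) : ℝ :=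
  (∫ w in Ioi (0 : ℝ), h w * gammaWeight a s n w) / gammaMass a s n

/-- The posterior mean of `h w`, size-biased by `w`, given the number `n` of points. -/
noncomputable def gammaSizeBiasedMean (a s : ℝ) (h : ℝ → ℝ) (n : ℕ) : ℝ :=
  (∫ w in Ioi (0 : ℝ), h w * (w * gammaWeight a s n w)) /
    ∫ w in Ioi (0 : ℝ), w * gammaWeight a s n w

section GammaWeight

variable {a s : ℝ} {h : ℝ → ℝ}

lemma gammaMass_pos (ha : 0 < a) (hs : 0 < s) (n : ℕ) : 0 < gammaMass a s n := by
  simpa [gammaMass] using integral_pow_mul_gammaWeight_pos ha hs n 0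

lemma integrableOn_gammaWeight (ha : 0 < a) (hs : 0 < s) (n : ℕ) :
    IntegrableOn (gammaWeight a s n) (Ioi (0 : ℝ)) := by
  simpa using integrableOn_pow_mul_gammaWeight ha hs n 0

lemma integrableOn_mul_gammaWeight (ha : 0 < a) (hs : 0 < s) (n : ℕ) :
    IntegrableOn (fun w => w * gammaWeight a s n w) (Ioi (0 : ℝ)) := by
  simpa using integrableOn_pow_mul_gammaWeight ha hs n 1

lemma integral_mul_gammaWeight (ha : 0 < a) (hs : 0 < s) (n : ℕ) :
    ∫ w in Ioi (0 : ℝ), w * gammaWeight a s n w = (n + a) / s * gammaMass a s n := by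
  simpa [gammaMass] using integral_pow_succ_mul_gammaWeight ha hs n 0

lemma integral_sq_mul_gammaWeight (ha : 0 < a) (hs : 0 < s) (n : ℕ) :
    ∫ w in Ioi (0 : ℝ), w ^ 2 * gammaWeight a s n w =
      (n + a + 1) / s * ((n + a) / s * gammaMass a s n) := by
  rw [← integral_mul_gammaWeight ha hs]
  simpa using integral_pow_succ_mul_gammaWeight ha hs n 1

lemma integral_sq_sub_mul_gammaWeight (ha : 0 < a) (hs : 0 < s) (n : ℕ) :
    ∫ w in Ioi (0 : ℝ), (w - (n + a) / s) ^ 2 * gammaWeight a s n w =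
      (n + a) / s ^ 2 * gammaMass a s n := by
  have e : ∀ w, (w - (n + a) / s) ^ 2 * gammaWeight a s n w =
      w ^ 2 * gammaWeight a s n w - 2 * ((n + a) / s) * (w * gammaWeight a s n w) +
        ((n + a) / s) ^ 2 * gammaWeight a s n w := fun w => by ring
  simp only [e]
  rw [integral_add, integral_sub, integral_const_mul, integral_const_mul,
    integral_sq_mul_gammaWeight ha hs, integral_mul_gammaWeight ha hs]
  · rw [← gammaMass]; ring
  · exact integrableOn_pow_mul_gammaWeight ha hs n 2
  · exact (integrableOn_mul_gammaWeight ha hs n).const_mul _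
  · exact (integrableOn_pow_mul_gammaWeight ha hs n 2).sub
      ((integrableOn_mul_gammaWeight ha hs n).const_mul _)
  · exact (integrableOn_gammaWeight ha hs n).const_mul _

/-- Cauchy–Schwarz for a density that is only almost everywhere nonnegative: integrating
$(Ag-Cf)^2\rho\ge0$ gives $A(AB-C^2)\ge0$. -/
lemma sq_integral_mul_le {X : Type*} [MeasurableSpace X] {μ : Measure X} {f g ρ : X → ℝ}
    (hρ : 0 ≤ᵐ[μ] ρ) (hf : Integrable (fun x => f x ^ 2 * ρ x) μ)
    (hg : Integrable (fun x => g x ^ 2 * ρ x) μ) (hfg : Integrable (fun x => f x * g x * ρ x) μ)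
    (hpos : 0 < ∫ x, f x ^ 2 * ρ x ∂μ) :
    (∫ x, f x * g x * ρ x ∂μ) ^ 2 ≤ (∫ x, f x ^ 2 * ρ x ∂μ) * ∫ x, g x ^ 2 * ρ x ∂μ := by
  set A := ∫ x, f x ^ 2 * ρ x ∂μ
  set B := ∫ x, g x ^ 2 * ρ x ∂μ
  set C := ∫ x, f x * g x * ρ x ∂μ
  have key : 0 ≤ ∫ x, (A * g x - C * f x) ^ 2 * ρ x ∂μ :=
    integral_nonneg_of_ae (hρ.mono fun x hx => mul_nonneg (sq_nonneg _) hx)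
  have e : ∀ x, (A * g x - C * f x) ^ 2 * ρ x =
      A ^ 2 * (g x ^ 2 * ρ x) - 2 * A * C * (f x * g x * ρ x) + C ^ 2 * (f x ^ 2 * ρ x) :=
    fun x => by ring
  simp only [e] at key
  rw [integral_add, integral_sub (hg.const_mul _) (hfg.const_mul _), integral_const_mul,
    integral_const_mul, integral_const_mul] at key
  rotate_left
  · exact (hg.const_mul _).sub (hfg.const_mul _)
  · exact hf.const_mul _
  have : 0 ≤ A * (A * B - C ^ 2) := by
    calc 0 ≤ A ^ 2 * B - 2 * A * C * C + C ^ 2 * A := key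
      _ = _ := by ring
  have := nonneg_of_mul_nonneg_right this hpos
  linarith

lemma IsBlythWeight.integrable_mul (hh : IsBlythWeight a h) {μ : Measure ℝ} {f : ℝ → ℝ}
    (hf : Integrable f μ) : Integrable (fun w => h w * f w) μ :=
  hf.bdd_mul (c := 1) hh.measurable.aestronglyMeasurable
    (ae_of_all _ fun w => by rw [Real.norm_of_nonneg (hh.pos w).le]; exact hh.le_one w)

lemma IsBlythWeight.integrable_sq_sub_mul (hh : IsBlythWeight a h) (c : ℝ) {μ : Measure ℝ}
    {f : ℝ → ℝ} (hf : Integrable f μ) : Integrable (fun w => (h w - c) ^ 2 * f w) μ := by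
  have e : ∀ w, (h w - c) ^ 2 * f w = h w * (h w * f w) - 2 * c * (h w * f w) + c ^ 2 * f w :=
    fun w => by ring
  simp only [e]
  exact ((hh.integrable_mul (hh.integrable_mul hf)).sub ((hh.integrable_mul hf).const_mul _)).add
    (hf.const_mul _)

/-- The affine bound `chord` at $v=(n+1)/s$ is integrated; the posterior mean of $w$ is $(n+a)/s\le
v$ because $a\le1$, so the bracket $1-w/(2v)$ has mean at least $1/2$. -/
lemma IsBlythWeight.gammaMean_lower (ha : 0 < a) (ha1 : a ≤ 1) (hs : 0 < s)
    (hh : IsBlythWeight a h) (n : ℕ) : h ((n + 1) / s) / 16 ≤ gammaMean a s h n := by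
  set v : ℝ := (n + 1) / s
  have hv : 0 < v := by positivity
  have hM := gammaMass_pos ha hs n
  have hc := hh.pos v
  unfold gammaMean
  rw [le_div_iff₀ hM]
  have h1 : ∫ w in Ioi (0 : ℝ), (h v / 8 * gammaWeight a s n w -
      h v / 8 / (2 * v) * (w * gammaWeight a s n w)) ≤
      ∫ w in Ioi (0 : ℝ), h w * gammaWeight a s n w := by
    refine setIntegral_mono_on (((integrableOn_gammaWeight ha hs n).const_mul _).sub
      ((integrableOn_mul_gammaWeight ha hs n).const_mul _))
      (hh.integrable_mul (integrableOn_gammaWeight ha hs n)) measurableSet_Ioi fun w hw => ?_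
    have hw0 : (0 : ℝ) < w := hw
    calc _ = h v / 8 * (1 - w / (2 * v)) * gammaWeight a s n w := by ring
      _ ≤ _ := mul_le_mul_of_nonneg_right (hh.chord v w hv hw0.le) (gammaWeight_nonneg hs n hw0)
  rw [integral_sub ((integrableOn_gammaWeight ha hs n).const_mul _)
      ((integrableOn_mul_gammaWeight ha hs n).const_mul _), integral_const_mul,
    integral_const_mul, integral_mul_gammaWeight ha hs, ← gammaMass] at h1
  refine le_trans ?_ h1
  have h2 : (n + a) / s ≤ v := div_le_div_of_nonneg_right (by linarith) hs.le
  have h3 : h v / 8 / (2 * v) * ((n + a) / s * gammaMass a s n) ≤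
      h v / 8 / (2 * v) * (v * gammaMass a s n) := by gcongr
  have h4 : h v / 8 / (2 * v) * (v * gammaMass a s n) = h v / 16 * gammaMass a s n := by
    field_simp; norm_num
  linarith

lemma IsBlythWeight.gammaMean_pos (ha : 0 < a) (ha1 : a ≤ 1) (hs : 0 < s)
    (hh : IsBlythWeight a h) (n : ℕ) : 0 < gammaMean a s h n := by
  have := hh.gammaMean_lower ha ha1 hs n
  have := hh.pos ((n + 1) / s)
  linarith

lemma IsBlythWeight.gammaSizeBiasedMean_nonneg (hs : 0 < s)
    (hh : IsBlythWeight a h) (n : ℕ) : 0 ≤ gammaSizeBiasedMean a s h n := by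
  refine div_nonneg (setIntegral_nonneg measurableSet_Ioi fun w hw => ?_)
    (setIntegral_nonneg measurableSet_Ioi fun w hw => ?_)
  · exact mul_nonneg (hh.pos w).le (mul_nonneg (le_of_lt hw) (gammaWeight_nonneg hs n hw))
  · exact mul_nonneg (le_of_lt hw) (gammaWeight_nonneg hs n hw)

/-- The size-biased mean minus the mean of $h$ is the posterior covariance of $w$ and $h(w)$ divided
by the mean of $w$. Cauchy–Schwarz against the variance $(n+a)/s^2$ absorbs the prefactor $(n+a)/s$
and leaves $1/s$; replacing the denominator by its lower bound $h((n+1)/s)/16$ costs the $16$. -/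
lemma IsBlythWeight.size_bias_cost_le (ha : 0 < a) (ha1 : a ≤ 1) (hs : 0 < s)
    (hh : IsBlythWeight a h) (n : ℕ) :
    (∫ w in Ioi (0 : ℝ), w * gammaWeight a s n w) *
        ((gammaSizeBiasedMean a s h n - gammaMean a s h n) ^ 2 / gammaMean a s h n) ≤
      16 / s * ∫ w in Ioi (0 : ℝ),
        (h w - h ((n + 1) / s)) ^ 2 / h ((n + 1) / s) * gammaWeight a s n w := by
  set c := h ((n + 1) / s)
  have hc : 0 < c := hh.pos _
  set M := gammaMass a s n
  have hM : 0 < M := gammaMass_pos ha hs n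
  set g := gammaMean a s h n with hg_def
  have hg : c / 16 ≤ g := hh.gammaMean_lower ha ha1 hs n
  have hg0 : 0 < g := hh.gammaMean_pos ha ha1 hs n
  set b : ℝ := n + a
  have hb : 0 < b := by positivity
  have hW := integrableOn_gammaWeight ha hs n
  have hW1 := integrableOn_mul_gammaWeight ha hs n
  set J := ∫ w in Ioi (0 : ℝ), (h w - c) ^ 2 * gammaWeight a s n w with hJ
  have hJint := hh.integrable_sq_sub_mul c hW
  have hJ0 : 0 ≤ J := setIntegral_nonneg measurableSet_Ioi fun w hw =>
    mul_nonneg (sq_nonneg _) (gammaWeight_nonneg hs n hw)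
  have hA1 : ∫ w in Ioi (0 : ℝ), w * gammaWeight a s n w = b / s * M :=
    integral_mul_gammaWeight ha hs n
  have hsqi : IntegrableOn (fun w => (w - b / s) ^ 2 * gammaWeight a s n w) (Ioi 0) := by
    by_contra hcon
    have h0 := integral_sq_sub_mul_gammaWeight ha hs n
    rw [integral_undef hcon] at h0
    have : 0 < b / s ^ 2 * M := by positivity
    exact this.ne h0
  have hsq : ∫ w in Ioi (0 : ℝ), (w - b / s) ^ 2 * gammaWeight a s n w = b / s ^ 2 * M :=
    integral_sq_sub_mul_gammaWeight ha hs n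
  have hlin : IntegrableOn (fun w => (w - b / s) * gammaWeight a s n w) (Ioi 0) := by
    have e : ∀ w, (w - b / s) * gammaWeight a s n w =
      w * gammaWeight a s n w - b / s * gammaWeight a s n w := fun w => by ring
    simp only [e]
    exact hW1.sub (hW.const_mul _)
  have hlin0 : ∫ w in Ioi (0 : ℝ), (w - b / s) * gammaWeight a s n w = 0 := by
    have e : ∀ w, (w - b / s) * gammaWeight a s n w =
      w * gammaWeight a s n w - b / s * gammaWeight a s n w := fun w => by ring
    simp only [e]
    rw [integral_sub hW1 (hW.const_mul _), integral_const_mul, hA1, ← gammaMass, sub_self]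
  have hcross_eq : ∀ w, (w - b / s) * (h w - c) * gammaWeight a s n w =
      h w * ((w - b / s) * gammaWeight a s n w) - c * ((w - b / s) * gammaWeight a s n w) :=
    fun w => by ring
  have hcross : IntegrableOn (fun w => (w - b / s) * (h w - c) * gammaWeight a s n w) (Ioi 0) := by
    simp only [hcross_eq]
    exact (hh.integrable_mul hlin).sub (hlin.const_mul _)
  -- Since $w-b/s$ is centred, subtracting the constant $c$ from $h$ does not change the covariance,
  -- but makes the second factor the small quantity $J$.
  have hcov : b / s * M * (gammaSizeBiasedMean a s h n - g) =
      ∫ w in Ioi (0 : ℝ), (w - b / s) * (h w - c) * gammaWeight a s n w := by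
    simp only [hcross_eq]
    rw [integral_sub (hh.integrable_mul hlin) (hlin.const_mul _), integral_const_mul, hlin0]
    have e : ∀ w, h w * ((w - b / s) * gammaWeight a s n w) =
        h w * (w * gammaWeight a s n w) - b / s * (h w * gammaWeight a s n w) := fun w => by ring
    simp only [e]
    rw [integral_sub (hh.integrable_mul hW1) ((hh.integrable_mul hW).const_mul _),
      integral_const_mul, hg_def, gammaSizeBiasedMean, gammaMean, hA1]
    have : b / s * M ≠ 0 := by positivity
    change b / s * M * (_ / (b / s * M) - _ / M) = _
    field_simp
    ring
  have hCS : (b / s * M * (gammaSizeBiasedMean a s h n - g)) ^ 2 ≤ b / s ^ 2 * M * J := by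
    rw [hcov, ← hsq]
    refine sq_integral_mul_le ?_ hsqi hJint hcross (by rw [hsq]; positivity)
    exact (ae_restrict_iff' measurableSet_Ioi).2 (ae_of_all _ fun w hw => gammaWeight_nonneg hs n hw)
  have hR : ∫ w in Ioi (0 : ℝ), (h w - c) ^ 2 / c * gammaWeight a s n w = J / c := by
    have e : ∀ w, (h w - c) ^ 2 / c * gammaWeight a s n w =
      ((h w - c) ^ 2 * gammaWeight a s n w) / c := fun w => by ring
    simp only [e]
    rw [integral_div]
  rw [hA1, hR]
  calc b / s * M * ((gammaSizeBiasedMean a s h n - g) ^ 2 / g)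
      = (b / s * M * (gammaSizeBiasedMean a s h n - g)) ^ 2 / (b / s * M * g) := by
        field_simp
    _ ≤ b / s ^ 2 * M * J / (b / s * M * g) := by gcongr
    _ = J / s / g := by field_simp
    _ ≤ J / s / (c / 16) := by gcongr
    _ = 16 / s * (J / c) := by field_simp

lemma IsBlythWeight.tsum_size_bias_cost_le (ha : 0 < a) (ha1 : a ≤ 1) (hs : 0 < s)
    (hh : IsBlythWeight a h) :
    ∑' n : ℕ, ENNReal.ofReal ((∫ w in Ioi (0 : ℝ), w * gammaWeight a s n w) *
        ((gammaSizeBiasedMean a s h n - gammaMean a s h n) ^ 2 / gammaMean a s h n)) ≤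
      ENNReal.ofReal (16 / s) * weightCost a s h := by
  have hm := hh.measurable
  calc _ ≤ ∑' n : ℕ, ENNReal.ofReal (16 / s) * ∫⁻ w in Ioi (0 : ℝ), ENNReal.ofReal (w ^ (a - 1)) *
          (ENNReal.ofReal (poissonWeight (s * w) n) *
            ENNReal.ofReal ((h w - h ((n + 1) / s)) ^ 2 / h ((n + 1) / s))) := by
        refine ENNReal.tsum_le_tsum fun n => ?_
        refine (ENNReal.ofReal_le_ofReal (hh.size_bias_cost_le ha ha1 hs n)).trans_eq ?_
        have hc := hh.pos ((n + 1) / s)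
        rw [ENNReal.ofReal_mul (by positivity), ofReal_integral_eq_lintegral_ofReal]
        · congr 1
          refine setLIntegral_congr_fun measurableSet_Ioi fun w hw => ?_
          have hw0 : (0 : ℝ) < w := hw
          have h1 := poissonWeight_nonneg (mul_nonneg hs.le hw0.le) n
          rw [← ENNReal.ofReal_mul h1, ← ENNReal.ofReal_mul (Real.rpow_nonneg hw0.le _),
            gammaWeight]
          congr 1
          ring
        · have e : ∀ w, (h w - h ((n + 1) / s)) ^ 2 / h ((n + 1) / s) * gammaWeight a s n w =
            (h w - h ((n + 1) / s)) ^ 2 * gammaWeight a s n w / h ((n + 1) / s) :=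
            fun w => by ring
          simp only [e]
          exact (hh.integrable_sq_sub_mul _ (integrableOn_gammaWeight ha hs n)).div_const _
        · refine (ae_restrict_iff' measurableSet_Ioi).2 (ae_of_all _ fun w hw => ?_)
          exact mul_nonneg (div_nonneg (sq_nonneg _) hc.le) (gammaWeight_nonneg hs n hw)
    _ = _ := by
        rw [ENNReal.tsum_mul_left, weightCost, ← lintegral_tsum]
        · congr 1
          refine lintegral_congr fun w => ?_
          rw [ENNReal.tsum_mul_left]
        · intro n
          have := measurable_poissonWeight n
          fun_prop

end GammaWeight

/-! ### Pointwise identities and inequalities for the divergence. -/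

/-- The integrand of the Kullback–Leibler divergence between measures with densities `p`, `q`. -/
noncomputable def klTerm (p q : ℝ≥0∞) : ℝ≥0∞ :=
  ENNReal.ofReal (p.toReal * Real.log (p.toReal / q.toReal) - p.toReal + q.toReal)

/-- `log (1 + q' / q)`. -/
noncomputable def logSum (q q' : ℝ≥0∞) : ℝ≥0∞ := ENNReal.ofReal (Real.log (1 + q'.toReal / q.toReal))

/-- `log ((q + q') / (2 √(q q')))`. -/
noncomputable def meanGap (q q' : ℝ≥0∞) : ℝ≥0∞ :=
  ENNReal.ofReal (Real.log (1 + q'.toReal / q.toReal) - Real.log 2 -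
    Real.log (q'.toReal / q.toReal) / 2)

@[fun_prop]
lemma measurable_klTerm {X : Type*} [MeasurableSpace X] {f g : X → ℝ≥0∞} (hf : Measurable f)
    (hg : Measurable g) : Measurable fun x => klTerm (f x) (g x) := by
  unfold klTerm; fun_prop

@[fun_prop]
lemma measurable_logSum {X : Type*} [MeasurableSpace X] {f g : X → ℝ≥0∞} (hf : Measurable f)
    (hg : Measurable g) : Measurable fun x => logSum (f x) (g x) := by
  unfold logSum; fun_prop

@[fun_prop]
lemma measurable_meanGap {X : Type*} [MeasurableSpace X] {f g : X → ℝ≥0∞} (hf : Measurable f)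
    (hg : Measurable g) : Measurable fun x => meanGap (f x) (g x) := by
  unfold meanGap; fun_prop

lemma mul_log_div_sub_add_nonneg {p q : ℝ} (hp : 0 < p) (hq : 0 < q) :
    0 ≤ p * Real.log (p / q) - p + q := by
  have h := Real.log_le_sub_one_of_pos (div_pos hq hp)
  have e : Real.log (p / q) = - Real.log (q / p) := by rw [← Real.log_inv, inv_div]
  have h2 := mul_le_mul_of_nonneg_left h hp.le
  have h3 : p * (q / p - 1) = q - p := by field_simp
  rw [e]
  linarith

/-- The inequality of arithmetic and geometric means, $4r\le(1+r)^2$, in logarithmic form; the next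
lemma is its equality case. -/
lemma meanGap_real_nonneg {r : ℝ} (hr : 0 < r) :
    0 ≤ Real.log (1 + r) - Real.log 2 - Real.log r / 2 := by
  have h : Real.log (4 * r) ≤ Real.log ((1 + r) ^ 2) :=
    Real.log_le_log (by positivity) (by nlinarith [sq_nonneg (r - 1)])
  rw [Real.log_pow, Real.log_mul (by norm_num) hr.ne', show (4 : ℝ) = 2 ^ 2 by norm_num,
    Real.log_pow] at h
  push_cast at h
  linarith

lemma eq_one_of_meanGap_real_le_zero {r : ℝ} (hr : 0 < r)
    (h : Real.log (1 + r) - Real.log 2 - Real.log r / 2 ≤ 0) : r = 1 := by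
  have h1 : Real.log ((1 + r) ^ 2) ≤ Real.log (4 * r) := by
    rw [Real.log_pow, Real.log_mul (by norm_num) hr.ne', show (4 : ℝ) = 2 ^ 2 by norm_num,
      Real.log_pow]
    push_cast
    linarith
  have h2 := (Real.log_le_log_iff (by positivity) (by positivity)).1 h1
  have h3 : (r - 1) ^ 2 ≤ 0 := by nlinarith
  have h4 := pow_eq_zero_iff (two_ne_zero) |>.1 (le_antisymm h3 (sq_nonneg _))
  linarith

section

variable {p q q' : ℝ≥0∞}

lemma eq_of_meanGap_eq_zero (hq : q ≠ 0) (hq_top : q ≠ ∞) (hq' : q' ≠ 0) (hq'_top : q' ≠ ∞)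
    (h : meanGap q q' = 0) : q' = q := by
  have h1 := ENNReal.toReal_pos hq hq_top
  have h2 := ENNReal.toReal_pos hq' hq'_top
  have h3 := eq_one_of_meanGap_real_le_zero (div_pos h2 h1) (ENNReal.ofReal_eq_zero.1 h)
  rw [div_eq_one_iff_eq h1.ne'] at h3
  exact (ENNReal.toReal_eq_toReal_iff' hq'_top hq_top).1 h3

/-- In real terms this is $\mathrm{kl}(p,q')-\mathrm{kl}(p,q)=q'-q-p\log(q'/q)$, with
$2p\log\frac{q+q'}{2q}$ split off and every term moved to the side where it is nonnegative. In this
form it integrates in `ℝ≥0∞` without any integrability hypothesis. -/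
lemma two_mul_logSum_add_klTerm (hp : p ≠ 0) (hp_top : p ≠ ∞) (hq : q ≠ 0) (hq_top : q ≠ ∞)
    (hq' : q' ≠ 0) (hq'_top : q' ≠ ∞) :
    2 * (p * logSum q q') + klTerm p q' + q =
      2 * (p * ENNReal.ofReal (Real.log 2)) + klTerm p q + q' + 2 * (p * meanGap q q') := by
  obtain ⟨P, hP⟩ : ∃ P, P = p.toReal := ⟨_, rfl⟩
  obtain ⟨Q, hQ⟩ : ∃ Q, Q = q.toReal := ⟨_, rfl⟩
  obtain ⟨Q', hQ'⟩ : ∃ Q', Q' = q'.toReal := ⟨_, rfl⟩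
  have hP0 : 0 < P := hP ▸ ENNReal.toReal_pos hp hp_top
  have hQ0 : 0 < Q := hQ ▸ ENNReal.toReal_pos hq hq_top
  have hQ'0 : 0 < Q' := hQ' ▸ ENNReal.toReal_pos hq' hq'_top
  unfold logSum klTerm meanGap
  rw [← hP, ← hQ, ← hQ', ← ENNReal.ofReal_toReal hp_top, ← ENNReal.ofReal_toReal hq_top,
    ← ENNReal.ofReal_toReal hq'_top, ← hP, ← hQ, ← hQ', show (2 : ℝ≥0∞) = ENNReal.ofReal 2 by simp]
  have hr : 0 < Q' / Q := by positivity
  have n1 : 0 ≤ Real.log (1 + Q' / Q) := Real.log_nonneg (by linarith)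
  have n2 := mul_log_div_sub_add_nonneg hP0 hQ0
  have n3 := mul_log_div_sub_add_nonneg hP0 hQ'0
  have n4 := meanGap_real_nonneg hr
  have n5 : 0 ≤ Real.log 2 := Real.log_nonneg (by norm_num)
  rw [← ENNReal.ofReal_mul hP0.le, ← ENNReal.ofReal_mul zero_le_two,
    ← ENNReal.ofReal_add (by positivity) n3, ← ENNReal.ofReal_add (by positivity) hQ0.le,
    ← ENNReal.ofReal_mul hP0.le, ← ENNReal.ofReal_mul zero_le_two,
    ← ENNReal.ofReal_add (by positivity) n2, ← ENNReal.ofReal_add (by positivity) hQ'0.le,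
    ← ENNReal.ofReal_mul hP0.le, ← ENNReal.ofReal_mul zero_le_two,
    ← ENNReal.ofReal_add (by positivity) (by positivity)]
  congr 1
  rw [Real.log_div hP0.ne' hQ0.ne', Real.log_div hP0.ne' hQ'0.ne', Real.log_div hQ'0.ne' hQ0.ne']
  ring

/-- With $u=(1+r)/2$, write $\log u=\log(uc/H)+\log(H/c)$ and apply $\log x\le x-1$ to both parts;
multiplying by $H$ gives $H\log u\le(H-c)^2/c+c(u-1)$. -/
lemma young_real {H c r : ℝ} (hH : 0 ≤ H) (hc : 0 < c) (hr : 0 ≤ r) :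
    H * Real.log (1 + r) + c ≤ (H - c) ^ 2 / c + c * (1 + r) / 2 + H * Real.log 2 := by
  have e : (H - c) ^ 2 / c = H * (H / c) - 2 * H + c := by field_simp; ring
  rcases hH.eq_or_lt with rfl | hH
  · rw [e]
    have : 0 ≤ c * (1 + r) / 2 := by positivity
    linarith
  · have h1 := Real.log_le_sub_one_of_pos (show 0 < (1 + r) / 2 * (c / H) by positivity)
    have h2 := Real.log_le_sub_one_of_pos (show 0 < H / c by positivity)
    rw [Real.log_mul (by positivity) (by positivity), Real.log_div (by positivity) (by norm_num),
      Real.log_div hc.ne' hH.ne'] at h1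
    rw [Real.log_div hH.ne' hc.ne'] at h2
    have h3 := mul_le_mul_of_nonneg_left (add_le_add h1 h2) hH.le
    have h4 : H * ((1 + r) / 2 * (c / H) - 1 + (H / c - 1)) =
        c * (1 + r) / 2 + H * (H / c) - 2 * H := by field_simp; ring
    rw [e]
    linarith

lemma two_mul_logSum_le {H c : ℝ} (hH : 0 ≤ H) (hc : 0 < c) (hq : q ≠ 0) (hq_top : q ≠ ∞)
    (hq'_top : q' ≠ ∞) :
    2 * (ENNReal.ofReal H * logSum q q') + 2 * ENNReal.ofReal c ≤
      2 * ENNReal.ofReal ((H - c) ^ 2 / c) + ENNReal.ofReal c * (1 + q' / q) +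
        2 * (ENNReal.ofReal H * ENNReal.ofReal (Real.log 2)) := by
  obtain ⟨Q, hQ⟩ : ∃ Q, Q = q.toReal := ⟨_, rfl⟩
  obtain ⟨Q', hQ'⟩ : ∃ Q', Q' = q'.toReal := ⟨_, rfl⟩
  have hQ0 : 0 < Q := hQ ▸ ENNReal.toReal_pos hq hq_top
  have hQ'0 : 0 ≤ Q' := hQ' ▸ ENNReal.toReal_nonneg
  unfold logSum
  rw [← hQ, ← hQ', ← ENNReal.ofReal_toReal hq_top,
    ← ENNReal.ofReal_toReal hq'_top, ← hQ, ← hQ', show (2 : ℝ≥0∞) = ENNReal.ofReal 2 by simp]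
  have hr : 0 ≤ Q' / Q := by positivity
  have n1 : 0 ≤ Real.log (1 + Q' / Q) := Real.log_nonneg (by linarith)
  have n5 : 0 ≤ Real.log 2 := Real.log_nonneg (by norm_num)
  rw [← ENNReal.ofReal_mul hH, ← ENNReal.ofReal_mul zero_le_two,
    ← ENNReal.ofReal_mul zero_le_two, ← ENNReal.ofReal_add (by positivity) (by positivity),
    ← ENNReal.ofReal_mul zero_le_two, ← ENNReal.ofReal_div_of_pos hQ0, ← ENNReal.ofReal_one,
    ← ENNReal.ofReal_add zero_le_one hr, ← ENNReal.ofReal_mul hc.le,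
    ← ENNReal.ofReal_add (by positivity) (by positivity),
    ← ENNReal.ofReal_mul hH, ← ENNReal.ofReal_mul zero_le_two,
    ← ENNReal.ofReal_add (by positivity) (by positivity)]
  refine ENNReal.ofReal_le_ofReal ?_
  have h := young_real hH hc hr
  linarith

end

/-! ### Divergence between measures given by densities. -/

section KLDensity

variable {X : Type*} [MeasurableSpace X] {μ : Measure X} {p q : X → ℝ≥0∞}

lemma withDensity_div_withDensity (hp : Measurable p) (hq : Measurable q)
    (hq0 : ∀ᵐ x ∂μ, q x ≠ 0) (hq_top : ∀ᵐ x ∂μ, q x ≠ ∞) :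
    (μ.withDensity q).withDensity (fun x => p x / q x) = μ.withDensity p := by
  have hd : Measurable fun x => p x / q x := hp.div hq
  rw [← withDensity_mul _ hq hd]
  refine withDensity_congr_ae ?_
  filter_upwards [hq0, hq_top] with x h0 ht
  exact ENNReal.mul_div_cancel h0 ht

/-- The Radon–Nikodym derivative is $p/q$, and multiplying `klFun` of it by $q$ gives `klTerm`. -/
lemma klDiv_withDensity_withDensity (hp : Measurable p) (hq : Measurable q)
    [IsFiniteMeasure (μ.withDensity p)] [IsFiniteMeasure (μ.withDensity q)]
    (hp0 : ∀ᵐ x ∂μ, p x ≠ 0) (hp_top : ∀ᵐ x ∂μ, p x ≠ ∞)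
    (hq0 : ∀ᵐ x ∂μ, q x ≠ 0) (hq_top : ∀ᵐ x ∂μ, q x ≠ ∞) :
    klDiv (μ.withDensity p) (μ.withDensity q) = ∫⁻ x, klTerm (p x) (q x) ∂μ := by
  have he := withDensity_div_withDensity (μ := μ) hp hq hq0 hq_top
  have hac : μ.withDensity p ≪ μ.withDensity q := by
    rw [← he]; exact withDensity_absolutelyContinuous _ _
  have hrn : (μ.withDensity p).rnDeriv (μ.withDensity q) =ᵐ[μ.withDensity q]
      fun x => p x / q x := by
    conv_lhs => rw [← he]
    exact Measure.rnDeriv_withDensity _ (hp.div hq)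
  rw [klDiv_eq_lintegral_klFun_of_ac hac, lintegral_congr_ae
    (g := fun x => ENNReal.ofReal (klFun (p x / q x).toReal)) (hrn.mono fun x hx => by rw [hx]),
    lintegral_withDensity_eq_lintegral_mul _ hq (by fun_prop)]
  refine lintegral_congr_ae ?_
  filter_upwards [hp0, hp_top, hq0, hq_top] with x h1 h2 h3 h4
  have hP0 := ENNReal.toReal_pos h1 h2
  have hQ0 := ENNReal.toReal_pos h3 h4
  simp only [Pi.mul_apply]
  rw [klTerm, ENNReal.toReal_div, ← ENNReal.ofReal_toReal h4, ← ENNReal.ofReal_mul (by simp),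
    ENNReal.ofReal_toReal h4, klFun]
  congr 1
  field_simp
  ring

/-- The set where $q$ vanishes is null for the second measure, hence for the first, whose density is
nonzero almost everywhere. -/
lemma ae_ne_zero_of_withDensity_absolutelyContinuous (hp : Measurable p) (hq : Measurable q)
    (hp0 : ∀ᵐ x ∂μ, p x ≠ 0) (h : μ.withDensity p ≪ μ.withDensity q) : ∀ᵐ x ∂μ, q x ≠ 0 := by
  have h1 : μ.withDensity q {x | q x = 0} = 0 := by
    have hm : MeasurableSet {x | q x = 0} := hq (measurableSet_singleton 0)
    rw [withDensity_apply _ hm, setLIntegral_congr_fun (g := fun _ => 0) hm (fun x hx => hx)]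
    simp
  have h2 := h h1
  rw [withDensity_apply_eq_zero hp] at h2
  rw [ae_iff] at hp0 ⊢
  refine measure_mono_null (fun x hx => ?_) (measure_union_null h2 hp0)
  by_cases hpx : p x = 0
  · exact Or.inr (by simpa using hpx)
  · exact Or.inl ⟨hpx, by simpa using hx⟩

end KLDensity

/-! ### The configuration space -/

section Sigma

variable {ι : Type*} {X : ι → Type*} [∀ i, MeasurableSpace (X i)]

lemma measurableSet_sigma_iff {s : Set (Σ i, X i)} :
    MeasurableSet s ↔ ∀ i, MeasurableSet (Sigma.mk i ⁻¹' s) :=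
  MeasurableSpace.measurableSet_iInf

lemma measurable_sigma_mk (i : ι) : Measurable (Sigma.mk i : X i → Σ i, X i) :=
  fun _ hs => measurableSet_sigma_iff.1 hs i

lemma measurable_of_sigma {Y : Type*} [MeasurableSpace Y] {f : (Σ i, X i) → Y}
    (hf : ∀ i, Measurable fun z : X i => f ⟨i, z⟩) : Measurable f :=
  fun _ hs => measurableSet_sigma_iff.2 fun i => hf i hs

lemma measurableEmbedding_sigma_mk (i : ι) :
    MeasurableEmbedding (Sigma.mk i : X i → Σ i, X i) where
  injective := sigma_mk_injective
  measurable := measurable_sigma_mk i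
  measurableSet_image' := by
    classical
    intro s hs
    refine measurableSet_sigma_iff.2 fun j => ?_
    by_cases h : i = j
    · subst h
      rwa [preimage_image_eq _ sigma_mk_injective]
    · convert MeasurableSet.empty
      ext z
      simp only [mem_preimage, mem_image, mem_empty_iff_false, iff_false]
      rintro ⟨y, -, hy⟩
      exact h (congrArg Sigma.fst hy)

/-- The preimage is the countable union of its slices, each the image of a measurable set under a
measurable embedding. -/
lemma measurable_of_sigma_prod [Countable ι] {Y Z : Type*} [MeasurableSpace Y] [MeasurableSpace Z]
    {f : (Σ i, X i) × Z → Y} (hf : ∀ i, Measurable fun p : X i × Z => f (⟨i, p.1⟩, p.2)) :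
    Measurable f := by
  intro s hs
  have : f ⁻¹' s = ⋃ i, Prod.map (Sigma.mk i) id '' ((fun p : X i × Z => f (⟨i, p.1⟩, p.2)) ⁻¹' s) := by
    ext ⟨⟨i, x⟩, z⟩
    simp only [mem_preimage, mem_iUnion, mem_image, Prod.exists, Prod.map_apply, id]
    constructor
    · exact fun h => ⟨i, x, z, h, rfl⟩
    · rintro ⟨j, y, z', h, he⟩
      rw [← he]; exact h
  rw [this]
  refine MeasurableSet.iUnion fun i => ?_
  exact ((measurableEmbedding_sigma_mk i).prodMap MeasurableEmbedding.id).measurableSet_image.2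
    (hf i hs)

/-- Needed for jointly measurable densities of kernels into the configuration space. The generators
are the ranges of the components and the images of generators of each; the ranges are what makes
complements within a component available. -/
lemma countablyGenerated_sigma [Countable ι] [h : ∀ i, MeasurableSpace.CountablyGenerated (X i)] :
    MeasurableSpace.CountablyGenerated (Σ i, X i) := by
  choose b hbc hb using fun i => (h i).isCountablyGenerated
  refine ⟨⋃ i, insert (range (Sigma.mk i)) ((fun s => Sigma.mk i '' s) '' b i),
    countable_iUnion fun i => ((hbc i).image _).insert _, le_antisymm ?_ ?_⟩
  · intro s hs
    have hs' : s = ⋃ i, Sigma.mk i '' (Sigma.mk i ⁻¹' s) := by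
      ext ⟨i, x⟩
      simp only [mem_iUnion, mem_image, mem_preimage]
      constructor
      · exact fun h => ⟨i, x, h, rfl⟩
      · rintro ⟨j, y, hy, he⟩
        rw [← he]; exact hy
    rw [hs']
    refine MeasurableSet.iUnion fun i => ?_
    have hm : MeasurableSet (Sigma.mk i ⁻¹' s) := measurableSet_sigma_iff.1 hs i
    rw [hb i] at hm
    generalize Sigma.mk i ⁻¹' s = t at hm
    induction t, hm using MeasurableSpace.generateFrom_induction with
    | hC u hu _ =>
      exact MeasurableSpace.measurableSet_generateFrom
        (mem_iUnion.2 ⟨i, mem_insert_of_mem _ ⟨u, hu, rfl⟩⟩)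
    | empty => simp
    | compl u _ ih =>
      rw [image_compl_eq_range_sdiff_image sigma_mk_injective]
      exact (MeasurableSpace.measurableSet_generateFrom
        (mem_iUnion.2 ⟨i, mem_insert _ _⟩)).diff ih
    | iUnion u _ ih =>
      rw [image_iUnion]
      exact MeasurableSet.iUnion ih
  · refine MeasurableSpace.generateFrom_le fun s hs => ?_
    obtain ⟨i, hs⟩ := mem_iUnion.1 hs
    rcases hs with rfl | ⟨u, hu, rfl⟩
    · exact (measurableEmbedding_sigma_mk i).measurableSet_range
    · refine (measurableEmbedding_sigma_mk i).measurableSet_image.2 ?_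
      rw [hb i]
      exact MeasurableSpace.measurableSet_generateFrom hu

end Sigma

section Pi

variable {X : Type*} [MeasurableSpace X] {μ : Measure X} [SigmaFinite μ]

lemma lintegral_fin_prod_eq_prod {n : ℕ} {f : Fin n → X → ℝ≥0∞} (hf : ∀ i, Measurable (f i)) :
    ∫⁻ z, ∏ i, f i (z i) ∂(Measure.pi fun _ : Fin n => μ) = ∏ i, ∫⁻ x, f i x ∂μ := by
  induction n with
  | zero => simp
  | succ n ih =>
    have hm : Measurable fun z : Fin n → X => ∏ i : Fin n, f i.succ (z i) :=
      Finset.measurable_prod _ fun i _ => (hf i.succ).comp (measurable_pi_apply i)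
    rw [← ((measurePreserving_piFinSuccAbove (fun _ => μ) 0).symm).lintegral_comp_emb
      (MeasurableEquiv.measurableEmbedding _)]
    simp_rw [MeasurableEquiv.piFinSuccAbove_symm_apply, Fin.insertNthEquiv,
      Fin.prod_univ_succ, Fin.insertNth_zero, Equiv.coe_fn_mk, Fin.cons_succ, Fin.cons_zero]
    rw [← ih (fun i => hf i.succ), ← lintegral_prod_mul (hf 0).aemeasurable hm.aemeasurable]
    rfl

lemma pi_withDensity {n : ℕ} {f : X → ℝ≥0∞} (hf : Measurable f) [SigmaFinite (μ.withDensity f)] :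
    (Measure.pi fun _ : Fin n => μ.withDensity f) =
      (Measure.pi fun _ => μ).withDensity fun z => ∏ i, f (z i) := by
  refine Measure.pi_eq fun s hs => ?_
  rw [withDensity_apply _ (MeasurableSet.univ_pi hs), ← lintegral_indicator
    (MeasurableSet.univ_pi hs)]
  have e : ∀ z : Fin n → X, (univ.pi s).indicator (fun z => ∏ i, f (z i)) z =
      ∏ i, (s i).indicator f (z i) := fun z => by
    by_cases hz : z ∈ univ.pi s
    · rw [indicator_of_mem hz]
      exact Finset.prod_congr rfl fun i _ => (indicator_of_mem (hz i trivial) _).symm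
    · rw [indicator_of_notMem hz]
      obtain ⟨i, hi⟩ : ∃ i, z i ∉ s i := by simpa [Set.mem_pi] using hz
      exact (Finset.prod_eq_zero (Finset.mem_univ i) (indicator_of_notMem hi _)).symm
  simp_rw [e]
  rw [lintegral_fin_prod_eq_prod fun i => hf.indicator (hs i)]
  refine Finset.prod_congr rfl fun i _ => ?_
  rw [lintegral_indicator (hs i), withDensity_apply _ (hs i)]

/-- Each summand is an integral of a product in which one factor $f$ is replaced by $fg$. For $n=0$
the truncated exponent $n-1$ is harmless, being multiplied by zero. -/
lemma lintegral_fin_prod_mul_sum {n : ℕ} {f g : X → ℝ≥0∞} (hf : Measurable f) (hg : Measurable g) :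
    ∫⁻ z, (∏ i, f (z i)) * ∑ i, g (z i) ∂(Measure.pi fun _ : Fin n => μ) =
      n * (∫⁻ x, f x ∂μ) ^ (n - 1) * ∫⁻ x, f x * g x ∂μ := by
  classical
  simp_rw [Finset.mul_sum]
  have e : ∀ (j : Fin n) (z : Fin n → X), (∏ i, f (z i)) * g (z j) =
      ∏ i, (if i = j then fun x => f x * g x else f) (z i) := fun j z => by
    rw [← Finset.mul_prod_erase _ _ (Finset.mem_univ j),
      ← Finset.mul_prod_erase (a := j) Finset.univ
        (fun i => (if i = j then fun x => f x * g x else f) (z i)) (Finset.mem_univ j)]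
    simp only [if_true]
    rw [Finset.prod_congr (s₁ := Finset.univ.erase j)
      (g := fun i => (if i = j then fun x => f x * g x else f) (z i)) rfl
      fun i hi => by rw [if_neg (Finset.ne_of_mem_erase hi)]]
    ring
  have hm : ∀ j i : Fin n, Measurable (if i = j then fun x => f x * g x else f) := fun j i => by
    split_ifs
    · exact hf.mul hg
    · exact hf
  rw [lintegral_finsetSum _ fun j _ => ?_]
  · simp_rw [e]
    have : ∀ j : Fin n, ∏ i, ∫⁻ x, (if i = j then fun x => f x * g x else f) x ∂μ =
        (∫⁻ x, f x ∂μ) ^ (n - 1) * ∫⁻ x, f x * g x ∂μ := fun j => by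
      rw [← Finset.mul_prod_erase _ _ (Finset.mem_univ j), if_pos rfl,
        Finset.prod_congr (s₁ := Finset.univ.erase j) (g := fun _ => ∫⁻ x, f x ∂μ) rfl
          fun i hi => by rw [if_neg (Finset.ne_of_mem_erase hi)],
        Finset.prod_const, Finset.card_erase_of_mem (Finset.mem_univ j)]
      simp [mul_comm]
    simp_rw [fun j => lintegral_fin_prod_eq_prod (μ := μ) (hm j), this]
    simp [mul_assoc]
  · exact (Finset.measurable_prod _ fun i _ => hf.comp (measurable_pi_apply i)).mul
      (hg.comp (measurable_pi_apply j))

lemma ae_pi_forall {n : ℕ} {P : X → Prop} (hP : ∀ᵐ x ∂μ, P x) :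
    ∀ᵐ z ∂(Measure.pi fun _ : Fin n => μ), ∀ i, P (z i) := by
  rw [ae_all_iff]
  exact fun i => (Measure.quasiMeasurePreserving_eval (fun _ : Fin n => μ) i).ae hP

end Pi

section ConfigMeasure

variable {X : Type*} [MeasurableSpace X] {ν : Measure X}

instance sFinite_configMeasure [SigmaFinite ν] : SFinite (configMeasure ν) := by
  unfold configMeasure; infer_instance

lemma lintegral_configMeasure {f : Config X → ℝ≥0∞} (hf : Measurable f) :
    ∫⁻ y, f y ∂(configMeasure ν) =
      ∑' n, ∫⁻ z, f ⟨n, z⟩ ∂(Measure.pi fun _ : Fin n => ν) := by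
  unfold configMeasure
  rw [lintegral_sum_measure]
  congr 1
  ext n
  rw [lintegral_map hf (measurable_sigma_mk n)]

lemma ae_configMeasure {P : Config X → Prop}
    (h : ∀ n, ∀ᵐ z ∂(Measure.pi fun _ : Fin n => ν), P ⟨n, z⟩) : ∀ᵐ y ∂(configMeasure ν), P y := by
  unfold configMeasure
  rw [Measure.ae_sum_iff]
  exact fun n => (measurableEmbedding_sigma_mk n).ae_map_iff.2 (h n)

lemma ae_configMeasure_forall [SigmaFinite ν] {P : X → Prop} (hP : ∀ᵐ x ∂ν, P x) :
    ∀ᵐ y ∂(configMeasure ν), ∀ i, P (y.2 i) :=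
  ae_configMeasure fun _ => ae_pi_forall hP

lemma configMeasure_fst_eq [SigmaFinite ν] (m : ℕ) :
    configMeasure ν {y | y.1 = m} = ν univ ^ m := by
  have hm : MeasurableSet {y : Config X | y.1 = m} := by
    refine measurableSet_sigma_iff.2 fun n => ?_
    by_cases h : n = m <;> simp [preimage, h]
  rw [← lintegral_indicator_one hm, lintegral_configMeasure (measurable_one.indicator hm),
    tsum_eq_single m]
  · simp [indicator, Measure.pi_univ]
  · intro n hn
    simp [indicator, hn]

end ConfigMeasure

/-! ### Densities of Poisson processes, Campbell's formula and the divergence. -/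

section PoissonPdf

variable {X : Type*} [MeasurableSpace X] {ν : Measure X} {f e : X → ℝ≥0∞}

/-- The density of the Poisson process with intensity function `f` with respect to
`configMeasure ν`. -/
noncomputable def poissonPdf (ν : Measure X) (f : X → ℝ≥0∞) (y : Config X) : ℝ≥0∞ :=
  (∏ i, f (y.2 i)) * ((Nat.factorial y.1 : ℝ≥0∞)⁻¹ *
    ENNReal.ofReal (Real.exp (-(∫⁻ x, f x ∂ν).toReal)))

lemma measurable_comp_fst {Y : Type*} [MeasurableSpace Y] (ψ : ℕ → Y) :
    Measurable fun y : Config X => ψ y.1 :=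
  measurable_of_sigma fun n => show Measurable fun _ : Fin n → X => ψ n from measurable_const

lemma measurable_config_prod (hf : Measurable f) :
    Measurable fun y : Config X => ∏ i, f (y.2 i) :=
  measurable_of_sigma fun n => show Measurable fun z : Fin n → X => ∏ i, f (z i) from
    Finset.measurable_prod _ fun i _ => hf.comp (measurable_pi_apply i)

lemma measurable_config_sum (hf : Measurable f) :
    Measurable fun y : Config X => ∑ i, f (y.2 i) :=
  measurable_of_sigma fun n => show Measurable fun z : Fin n → X => ∑ i, f (z i) from
    Finset.measurable_sum _ fun i _ => hf.comp (measurable_pi_apply i)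

lemma measurable_poissonPdf (hf : Measurable f) : Measurable (poissonPdf ν f) :=
  (measurable_config_prod hf).mul ((measurable_comp_fst fun n => (Nat.factorial n : ℝ≥0∞)⁻¹).mul_const _)

lemma isFiniteMeasure_withDensity_of_ne_top (hF : ∫⁻ x, f x ∂ν ≠ ∞) :
    IsFiniteMeasure (ν.withDensity f) := isFiniteMeasure_withDensity hF

lemma factorial_inv_mul_exp_mul_pow (hF : ∫⁻ x, f x ∂ν ≠ ∞) (n : ℕ) :
    (Nat.factorial n : ℝ≥0∞)⁻¹ * ENNReal.ofReal (Real.exp (-(∫⁻ x, f x ∂ν).toReal)) *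
      (∫⁻ x, f x ∂ν) ^ n = ENNReal.ofReal (poissonWeight (∫⁻ x, f x ∂ν).toReal n) := by
  have h1 : (Nat.factorial n : ℝ≥0∞)⁻¹ = ENNReal.ofReal ((Nat.factorial n : ℝ)⁻¹) := by
    rw [ENNReal.ofReal_inv_of_pos (by positivity), ENNReal.ofReal_natCast]
  have h2 : (∫⁻ x, f x ∂ν) ^ n = ENNReal.ofReal ((∫⁻ x, f x ∂ν).toReal ^ n) := by
    rw [ENNReal.ofReal_pow ENNReal.toReal_nonneg, ENNReal.ofReal_toReal hF]
  rw [h1, h2, ← ENNReal.ofReal_mul (by positivity), ← ENNReal.ofReal_mul (by positivity),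
    poissonWeight]
  congr 1
  ring

lemma tsum_ofReal_poissonWeight {μ : ℝ} (hμ : 0 ≤ μ) :
    ∑' n, ENNReal.ofReal (poissonWeight μ n) = 1 := by
  rw [← ENNReal.ofReal_tsum_of_nonneg (poissonWeight_nonneg hμ) (hasSum_poissonWeight μ).summable,
    (hasSum_poissonWeight μ).tsum_eq, ENNReal.ofReal_one]

lemma poissonPdf_ne_zero {y : Config X} (h : ∀ i, f (y.2 i) ≠ 0) : poissonPdf ν f y ≠ 0 := by
  unfold poissonPdf
  refine mul_ne_zero (Finset.prod_ne_zero_iff.2 fun i _ => h i)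
    (mul_ne_zero (ENNReal.inv_ne_zero.2 (by simp)) ?_)
  simpa using Real.exp_pos _

lemma poissonPdf_ne_top {y : Config X} (h : ∀ i, f (y.2 i) ≠ ∞) : poissonPdf ν f y ≠ ∞ := by
  unfold poissonPdf
  exact ENNReal.mul_ne_top (ENNReal.prod_ne_top fun i _ => h i)
    (ENNReal.mul_ne_top (ENNReal.inv_ne_top.2 (by exact_mod_cast y.1.factorial_ne_zero))
      ENNReal.ofReal_ne_top)

/-- The identity behind the formula for the divergence of Poisson processes, rearranged so that
every term is nonnegative. -/
lemma klTerm_poissonPdf {y : Config X} (hE : ∫⁻ x, e x ∂ν ≠ ∞) (hF : ∫⁻ x, f x ∂ν ≠ ∞)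
    (hf0 : ∀ i, f (y.2 i) ≠ 0) (hft : ∀ i, f (y.2 i) ≠ ∞)
    (he0 : ∀ i, e (y.2 i) ≠ 0) (het : ∀ i, e (y.2 i) ≠ ∞) :
    klTerm (poissonPdf ν f y) (poissonPdf ν e y) +
        poissonPdf ν f y * ∑ i, e (y.2 i) / f (y.2 i) +
        poissonPdf ν f y * (∫⁻ x, f x ∂ν) + poissonPdf ν f y =
      poissonPdf ν f y * ∑ i, klTerm (f (y.2 i)) (e (y.2 i)) / f (y.2 i) +
        poissonPdf ν f y * (y.1 : ℝ≥0∞) + poissonPdf ν f y * (∫⁻ x, e x ∂ν) + poissonPdf ν e y := by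
  obtain ⟨P, hP⟩ : ∃ P, P = (poissonPdf ν f y).toReal := ⟨_, rfl⟩
  obtain ⟨Q, hQ⟩ : ∃ Q, Q = (poissonPdf ν e y).toReal := ⟨_, rfl⟩
  obtain ⟨F, hFF⟩ : ∃ F, F = (∫⁻ x, f x ∂ν).toReal := ⟨_, rfl⟩
  obtain ⟨E, hEE⟩ : ∃ E, E = (∫⁻ x, e x ∂ν).toReal := ⟨_, rfl⟩
  obtain ⟨u, hu⟩ : ∃ u : Fin y.1 → ℝ, ∀ i, u i = (f (y.2 i)).toReal := ⟨_, fun _ => rfl⟩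
  obtain ⟨v, hv⟩ : ∃ v : Fin y.1 → ℝ, ∀ i, v i = (e (y.2 i)).toReal := ⟨_, fun _ => rfl⟩
  have hu0 : ∀ i, 0 < u i := fun i => hu i ▸ ENNReal.toReal_pos (hf0 i) (hft i)
  have hv0 : ∀ i, 0 < v i := fun i => hv i ▸ ENNReal.toReal_pos (he0 i) (het i)
  have hP0 : 0 < P := hP ▸ ENNReal.toReal_pos (poissonPdf_ne_zero hf0) (poissonPdf_ne_top hft)
  have hQ0 : 0 < Q := hQ ▸ ENNReal.toReal_pos (poissonPdf_ne_zero he0) (poissonPdf_ne_top het)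
  have hF0 : 0 ≤ F := hFF ▸ ENNReal.toReal_nonneg
  have hE0 : 0 ≤ E := hEE ▸ ENNReal.toReal_nonneg
  have hPe : P = (∏ i, u i) * ((Nat.factorial y.1 : ℝ)⁻¹ * Real.exp (-F)) := by
    rw [hP, poissonPdf, ENNReal.toReal_mul, ENNReal.toReal_prod, ENNReal.toReal_mul,
      ENNReal.toReal_inv, ENNReal.toReal_natCast, ENNReal.toReal_ofReal (Real.exp_pos _).le, hFF]
    simp only [hu]
  have hQe : Q = (∏ i, v i) * ((Nat.factorial y.1 : ℝ)⁻¹ * Real.exp (-E)) := by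
    rw [hQ, poissonPdf, ENNReal.toReal_mul, ENNReal.toReal_prod, ENNReal.toReal_mul,
      ENNReal.toReal_inv, ENNReal.toReal_natCast, ENNReal.toReal_ofReal (Real.exp_pos _).le, hEE]
    simp only [hv]
  have hfac : (0 : ℝ) < (Nat.factorial y.1 : ℝ)⁻¹ := by positivity
  have hlog : Real.log (P / Q) = ∑ i, Real.log (u i / v i) - F + E := by
    have h1 : (∏ i, u i) ≠ 0 := (Finset.prod_pos fun i _ => hu0 i).ne'
    have h2 : (∏ i, v i) ≠ 0 := (Finset.prod_pos fun i _ => hv0 i).ne'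
    rw [Real.log_div hP0.ne' hQ0.ne', hPe, hQe, Real.log_mul h1 (by positivity),
      Real.log_mul h2 (by positivity), Real.log_mul hfac.ne' (Real.exp_ne_zero _),
      Real.log_mul hfac.ne' (Real.exp_ne_zero _), Real.log_exp, Real.log_exp,
      Real.log_prod fun i _ => (hu0 i).ne', Real.log_prod fun i _ => (hv0 i).ne']
    simp_rw [fun i => Real.log_div (hu0 i).ne' (hv0 i).ne', Finset.sum_sub_distrib]
    ring
  have n2 := mul_log_div_sub_add_nonneg hP0 hQ0
  have n3 : ∀ i, 0 ≤ u i * Real.log (u i / v i) - u i + v i := fun i =>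
    mul_log_div_sub_add_nonneg (hu0 i) (hv0 i)
  have s1 : ∑ i, e (y.2 i) / f (y.2 i) = ENNReal.ofReal (∑ i, v i / u i) := by
    rw [ENNReal.ofReal_sum_of_nonneg fun i _ => (div_pos (hv0 i) (hu0 i)).le]
    refine Finset.sum_congr rfl fun i _ => ?_
    rw [ENNReal.ofReal_div_of_pos (hu0 i), hu, hv, ENNReal.ofReal_toReal (hft i),
      ENNReal.ofReal_toReal (het i)]
  have s2 : ∑ i, klTerm (f (y.2 i)) (e (y.2 i)) / f (y.2 i) =
      ENNReal.ofReal (∑ i, (u i * Real.log (u i / v i) - u i + v i) / u i) := by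
    rw [ENNReal.ofReal_sum_of_nonneg fun i _ => div_nonneg (n3 i) (hu0 i).le]
    refine Finset.sum_congr rfl fun i _ => ?_
    rw [ENNReal.ofReal_div_of_pos (hu0 i), klTerm, hu, hv, ENNReal.ofReal_toReal (hft i)]
  have s3 : ∑ i, (u i * Real.log (u i / v i) - u i + v i) / u i =
      ∑ i, Real.log (u i / v i) - y.1 + ∑ i, v i / u i := by
    have : ∀ i, (u i * Real.log (u i / v i) - u i + v i) / u i =
        Real.log (u i / v i) - 1 + v i / u i := fun i => by
      have := hu0 i; field_simp
    simp_rw [this, Finset.sum_add_distrib, Finset.sum_sub_distrib]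
    simp
  have n4 : 0 ≤ ∑ i, v i / u i := Finset.sum_nonneg fun i _ => (div_pos (hv0 i) (hu0 i)).le
  have n5 : 0 ≤ ∑ i, (u i * Real.log (u i / v i) - u i + v i) / u i :=
    Finset.sum_nonneg fun i _ => div_nonneg (n3 i) (hu0 i).le
  have r1 : poissonPdf ν f y = ENNReal.ofReal P := by
    rw [hP, ENNReal.ofReal_toReal (poissonPdf_ne_top hft)]
  have r2 : poissonPdf ν e y = ENNReal.ofReal Q := by
    rw [hQ, ENNReal.ofReal_toReal (poissonPdf_ne_top het)]
  have r3 : ∫⁻ x, f x ∂ν = ENNReal.ofReal F := by rw [hFF, ENNReal.ofReal_toReal hF]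
  have r4 : ∫⁻ x, e x ∂ν = ENNReal.ofReal E := by rw [hEE, ENNReal.ofReal_toReal hE]
  rw [klTerm, s1, s2, ← hP, ← hQ, r1, r2, r3, r4, ← ENNReal.ofReal_natCast y.1,
    ← ENNReal.ofReal_mul hP0.le, ← ENNReal.ofReal_mul hP0.le, ← ENNReal.ofReal_mul hP0.le,
    ← ENNReal.ofReal_mul hP0.le, ← ENNReal.ofReal_mul hP0.le,
    ← ENNReal.ofReal_add n2 (by positivity), ← ENNReal.ofReal_add (by positivity) (by positivity),
    ← ENNReal.ofReal_add (by positivity) (by positivity),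
    ← ENNReal.ofReal_add (by positivity) (by positivity),
    ← ENNReal.ofReal_add (by positivity) (by positivity),
    ← ENNReal.ofReal_add (by positivity) (by positivity), hlog, s3]
  congr 1
  ring

variable [SigmaFinite ν]

lemma poissonProcess_withDensity (hf : Measurable f) (hF : ∫⁻ x, f x ∂ν ≠ ∞) :
    poissonProcess (ν.withDensity f) = (configMeasure ν).withDensity (poissonPdf ν f) := by
  have := isFiniteMeasure_withDensity_of_ne_top hF
  ext s hs
  have hm : ∀ n, MeasurableSet ((fun z : Fin n → X => (⟨n, z⟩ : Config X)) ⁻¹' s) :=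
    fun n => measurable_sigma_mk n hs
  rw [withDensity_apply _ hs, ← lintegral_indicator hs,
    lintegral_configMeasure ((measurable_poissonPdf hf).indicator hs), poissonProcess,
    Measure.smul_apply, Measure.sum_apply _ hs, smul_eq_mul, ← ENNReal.tsum_mul_left]
  congr 1
  ext n
  have e : ∀ z : Fin n → X, s.indicator (poissonPdf ν f) ⟨n, z⟩ =
      ((fun z : Fin n → X => (⟨n, z⟩ : Config X)) ⁻¹' s).indicator (fun z => ∏ i, f (z i)) z *
        ((Nat.factorial n : ℝ≥0∞)⁻¹ *
          ENNReal.ofReal (Real.exp (-(∫⁻ x, f x ∂ν).toReal))) := fun z => by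
    by_cases hz : (⟨n, z⟩ : Config X) ∈ s
    · rw [indicator_of_mem hz, indicator_of_mem (by exact hz)]; rfl
    · rw [indicator_of_notMem hz, indicator_of_notMem (by exact hz), zero_mul]
  simp_rw [e]
  have hprod : Measurable fun z : Fin n → X => ∏ i, f (z i) :=
    Finset.measurable_prod _ fun i _ => hf.comp (measurable_pi_apply i)
  rw [lintegral_mul_const _ (hprod.indicator (hm n)), lintegral_indicator (hm n),
    Measure.smul_apply, Measure.map_apply (measurable_sigma_mk n) hs, pi_withDensity hf,
    withDensity_apply _ (hm n), withDensity_apply _ MeasurableSet.univ, Measure.restrict_univ,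
    smul_eq_mul]
  ring

lemma lintegral_poissonPdf_mul (hf : Measurable f) (hF : ∫⁻ x, f x ∂ν ≠ ∞) (ψ : ℕ → ℝ≥0∞) :
    ∫⁻ y, poissonPdf ν f y * ψ y.1 ∂(configMeasure ν) =
      ∑' n, ENNReal.ofReal (poissonWeight (∫⁻ x, f x ∂ν).toReal n) * ψ n := by
  have hψ : Measurable fun y : Config X => ψ y.1 := measurable_comp_fst ψ
  rw [lintegral_configMeasure (f := fun y => poissonPdf ν f y * ψ y.1)
    ((measurable_poissonPdf hf).mul hψ)]
  congr 1
  ext n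
  have hprod : Measurable fun z : Fin n → X => ∏ i, f (z i) :=
    Finset.measurable_prod _ fun i _ => hf.comp (measurable_pi_apply i)
  simp only [poissonPdf]
  rw [lintegral_mul_const _ (hprod.mul_const _), lintegral_mul_const _ hprod,
    lintegral_fin_prod_eq_prod fun _ => hf, Finset.prod_const, Finset.card_univ, Fintype.card_fin,
    ← factorial_inv_mul_exp_mul_pow hF]
  ring

lemma lintegral_poissonPdf (hf : Measurable f) (hF : ∫⁻ x, f x ∂ν ≠ ∞) :
    ∫⁻ y, poissonPdf ν f y ∂(configMeasure ν) = 1 := by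
  have := lintegral_poissonPdf_mul hf hF (fun _ => 1)
  simpa [tsum_ofReal_poissonWeight ENNReal.toReal_nonneg] using this

/-- Campbell's formula $E\sum_i g(y_i)=\int fg$: choosing one of the $n$ points cancels $n$ against
the factorial, and the remaining $n-1$ points sum to total probability one. -/
lemma lintegral_poissonPdf_mul_sum (hf : Measurable f) (hF : ∫⁻ x, f x ∂ν ≠ ∞) {g : X → ℝ≥0∞}
    (hg : Measurable g) :
    ∫⁻ y, poissonPdf ν f y * ∑ i, g (y.2 i) ∂(configMeasure ν) = ∫⁻ x, f x * g x ∂ν := by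
  have hs : Measurable fun y : Config X => ∑ i, g (y.2 i) := measurable_config_sum hg
  rw [lintegral_configMeasure (f := fun y => poissonPdf ν f y * ∑ i, g (y.2 i))
    ((measurable_poissonPdf hf).mul hs)]
  have h : ∀ n : ℕ, ∫⁻ z, poissonPdf ν f ⟨n, z⟩ * ∑ i, g (z i) ∂(Measure.pi fun _ : Fin n => ν) =
      (Nat.factorial n : ℝ≥0∞)⁻¹ * ENNReal.ofReal (Real.exp (-(∫⁻ x, f x ∂ν).toReal)) *
        (n * (∫⁻ x, f x ∂ν) ^ (n - 1) * ∫⁻ x, f x * g x ∂ν) := fun n => by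
    rw [← lintegral_fin_prod_mul_sum hf hg, ← lintegral_const_mul' _ _ (ENNReal.mul_ne_top
      (ENNReal.inv_ne_top.2 (by exact_mod_cast n.factorial_ne_zero)) ENNReal.ofReal_ne_top)]
    refine lintegral_congr fun z => ?_
    simp only [poissonPdf]
    ring
  simp only [h]
  rw [tsum_eq_zero_add' ENNReal.summable]
  simp only [Nat.cast_zero, zero_mul, mul_zero, zero_add]
  have h2 : ∀ n : ℕ, (Nat.factorial (n + 1) : ℝ≥0∞)⁻¹ *
      ENNReal.ofReal (Real.exp (-(∫⁻ x, f x ∂ν).toReal)) *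
        (((n + 1 : ℕ) : ℝ≥0∞) * (∫⁻ x, f x ∂ν) ^ (n + 1 - 1) * ∫⁻ x, f x * g x ∂ν) =
      ENNReal.ofReal (poissonWeight (∫⁻ x, f x ∂ν).toReal n) * ∫⁻ x, f x * g x ∂ν := fun n => by
    rw [← factorial_inv_mul_exp_mul_pow hF, Nat.factorial_succ, Nat.cast_mul,
      ENNReal.mul_inv (Or.inr (by simp)) (Or.inl (by simp)), Nat.add_sub_cancel]
    have : ((n + 1 : ℕ) : ℝ≥0∞)⁻¹ * ((n + 1 : ℕ) : ℝ≥0∞) = 1 :=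
      ENNReal.inv_mul_cancel (by simp) (by simp)
    calc _ = ((n + 1 : ℕ) : ℝ≥0∞)⁻¹ * ((n + 1 : ℕ) : ℝ≥0∞) * ((Nat.factorial n : ℝ≥0∞)⁻¹ *
          ENNReal.ofReal (Real.exp (-(∫⁻ x, f x ∂ν).toReal)) * (∫⁻ x, f x ∂ν) ^ n *
            ∫⁻ x, f x * g x ∂ν) := by ring
      _ = _ := by rw [this, one_mul]
  simp only [h2]
  rw [ENNReal.tsum_mul_right, tsum_ofReal_poissonWeight ENNReal.toReal_nonneg, one_mul]

lemma lintegral_poissonPdf_mul_fst (hf : Measurable f) (hF : ∫⁻ x, f x ∂ν ≠ ∞) :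
    ∫⁻ y, poissonPdf ν f y * (y.1 : ℝ≥0∞) ∂(configMeasure ν) = ∫⁻ x, f x ∂ν := by
  have := lintegral_poissonPdf_mul_sum hf hF (g := fun _ => 1) measurable_const
  simpa using this

/-- The log-likelihood ratio is a sum over points plus a constant, so Campbell's formula reduces its
mean to an integral over the base space. Integrating the subtraction-free identity
`klTerm_poissonPdf` leaves finite terms on both sides, which cancel at the end; the divergence
itself may be infinite. -/
theorem klDiv_poissonProcess (hf : Measurable f) (he : Measurable e) (hF : ∫⁻ x, f x ∂ν ≠ ∞)
    (hE : ∫⁻ x, e x ∂ν ≠ ∞) (hf0 : ∀ᵐ x ∂ν, f x ≠ 0) (he0 : ∀ᵐ x ∂ν, e x ≠ 0) :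
    klDiv (poissonProcess (ν.withDensity f)) (poissonProcess (ν.withDensity e)) =
      ∫⁻ x, klTerm (f x) (e x) ∂ν := by
  have hft : ∀ᵐ x ∂ν, f x ≠ ∞ := (ae_lt_top hf hF).mono fun _ h => h.ne
  have het : ∀ᵐ x ∂ν, e x ≠ ∞ := (ae_lt_top he hE).mono fun _ h => h.ne
  have c1 := ae_configMeasure_forall hf0
  have c2 := ae_configMeasure_forall hft
  have c3 := ae_configMeasure_forall he0
  have c4 := ae_configMeasure_forall het
  have mf := measurable_poissonPdf (ν := ν) hf
  have me := measurable_poissonPdf (ν := ν) he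
  have i1 := lintegral_poissonPdf hf hF
  have i2 := lintegral_poissonPdf he hE
  have : IsFiniteMeasure ((configMeasure ν).withDensity (poissonPdf ν f)) :=
    isFiniteMeasure_withDensity (by simp [i1])
  have : IsFiniteMeasure ((configMeasure ν).withDensity (poissonPdf ν e)) :=
    isFiniteMeasure_withDensity (by simp [i2])
  rw [poissonProcess_withDensity hf hF, poissonProcess_withDensity he hE,
    klDiv_withDensity_withDensity mf me (c1.mono fun _ h => poissonPdf_ne_zero h)
      (c2.mono fun _ h => poissonPdf_ne_top h) (c3.mono fun _ h => poissonPdf_ne_zero h)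
      (c4.mono fun _ h => poissonPdf_ne_top h)]
  have mkl : Measurable fun x => klTerm (f x) (e x) := measurable_klTerm hf he
  have mef : Measurable fun x => e x / f x := he.div hf
  have mkf : Measurable fun x => klTerm (f x) (e x) / f x := mkl.div hf
  have mN : Measurable fun y : Config X => (y.1 : ℝ≥0∞) :=
    measurable_comp_fst (Nat.cast : ℕ → ℝ≥0∞)
  have mklp : Measurable fun y => klTerm (poissonPdf ν f y) (poissonPdf ν e y) :=
    measurable_klTerm mf me
  have m1 : Measurable fun y => poissonPdf ν f y * ∑ i, e (y.2 i) / f (y.2 i) :=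
    mf.mul (measurable_config_sum mef)
  have m2 : Measurable fun y => poissonPdf ν f y * (∫⁻ x, f x ∂ν) := mf.mul_const _
  have m3 : Measurable fun y => poissonPdf ν f y * (y.1 : ℝ≥0∞) := mf.mul mN
  have m4 : Measurable fun y => poissonPdf ν f y * (∫⁻ x, e x ∂ν) := mf.mul_const _
  have key := lintegral_congr_ae (μ := configMeasure ν)
    ((c1.and (c2.and (c3.and c4))).mono fun y h =>
      klTerm_poissonPdf hE hF h.1 h.2.1 h.2.2.1 h.2.2.2)
  have cancel : ∀ g : X → ℝ≥0∞, ∫⁻ x, f x * (g x / f x) ∂ν = ∫⁻ x, g x ∂ν := fun g => by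
    refine lintegral_congr_ae ?_
    filter_upwards [hf0, hft] with x h1 h2
    exact ENNReal.mul_div_cancel h1 h2
  have i3 := lintegral_poissonPdf_mul_sum hf hF mef
  have i4 := lintegral_poissonPdf_mul_sum hf hF mkf
  have i5 := lintegral_poissonPdf_mul_fst hf hF
  rw [cancel] at i3 i4
  rw [lintegral_add_right _ mf, lintegral_add_right _ m2, lintegral_add_right _ m1,
    lintegral_add_right _ me, lintegral_add_right _ m4, lintegral_add_right _ m3,
    lintegral_mul_const _ mf, lintegral_mul_const _ mf, i1, i2, i3, i4, i5, one_mul, one_mul] at key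
  have hkey : ∫⁻ y, klTerm (poissonPdf ν f y) (poissonPdf ν e y) ∂(configMeasure ν) +
      (∫⁻ x, e x ∂ν + ∫⁻ x, f x ∂ν + 1) =
      ∫⁻ x, klTerm (f x) (e x) ∂ν + (∫⁻ x, e x ∂ν + ∫⁻ x, f x ∂ν + 1) := by
    rw [← add_assoc, ← add_assoc, key]
    ring
  exact (ENNReal.add_left_inj (by simp [hE, hF])).1 hkey

end PoissonPdf

/-! ### Comparison of Bayes risks -/

section Comparison

variable {Θ X Y : Type*} [MeasurableSpace Θ] [MeasurableSpace X] [MeasurableSpace Y]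
  {π : Measure Θ} {μ : Measure X} {ν : Measure Y} 

lemma lintegral_lintegral_mul_eq {F : X → ℝ≥0∞} {G : X × Y → ℝ≥0∞} (hG : Measurable G) :
    ∫⁻ x, ∫⁻ y, F x * G (x, y) ∂ν ∂μ = ∫⁻ x, F x * ∫⁻ y, G (x, y) ∂ν ∂μ :=
  lintegral_congr fun _ => lintegral_const_mul _ (hG.comp measurable_prodMk_left)

lemma lintegral_rotate [SFinite π] [SFinite μ] [SFinite ν] {G : Θ × X × Y → ℝ≥0∞} (hG : Measurable G) :
    ∫⁻ θ, ∫⁻ x, ∫⁻ y, G (θ, x, y) ∂ν ∂μ ∂π = ∫⁻ x, ∫⁻ y, ∫⁻ θ, G (θ, x, y) ∂π ∂ν ∂μ := by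
  rw [lintegral_lintegral_swap]
  · refine lintegral_congr fun _ => lintegral_lintegral_swap ?_
    exact (hG.comp (by fun_prop : Measurable fun z : Θ × Y => (z.1, _, z.2))).aemeasurable
  · have : Measurable fun z : (Θ × X) × Y => G (z.1.1, z.1.2, z.2) := by fun_prop
    exact this.lintegral_prod_right'.aemeasurable

/-- The risk of the action density `q` at `θ`: the observation has density `p (θ, ·)` and the
Kullback–Leibler loss is computed from the density `r (θ, ·)`. -/
noncomputable def klRisk (μ : Measure X) (ν : Measure Y) (p : Θ × X → ℝ≥0∞) (r : Θ × Y → ℝ≥0∞)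
    (q : X × Y → ℝ≥0∞) (θ : Θ) : ℝ≥0∞ :=
  ∫⁻ x, ∫⁻ y, p (θ, x) * klTerm (r (θ, y)) (q (x, y)) ∂ν ∂μ

/-- The expected gain from averaging the action densities `q` and `q'`. -/
noncomputable def gapRisk (μ : Measure X) (ν : Measure Y) (p : Θ × X → ℝ≥0∞) (r : Θ × Y → ℝ≥0∞)
    (q q' : X × Y → ℝ≥0∞) (θ : Θ) : ℝ≥0∞ :=
  ∫⁻ x, ∫⁻ y, p (θ, x) * (r (θ, y) * meanGap (q (x, y)) (q' (x, y))) ∂ν ∂μ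

/-- The expectation of `log (1 + q' / q)`. -/
noncomputable def logSumRisk (μ : Measure X) (ν : Measure Y) (p : Θ × X → ℝ≥0∞)
    (r : Θ × Y → ℝ≥0∞) (q q' : X × Y → ℝ≥0∞) (θ : Θ) : ℝ≥0∞ :=
  ∫⁻ x, ∫⁻ y, p (θ, x) * (r (θ, y) * logSum (q (x, y)) (q' (x, y))) ∂ν ∂μ

variable {p : Θ × X → ℝ≥0∞} {r : Θ × Y → ℝ≥0∞} {q q' : X × Y → ℝ≥0∞}

lemma klRisk_eq (hr : Measurable r) (hq : Measurable q) (θ : Θ) : klRisk μ ν p r q θ =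
    ∫⁻ x, p (θ, x) * ∫⁻ y, klTerm (r (θ, y)) (q (x, y)) ∂ν ∂μ := by
  refine lintegral_congr fun x => lintegral_const_mul _ ?_
  fun_prop

variable [SFinite ν]

lemma measurable_gapRisk [SFinite μ] (hp : Measurable p) (hr : Measurable r) (hq : Measurable q)
    (hq' : Measurable q') : Measurable (gapRisk μ ν p r q q') := by
  have h1 : Measurable fun z : (Θ × X) × Y =>
      p z.1 * (r (z.1.1, z.2) * meanGap (q (z.1.2, z.2)) (q' (z.1.2, z.2))) := by
    fun_prop
  exact h1.lintegral_prod_right'.lintegral_prod_right'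

lemma measurable_logSumRisk [SFinite μ] (hp : Measurable p) (hr : Measurable r) (hq : Measurable q)
    (hq' : Measurable q') : Measurable (logSumRisk μ ν p r q q') := by
  have h1 : Measurable fun z : (Θ × X) × Y =>
      p z.1 * (r (z.1.1, z.2) * logSum (q (z.1.2, z.2)) (q' (z.1.2, z.2))) := by
    fun_prop
  exact h1.lintegral_prod_right'.lintegral_prod_right'

lemma two_mul_logSumRisk_add_klRisk (hp : Measurable p) (hr : Measurable r) (hq : Measurable q)
    (hq' : Measurable q') (hq0 : ∀ᵐ x ∂μ, ∀ᵐ y ∂ν, q (x, y) ≠ 0 ∧ q (x, y) ≠ ∞)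
    (hq'0 : ∀ᵐ x ∂μ, ∀ᵐ y ∂ν, q' (x, y) ≠ 0 ∧ q' (x, y) ≠ ∞) {θ : Θ}
    (hr0 : ∀ᵐ y ∂ν, r (θ, y) ≠ 0 ∧ r (θ, y) ≠ ∞) :
    2 * logSumRisk μ ν p r q q' θ + klRisk μ ν p r q' θ +
        ∫⁻ x, p (θ, x) * ∫⁻ y, q (x, y) ∂ν ∂μ =
      2 * ENNReal.ofReal (Real.log 2) * ((∫⁻ x, p (θ, x) ∂μ) * ∫⁻ y, r (θ, y) ∂ν) +
        klRisk μ ν p r q θ + ∫⁻ x, p (θ, x) * ∫⁻ y, q' (x, y) ∂ν ∂μ +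
        2 * gapRisk μ ν p r q q' θ := by
  have m1 : Measurable fun z : X × Y =>
      p (θ, z.1) * (r (θ, z.2) * logSum (q z) (q' z)) := by fun_prop
  have m2 : Measurable fun z : X × Y => p (θ, z.1) * klTerm (r (θ, z.2)) (q' z) := by fun_prop
  have m3 : Measurable fun z : X × Y => p (θ, z.1) * q z := by fun_prop
  have m4 : Measurable fun z : X × Y => p (θ, z.1) * r (θ, z.2) := by fun_prop
  have m5 : Measurable fun z : X × Y => p (θ, z.1) * klTerm (r (θ, z.2)) (q z) := by fun_prop
  have m6 : Measurable fun z : X × Y => p (θ, z.1) * q' z := by fun_prop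
  have m7 : Measurable fun z : X × Y =>
      p (θ, z.1) * (r (θ, z.2) * meanGap (q z) (q' z)) := by fun_prop
  have key : ∀ᵐ z ∂(μ.prod ν),
      2 * (p (θ, z.1) * (r (θ, z.2) * logSum (q z) (q' z))) +
        p (θ, z.1) * klTerm (r (θ, z.2)) (q' z) + p (θ, z.1) * q z =
      2 * ENNReal.ofReal (Real.log 2) * (p (θ, z.1) * r (θ, z.2)) +
        p (θ, z.1) * klTerm (r (θ, z.2)) (q z) + p (θ, z.1) * q' z +
        2 * (p (θ, z.1) * (r (θ, z.2) * meanGap (q z) (q' z))) := by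
    have hs : MeasurableSet {z : X × Y |
        2 * (p (θ, z.1) * (r (θ, z.2) * logSum (q z) (q' z))) +
          p (θ, z.1) * klTerm (r (θ, z.2)) (q' z) + p (θ, z.1) * q z =
        2 * ENNReal.ofReal (Real.log 2) * (p (θ, z.1) * r (θ, z.2)) +
          p (θ, z.1) * klTerm (r (θ, z.2)) (q z) + p (θ, z.1) * q' z +
          2 * (p (θ, z.1) * (r (θ, z.2) * meanGap (q z) (q' z)))} :=
      measurableSet_eq_fun (by fun_prop) (by fun_prop)
    rw [Measure.ae_prod_iff_ae_ae hs]
    filter_upwards [hq0, hq'0] with x h1 h2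
    filter_upwards [h1, h2, hr0] with y h3 h4 h5
    have := two_mul_logSum_add_klTerm h5.1 h5.2 h3.1 h3.2 h4.1 h4.2
    calc _ = p (θ, x) * (2 * (r (θ, y) * logSum (q (x, y)) (q' (x, y))) +
          klTerm (r (θ, y)) (q' (x, y)) + q (x, y)) := by ring
      _ = _ := by rw [this]; ring
  have key2 := lintegral_congr_ae key
  rw [lintegral_add_right _ m3, lintegral_add_right _ m2, lintegral_const_mul _ m1,
    lintegral_add_right _ (m7.const_mul _), lintegral_add_right _ m6, lintegral_add_right _ m5,
    lintegral_const_mul _ m4, lintegral_const_mul _ m7, lintegral_prod _ m1.aemeasurable,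
    lintegral_prod _ m2.aemeasurable, lintegral_prod _ m3.aemeasurable,
    lintegral_prod _ m5.aemeasurable, lintegral_prod _ m6.aemeasurable,
    lintegral_prod _ m7.aemeasurable, lintegral_prod_mul (f := fun x => p (θ, x)) (g := fun y => r (θ, y))
      (hp.comp measurable_prodMk_left).aemeasurable (hr.comp measurable_prodMk_left).aemeasurable,
    lintegral_lintegral_mul_eq (F := fun x => p (θ, x)) hq,
    lintegral_lintegral_mul_eq (F := fun x => p (θ, x)) hq'] at key2
  exact key2

/-- A vanishing integral makes the integrand vanish almost everywhere, and one parameter suffices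
because its sampling densities are almost everywhere nonzero; then the equality case of the
arithmetic–geometric inequality applies. -/
lemma eq_of_gapRisk_eq_zero (hp : Measurable p) (hr : Measurable r) (hq : Measurable q)
    (hq' : Measurable q') (hq0 : ∀ᵐ x ∂μ, ∀ᵐ y ∂ν, q (x, y) ≠ 0 ∧ q (x, y) ≠ ∞)
    (hq'0 : ∀ᵐ x ∂μ, ∀ᵐ y ∂ν, q' (x, y) ≠ 0 ∧ q' (x, y) ≠ ∞) {θ : Θ}
    (hp0 : ∀ᵐ x ∂μ, p (θ, x) ≠ 0) (hr0 : ∀ᵐ y ∂ν, r (θ, y) ≠ 0)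
    (h : gapRisk μ ν p r q q' θ = 0) : ∀ᵐ x ∂μ, ∀ᵐ y ∂ν, q' (x, y) = q (x, y) := by
  have m : Measurable fun z : X × Y =>
      p (θ, z.1) * (r (θ, z.2) * meanGap (q z) (q' z)) := by fun_prop
  unfold gapRisk at h
  rw [lintegral_eq_zero_iff m.lintegral_prod_right'] at h
  filter_upwards [h, hp0, hq0, hq'0] with x h1 h2 h3 h4
  have mx : Measurable fun y =>
      p (θ, x) * (r (θ, y) * meanGap (q (x, y)) (q' (x, y))) := m.comp measurable_prodMk_left
  rw [Pi.zero_apply, lintegral_eq_zero_iff mx] at h1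
  filter_upwards [h1, hr0, h3, h4] with y k1 k2 k3 k4
  refine eq_of_meanGap_eq_zero k3.1 k3.2 k4.1 k4.2 ?_
  simpa [h2, k2] using k1

end Comparison

/-! ### Blyth's inequalities for prediction and estimation. -/

section Cores

variable {Θ X Y : Type*} [MeasurableSpace Θ] [MeasurableSpace X] [MeasurableSpace Y]
  {π : Measure Θ} {μ : Measure X} {ν : Measure Y} [SFinite μ] [SFinite ν]
  {p : Θ × X → ℝ≥0∞} {r : Θ × Y → ℝ≥0∞} {q q' : X × Y → ℝ≥0∞}

lemma lintegral_prod_prod {G : Θ × X × Y → ℝ≥0∞} (hG : Measurable G) :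
    ∫⁻ z, G z ∂(π.prod (μ.prod ν)) = ∫⁻ θ, ∫⁻ x, ∫⁻ y, G (θ, x, y) ∂ν ∂μ ∂π := by
  rw [lintegral_prod _ hG.aemeasurable]
  exact lintegral_congr fun θ =>
    lintegral_prod _ (hG.comp measurable_prodMk_left).aemeasurable

/-- Blyth's inequality for predictive densities: a density `q'` whose risk is at most that of the
Bayesian predictive density `q` differs from `q` by little. -/
theorem lintegral_mul_gapRisk_le [SFinite π] (hp : Measurable p) (hr : Measurable r) (hq : Measurable q)
    (hq' : Measurable q') (hp1 : ∀ᵐ θ ∂π, ∫⁻ x, p (θ, x) ∂μ = 1)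
    (hr1 : ∀ᵐ θ ∂π, ∫⁻ y, r (θ, y) ∂ν = 1)
    (hr0 : ∀ᵐ θ ∂π, ∀ᵐ y ∂ν, r (θ, y) ≠ 0 ∧ r (θ, y) ≠ ∞)
    (hq0 : ∀ᵐ x ∂μ, ∀ᵐ y ∂ν, q (x, y) ≠ 0 ∧ q (x, y) ≠ ∞)
    (hq'0 : ∀ᵐ x ∂μ, ∀ᵐ y ∂ν, q' (x, y) ≠ 0 ∧ q' (x, y) ≠ ∞)
    (hq1 : ∀ᵐ x ∂μ, ∫⁻ y, q (x, y) ∂ν = 1) (hq'1 : ∀ᵐ x ∂μ, ∫⁻ y, q' (x, y) ∂ν = 1)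
    (hQ : ∀ᵐ x ∂μ, ∀ᵐ y ∂ν,
      ∫⁻ θ, p (θ, x) * r (θ, y) ∂π = (∫⁻ θ, p (θ, x) ∂π) * q (x, y))
    (hR : ∀ᵐ θ ∂π, klRisk μ ν p r q θ < ∞)
    (hR' : ∀ᵐ θ ∂π, klRisk μ ν p r q' θ ≤ klRisk μ ν p r q θ)
    {h : Θ → ℝ} {c : X → ℝ} (hh : Measurable h) (hc : Measurable c) (hh0 : ∀ θ, 0 ≤ h θ)
    (hc0 : ∀ x, 0 < c x) (hh1 : ∫⁻ θ, ENNReal.ofReal (h θ) ∂π ≠ ∞) :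
    ∫⁻ θ, ENNReal.ofReal (h θ) * gapRisk μ ν p r q q' θ ∂π ≤
      ∫⁻ θ, ∫⁻ x, p (θ, x) * ENNReal.ofReal ((h θ - c x) ^ 2 / c x) ∂μ ∂π := by
  obtain ⟨l, hl⟩ : ∃ l, l = ENNReal.ofReal (Real.log 2) := ⟨_, rfl⟩
  have hl_top : l ≠ ∞ := by simp [hl]
  obtain ⟨V, hV⟩ : ∃ V, V =
    ∫⁻ θ, ∫⁻ x, p (θ, x) * ENNReal.ofReal ((h θ - c x) ^ 2 / c x) ∂μ ∂π := ⟨_, rfl⟩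
  obtain ⟨A, hA⟩ : ∃ A, A = ∫⁻ θ, ENNReal.ofReal (h θ) ∂π := ⟨_, rfl⟩
  obtain ⟨C, hC⟩ : ∃ C, C = ∫⁻ x, ENNReal.ofReal (c x) * ∫⁻ θ, p (θ, x) ∂π ∂μ := ⟨_, rfl⟩
  obtain ⟨S, hS⟩ : ∃ S, S = ∫⁻ θ, ENNReal.ofReal (h θ) * logSumRisk μ ν p r q q' θ ∂π := ⟨_, rfl⟩
  obtain ⟨T, hT⟩ : ∃ T, T = ∫⁻ θ, ENNReal.ofReal (h θ) * gapRisk μ ν p r q q' θ ∂π := ⟨_, rfl⟩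
  rw [← hV, ← hT]
  rw [← hA] at hh1
  by_cases hV_top : V = ∞
  · simp [hV_top]
  have mh : Measurable fun θ => ENNReal.ofReal (h θ) := hh.ennreal_ofReal
  have mc : Measurable fun x => ENNReal.ofReal (c x) := hc.ennreal_ofReal
  have mG : Measurable fun θ => ENNReal.ofReal (h θ) * gapRisk μ ν p r q q' θ :=
    mh.mul (measurable_gapRisk hp hr hq hq')
  have mL : Measurable fun θ => ENNReal.ofReal (h θ) * logSumRisk μ ν p r q q' θ :=
    mh.mul (measurable_logSumRisk hp hr hq hq')
  have mV : Measurable fun z : Θ × X =>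
      ENNReal.ofReal ((h z.1 - c z.2) ^ 2 / c z.2) := by fun_prop
  -- the weight `c` is integrable against the marginal density
  have hC_top : C ≠ ∞ := by
    have e1 : C = ∫⁻ θ, ∫⁻ x, ENNReal.ofReal (c x) * p (θ, x) ∂μ ∂π := by
      rw [hC, lintegral_lintegral_swap (by fun_prop)]
      exact lintegral_congr fun x =>
        (lintegral_const_mul _ (by fun_prop)).symm
    have e2 : C ≤ ∫⁻ θ, (2 * ENNReal.ofReal (h θ) +
        4 * ∫⁻ x, p (θ, x) * ENNReal.ofReal ((h θ - c x) ^ 2 / c x) ∂μ) ∂π := by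
      rw [e1]
      refine lintegral_mono_ae ?_
      filter_upwards [hp1] with θ hθ
      have : ∀ x, ENNReal.ofReal (c x) * p (θ, x) ≤ 2 * ENNReal.ofReal (h θ) * p (θ, x) +
          4 * (p (θ, x) * ENNReal.ofReal ((h θ - c x) ^ 2 / c x)) := by
        intro x
        -- Either $c\le2h$, or $|h-c|\ge c/2$ and then $c\le4(h-c)^2/c$. Hence the integral of $c$
        -- is at most twice the mass of the weighted prior plus four times the cost.
        have h1 : c x ≤ 2 * h θ + 4 * ((h θ - c x) ^ 2 / c x) := by
          have e : (h θ - c x) ^ 2 / c x * c x = (h θ - c x) ^ 2 := by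
            have := (hc0 x).ne'
            field_simp
          refine le_of_mul_le_mul_right ?_ (hc0 x)
          rw [add_mul, mul_assoc 4, e]
          nlinarith [hh0 θ, hc0 x, sq_nonneg (2 * h θ - c x), mul_nonneg (hh0 θ) (hc0 x).le]
        have h2 : ENNReal.ofReal (c x) ≤ 2 * ENNReal.ofReal (h θ) +
            4 * ENNReal.ofReal ((h θ - c x) ^ 2 / c x) := by
          have n1 : 0 ≤ (h θ - c x) ^ 2 / c x := div_nonneg (sq_nonneg _) (hc0 x).le
          refine (ENNReal.ofReal_le_ofReal h1).trans_eq ?_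
          rw [ENNReal.ofReal_add (mul_nonneg two_pos.le (hh0 θ)) (mul_nonneg four_pos.le n1),
            ENNReal.ofReal_mul two_pos.le, ENNReal.ofReal_mul four_pos.le]
          simp
        calc _ ≤ _ := mul_le_mul_left h2 (p (θ, x))
          _ = _ := by ring
      refine (lintegral_mono this).trans_eq ?_
      rw [lintegral_add_left (by fun_prop), lintegral_const_mul _ (by fun_prop), hθ, mul_one,
        lintegral_const_mul _ (by fun_prop)]
    rw [lintegral_add_left (by fun_prop), lintegral_const_mul _ mh, lintegral_const_mul _
      (by
        have : Measurable fun z : Θ × X =>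
          p z * ENNReal.ofReal ((h z.1 - c z.2) ^ 2 / c z.2) := by fun_prop
        exact this.lintegral_prod_right'), ← hA, ← hV] at e2
    exact ne_top_of_le_ne_top (by finiteness) e2
  -- the identity, integrated against the weight `h`
  have step1 : 2 * l * A + 2 * T ≤ 2 * S := by
    have : ∀ᵐ θ ∂π, 2 * l * ENNReal.ofReal (h θ) +
        2 * (ENNReal.ofReal (h θ) * gapRisk μ ν p r q q' θ) ≤
        2 * (ENNReal.ofReal (h θ) * logSumRisk μ ν p r q q' θ) := by
      filter_upwards [hp1, hr1, hr0, hR, hR'] with θ h1 h2 h3 h4 h5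
      have key := two_mul_logSumRisk_add_klRisk hp hr hq hq' hq0 hq'0 h3
      have e1 : ∫⁻ x, p (θ, x) * ∫⁻ y, q (x, y) ∂ν ∂μ = 1 := by
        rw [← h1]
        refine lintegral_congr_ae ?_
        filter_upwards [hq1] with x hx
        rw [hx, mul_one]
      have e2 : ∫⁻ x, p (θ, x) * ∫⁻ y, q' (x, y) ∂ν ∂μ = 1 := by
        rw [← h1]
        refine lintegral_congr_ae ?_
        filter_upwards [hq'1] with x hx
        rw [hx, mul_one]
      rw [e1, e2, h1, h2, mul_one, mul_one, ← hl] at key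
      have h6 : 2 * l + 2 * gapRisk μ ν p r q q' θ ≤ 2 * logSumRisk μ ν p r q q' θ := by
        have hne : klRisk μ ν p r q θ + 1 ≠ ∞ := by finiteness
        refine (ENNReal.add_le_add_iff_right hne).1 ?_
        calc _ = 2 * l + klRisk μ ν p r q θ + 1 + 2 * gapRisk μ ν p r q q' θ := by ring
          _ = 2 * logSumRisk μ ν p r q q' θ + klRisk μ ν p r q' θ + 1 := key.symm
          _ ≤ 2 * logSumRisk μ ν p r q q' θ + klRisk μ ν p r q θ + 1 := by gcongr
          _ = _ := by ring
      calc _ = ENNReal.ofReal (h θ) * (2 * l + 2 * gapRisk μ ν p r q q' θ) := by ring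
        _ ≤ ENNReal.ofReal (h θ) * (2 * logSumRisk μ ν p r q q' θ) := by gcongr
        _ = _ := by ring
    have := lintegral_mono_ae this
    rwa [lintegral_add_left (by fun_prop), lintegral_const_mul _ mh, lintegral_const_mul _ mG,
      lintegral_const_mul _ mL, ← hA, ← hT, ← hS] at this
  -- Young's inequality, integrated
  have step2 : 2 * S + 2 * C ≤ 2 * V + 2 * C + 2 * l * A := by
    have hae : ∀ᵐ z ∂(μ.prod ν), (q z ≠ 0 ∧ q z ≠ ∞) ∧ (q' z ≠ 0 ∧ q' z ≠ ∞) := by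
      rw [Measure.ae_prod_iff_ae_ae]
      · filter_upwards [hq0, hq'0] with x k1 k2
        filter_upwards [k1, k2] with y k3 k4 using ⟨k3, k4⟩
      · have a1 : MeasurableSet {z | q z ≠ 0} := hq (measurableSet_singleton 0).compl
        have a2 : MeasurableSet {z | q z ≠ ∞} := hq (measurableSet_singleton ∞).compl
        have a3 : MeasurableSet {z | q' z ≠ 0} := hq' (measurableSet_singleton 0).compl
        have a4 : MeasurableSet {z | q' z ≠ ∞} := hq' (measurableSet_singleton ∞).compl
        exact (a1.inter a2).inter (a3.inter a4)
    have hae' : ∀ᵐ z ∂(π.prod (μ.prod ν)),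
        (q z.2 ≠ 0 ∧ q z.2 ≠ ∞) ∧ (q' z.2 ≠ 0 ∧ q' z.2 ≠ ∞) :=
      Measure.quasiMeasurePreserving_snd.ae hae
    have m1 : Measurable fun z : Θ × X × Y =>
      ENNReal.ofReal (h z.1) * (p (z.1, z.2.1) * (r (z.1, z.2.2) * logSum (q z.2) (q' z.2))) := by
      fun_prop
    have m2 : Measurable fun z : Θ × X × Y =>
      ENNReal.ofReal (c z.2.1) * (p (z.1, z.2.1) * r (z.1, z.2.2)) := by fun_prop
    have m3 : Measurable fun z : Θ × X × Y =>
      p (z.1, z.2.1) * ENNReal.ofReal ((h z.1 - c z.2.1) ^ 2 / c z.2.1) * r (z.1, z.2.2) := by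
      fun_prop
    have m4 : Measurable fun z : Θ × X × Y =>
      ENNReal.ofReal (c z.2.1) * ((1 + q' z.2 / q z.2) * (p (z.1, z.2.1) * r (z.1, z.2.2))) := by
      fun_prop
    have m5 : Measurable fun z : Θ × X × Y =>
      ENNReal.ofReal (h z.1) * (p (z.1, z.2.1) * r (z.1, z.2.2)) := by fun_prop
    have mC : Measurable fun x => ENNReal.ofReal (c x) * ∫⁻ θ, p (θ, x) ∂π :=
      mc.mul hp.lintegral_prod_left'
    have ineq : ∀ᵐ z ∂(π.prod (μ.prod ν)),
        2 * (ENNReal.ofReal (h z.1) *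
            (p (z.1, z.2.1) * (r (z.1, z.2.2) * logSum (q z.2) (q' z.2)))) +
          2 * (ENNReal.ofReal (c z.2.1) * (p (z.1, z.2.1) * r (z.1, z.2.2))) ≤
        2 * (p (z.1, z.2.1) * ENNReal.ofReal ((h z.1 - c z.2.1) ^ 2 / c z.2.1) * r (z.1, z.2.2)) +
          ENNReal.ofReal (c z.2.1) *
            ((1 + q' z.2 / q z.2) * (p (z.1, z.2.1) * r (z.1, z.2.2))) +
          2 * l * (ENNReal.ofReal (h z.1) * (p (z.1, z.2.1) * r (z.1, z.2.2))) := by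
      filter_upwards [hae'] with z hz
      have := two_mul_logSum_le (hh0 z.1) (hc0 z.2.1) hz.1.1 hz.1.2 hz.2.2
      rw [← hl] at this
      calc _ = p (z.1, z.2.1) * r (z.1, z.2.2) * (2 * (ENNReal.ofReal (h z.1) *
            logSum (q z.2) (q' z.2)) + 2 * ENNReal.ofReal (c z.2.1)) := by ring
        _ ≤ _ := mul_le_mul_right this _
        _ = _ := by ring
    have := lintegral_mono_ae ineq
    rw [lintegral_add_right _ (m2.const_mul _), lintegral_add_right _ (m5.const_mul _),
      lintegral_add_right _ m4, lintegral_const_mul _ m1, lintegral_const_mul _ m2,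
      lintegral_const_mul _ m3, lintegral_const_mul _ m5] at this
    have e1 : ∫⁻ z, ENNReal.ofReal (h z.1) *
        (p (z.1, z.2.1) * (r (z.1, z.2.2) * logSum (q z.2) (q' z.2))) ∂(π.prod (μ.prod ν)) = S := by
      rw [lintegral_prod_prod m1, hS]
      refine lintegral_congr fun θ => ?_
      unfold logSumRisk
      have mm : Measurable fun z : X × Y => p (θ, z.1) * (r (θ, z.2) * logSum (q z) (q' z)) := by
        fun_prop
      rw [← lintegral_const_mul _ mm.lintegral_prod_right']
      refine lintegral_congr fun x => ?_
      have mx : Measurable fun y => p (θ, x) * (r (θ, y) * logSum (q (x, y)) (q' (x, y))) := by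
        fun_prop
      exact lintegral_const_mul (ENNReal.ofReal (h θ)) mx
    have e2 : ∫⁻ z, ENNReal.ofReal (c z.2.1) * (p (z.1, z.2.1) * r (z.1, z.2.2))
        ∂(π.prod (μ.prod ν)) = C := by
      rw [lintegral_prod_prod m2, lintegral_rotate m2, hC]
      refine lintegral_congr_ae ?_
      filter_upwards [hQ, hq1] with x h1 h2
      rw [lintegral_congr_ae (g := fun y => ENNReal.ofReal (c x) * ((∫⁻ θ, p (θ, x) ∂π) * q (x, y)))]
      · rw [lintegral_const_mul _ (by fun_prop), lintegral_const_mul _ (by fun_prop), h2, mul_one]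
      · filter_upwards [h1] with y h3
        rw [lintegral_const_mul _ (by fun_prop), h3]
    have e3 : ∫⁻ z, p (z.1, z.2.1) * ENNReal.ofReal ((h z.1 - c z.2.1) ^ 2 / c z.2.1) *
        r (z.1, z.2.2) ∂(π.prod (μ.prod ν)) = V := by
      rw [lintegral_prod_prod m3, hV]
      refine lintegral_congr_ae ?_
      filter_upwards [hr1] with θ h1
      refine lintegral_congr fun x => ?_
      rw [lintegral_const_mul _ (by fun_prop), h1, mul_one]
    -- Both actions are probability densities and $q$ times the marginal of $x$ is the joint
    -- marginal, so $c(1+q'/q)$ integrates to exactly $2C$. This cancels the $2C$ on the other side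
    -- of Young's inequality.
    have e4 : ∫⁻ z, ENNReal.ofReal (c z.2.1) *
        ((1 + q' z.2 / q z.2) * (p (z.1, z.2.1) * r (z.1, z.2.2))) ∂(π.prod (μ.prod ν)) =
        2 * C := by
      rw [lintegral_prod_prod m4, lintegral_rotate m4, hC, ← lintegral_const_mul _ mC]
      refine lintegral_congr_ae ?_
      filter_upwards [hQ, hq1, hq'1, hq0] with x h1 h2 h3 h0
      rw [lintegral_congr_ae (g := fun y => ENNReal.ofReal (c x) *
        ((∫⁻ θ, p (θ, x) ∂π) * (q (x, y) + q' (x, y))))]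
      · rw [lintegral_const_mul _ (by fun_prop), lintegral_const_mul _ (by fun_prop),
          lintegral_add_left (by fun_prop), h2, h3]
        ring
      · filter_upwards [h1, h0] with y h4 h5
        rw [lintegral_const_mul _ (by fun_prop), lintegral_const_mul _ (by fun_prop), h4]
        congr 1
        rw [mul_left_comm, add_mul, one_mul, ENNReal.div_mul_cancel h5.1 h5.2]
    have e5 : ∫⁻ z, ENNReal.ofReal (h z.1) * (p (z.1, z.2.1) * r (z.1, z.2.2))
        ∂(π.prod (μ.prod ν)) = A := by
      rw [lintegral_prod_prod m5, hA]
      refine lintegral_congr_ae ?_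
      filter_upwards [hp1, hr1] with θ h1 h2
      have : ∀ x, ∫⁻ y, ENNReal.ofReal (h θ) * (p (θ, x) * r (θ, y)) ∂ν =
          ENNReal.ofReal (h θ) * p (θ, x) := fun x => by
        rw [lintegral_const_mul _ (by fun_prop), lintegral_const_mul _ (by fun_prop), h2, mul_one]
      simp_rw [this]
      rw [lintegral_const_mul _ (by fun_prop), h1, mul_one]
    rwa [e1, e2, e3, e4, e5] at this
  have h2A : 2 * l * A ≠ ∞ := by finiteness
  have h2C : 2 * C ≠ ∞ := by finiteness
  have : 2 * T ≤ 2 * V := by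
    refine (ENNReal.add_le_add_iff_right h2A).1 ((ENNReal.add_le_add_iff_right h2C).1 ?_)
    calc 2 * T + 2 * l * A + 2 * C = 2 * l * A + 2 * T + 2 * C := by ring
      _ ≤ 2 * S + 2 * C := by gcongr
      _ ≤ _ := step2
      _ = _ := by ring
  exact (ENNReal.mul_le_mul_iff_right (by norm_num) (by norm_num)).1 this

/-- The weights are at least $1/3$ on $A$, so the integral of $G$ over $A$ is at most $3\varepsilon$
for every $\varepsilon$, hence zero. Since $A$ has positive measure, a zero of $G$ also satisfying
the almost sure property exists. -/
lemma exists_eq_zero_of_lintegral_mul_lt {A : Set Θ} (hA : MeasurableSet A) (hA0 : π A ≠ 0)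
    {G : Θ → ℝ≥0∞} (hG : Measurable G) {P : Θ → Prop} (hP : ∀ᵐ θ ∂π, P θ)
    (hB : ∀ ε : ℝ, 0 < ε → ∃ h : Θ → ℝ, (∀ θ ∈ A, 1 / 3 ≤ h θ) ∧
      ∫⁻ θ, ENNReal.ofReal (h θ) * G θ ∂π ≤ ENNReal.ofReal ε) : ∃ θ, P θ ∧ G θ = 0 := by
  have h0 : ∫⁻ θ in A, G θ ∂π = 0 := by
    have hle : ∀ ε : ℝ, 0 < ε → ∫⁻ θ in A, G θ ∂π ≤ 3 * ENNReal.ofReal ε := by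
      intro ε hε
      obtain ⟨h, h1, h2⟩ := hB ε hε
      calc ∫⁻ θ in A, G θ ∂π ≤ ∫⁻ θ in A, 3 * (ENNReal.ofReal (h θ) * G θ) ∂π := by
            refine setLIntegral_mono' hA fun θ hθ => ?_
            have : 1 ≤ 3 * ENNReal.ofReal (h θ) := by
              rw [show (3 : ℝ≥0∞) = ENNReal.ofReal 3 by simp, ← ENNReal.ofReal_mul (by norm_num),
                ← ENNReal.ofReal_one]
              exact ENNReal.ofReal_le_ofReal (by linarith [h1 θ hθ])
            calc G θ = 1 * G θ := (one_mul _).symm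
              _ ≤ 3 * ENNReal.ofReal (h θ) * G θ := by gcongr
              _ = _ := mul_assoc _ _ _
        _ ≤ ∫⁻ θ, 3 * (ENNReal.ofReal (h θ) * G θ) ∂π := setLIntegral_le_lintegral _ _
        _ = 3 * ∫⁻ θ, ENNReal.ofReal (h θ) * G θ ∂π := lintegral_const_mul' _ _ (by norm_num)
        _ ≤ _ := by gcongr
    have htop : ∫⁻ θ in A, G θ ∂π ≠ ∞ := ne_top_of_le_ne_top (by finiteness) (hle 1 one_pos)
    have hle' : ∀ ε : ℝ, 0 < ε → (∫⁻ θ in A, G θ ∂π).toReal ≤ 3 * ε := fun ε hε => by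
      have := ENNReal.toReal_mono (by finiteness) (hle ε hε)
      simpa [ENNReal.toReal_ofReal hε.le] using this
    have : (∫⁻ θ in A, G θ ∂π).toReal ≤ 0 :=
      le_of_forall_pos_le_add fun ε hε => by linarith [hle' (ε / 3) (by positivity)]
    rcases (ENNReal.toReal_eq_zero_iff _).1 (le_antisymm this ENNReal.toReal_nonneg) with h | h
    · exact h
    · exact absurd h htop
  rw [lintegral_eq_zero_iff hG] at h0
  have h2 : ∀ᵐ θ ∂(π.restrict A), P θ ∧ G θ = 0 := by
    filter_upwards [h0, ae_restrict_of_ae hP] with θ k1 k2 using ⟨k2, k1⟩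
  have : NeZero (π.restrict A) := ⟨fun h => hA0 (by simpa using h)⟩
  exact h2.exists

/-- A density `q'` whose risk is at most that of the Bayesian predictive density `q` equals `q`, if
the prior can be approximated by finite priors at an arbitrarily small cost. -/
theorem eq_of_klRisk_le [SFinite π] (hp : Measurable p) (hr : Measurable r) (hq : Measurable q)
    (hq' : Measurable q') (hp1 : ∀ᵐ θ ∂π, ∫⁻ x, p (θ, x) ∂μ = 1)
    (hr1 : ∀ᵐ θ ∂π, ∫⁻ y, r (θ, y) ∂ν = 1)
    (hp0 : ∀ᵐ θ ∂π, ∀ᵐ x ∂μ, p (θ, x) ≠ 0)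
    (hr0 : ∀ᵐ θ ∂π, ∀ᵐ y ∂ν, r (θ, y) ≠ 0 ∧ r (θ, y) ≠ ∞)
    (hq0 : ∀ᵐ x ∂μ, ∀ᵐ y ∂ν, q (x, y) ≠ 0 ∧ q (x, y) ≠ ∞)
    (hq'0 : ∀ᵐ x ∂μ, ∀ᵐ y ∂ν, q' (x, y) ≠ 0 ∧ q' (x, y) ≠ ∞)
    (hq1 : ∀ᵐ x ∂μ, ∫⁻ y, q (x, y) ∂ν = 1) (hq'1 : ∀ᵐ x ∂μ, ∫⁻ y, q' (x, y) ∂ν = 1)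
    (hQ : ∀ᵐ x ∂μ, ∀ᵐ y ∂ν,
      ∫⁻ θ, p (θ, x) * r (θ, y) ∂π = (∫⁻ θ, p (θ, x) ∂π) * q (x, y))
    (hR : ∀ᵐ θ ∂π, klRisk μ ν p r q θ < ∞)
    (hR' : ∀ᵐ θ ∂π, klRisk μ ν p r q' θ ≤ klRisk μ ν p r q θ)
    {A : Set Θ} (hA : MeasurableSet A) (hA0 : π A ≠ 0)
    (hB : ∀ ε : ℝ, 0 < ε → ∃ (h : Θ → ℝ) (c : X → ℝ), Measurable h ∧ Measurable c ∧
      (∀ θ, 0 ≤ h θ) ∧ (∀ x, 0 < c x) ∧ (∀ θ ∈ A, 1 / 3 ≤ h θ) ∧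
      ∫⁻ θ, ENNReal.ofReal (h θ) ∂π ≠ ∞ ∧
      ∫⁻ θ, ∫⁻ x, p (θ, x) * ENNReal.ofReal ((h θ - c x) ^ 2 / c x) ∂μ ∂π ≤ ENNReal.ofReal ε) :
    ∀ᵐ x ∂μ, ∀ᵐ y ∂ν, q' (x, y) = q (x, y) := by
  obtain ⟨θ, ⟨h1, h2⟩, h3⟩ := exists_eq_zero_of_lintegral_mul_lt hA hA0
    (measurable_gapRisk (μ := μ) (ν := ν) hp hr hq hq') (hp0.and hr0) fun ε hε => by
      obtain ⟨h, c, k1, k2, k3, k4, k5, k6, k7⟩ := hB ε hε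
      exact ⟨h, k5, (lintegral_mul_gapRisk_le hp hr hq hq' hp1 hr1 hr0 hq0 hq'0 hq1 hq'1 hQ hR hR'
        k1 k2 k3 k4 k6).trans k7⟩
  exact eq_of_gapRisk_eq_zero hp hr hq hq' hq0 hq'0 h1 (h2.mono fun _ h => h.1) h3

/-- Blyth's inequality for estimators of an intensity: a density `q'` whose risk exceeds that of the
posterior mean `q` by at most `κ` differs from `q` by little. -/
theorem two_mul_lintegral_mul_gapRisk_le [SFinite π] (hp : Measurable p) (hr : Measurable r)
    (hq : Measurable q) (hq' : Measurable q') (hp1 : ∀ᵐ θ ∂π, ∫⁻ x, p (θ, x) ∂μ = 1)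
    (hr0 : ∀ᵐ θ ∂π, ∀ᵐ y ∂ν, r (θ, y) ≠ 0 ∧ r (θ, y) ≠ ∞)
    (hq0 : ∀ᵐ x ∂μ, ∀ᵐ y ∂ν, q (x, y) ≠ 0 ∧ q (x, y) ≠ ∞)
    (hq'0 : ∀ᵐ x ∂μ, ∀ᵐ y ∂ν, q' (x, y) ≠ 0 ∧ q' (x, y) ≠ ∞)
    (hQ : ∀ᵐ x ∂μ, ∀ᵐ y ∂ν,
      ∫⁻ θ, p (θ, x) * r (θ, y) ∂π = (∫⁻ θ, p (θ, x) ∂π) * q (x, y))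
    (hR : ∀ᵐ θ ∂π, klRisk μ ν p r q θ < ∞) {κ : Θ → ℝ≥0∞} (hκ : Measurable κ)
    (hR' : ∀ᵐ θ ∂π, klRisk μ ν p r q' θ ≤ klRisk μ ν p r q θ + κ θ)
    {h : Θ → ℝ} {H g : X → ℝ} (hh : Measurable h) (hH : Measurable H) (hg : Measurable g)
    (hH0 : ∀ x, 0 ≤ H x) (hg0 : ∀ x, 0 < g x)
    (hgZ : ∀ᵐ x ∂μ, ∫⁻ θ, ENNReal.ofReal (h θ) * p (θ, x) ∂π =
      ENNReal.ofReal (g x) * ∫⁻ θ, p (θ, x) ∂π)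
    (hHQ : ∀ᵐ x ∂μ, ∀ᵐ y ∂ν, ∫⁻ θ, ENNReal.ofReal (h θ) * (p (θ, x) * r (θ, y)) ∂π =
      ENNReal.ofReal (H x) * ∫⁻ θ, p (θ, x) * r (θ, y) ∂π)
    (hb : ∫⁻ θ, ENNReal.ofReal (h θ) * ∫⁻ y, r (θ, y) ∂ν ∂π ≠ ∞)
    (hA : ∫⁻ θ, ENNReal.ofReal (h θ) * ∫⁻ x, p (θ, x) * ∫⁻ y, q (x, y) ∂ν ∂μ ∂π ≠ ∞)
    (hA' : ∫⁻ θ, ENNReal.ofReal (h θ) * ∫⁻ x, p (θ, x) * ∫⁻ y, q' (x, y) ∂ν ∂μ ∂π ≠ ∞) :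
    2 * ∫⁻ θ, ENNReal.ofReal (h θ) * gapRisk μ ν p r q q' θ ∂π ≤
      2 * ∫⁻ x, ENNReal.ofReal ((H x - g x) ^ 2 / g x) *
          ∫⁻ y, ∫⁻ θ, p (θ, x) * r (θ, y) ∂π ∂ν ∂μ +
        ∫⁻ θ, ENNReal.ofReal (h θ) * κ θ ∂π := by
  obtain ⟨l, hl⟩ : ∃ l, l = ENNReal.ofReal (Real.log 2) := ⟨_, rfl⟩
  have hl_top : l ≠ ∞ := by simp [hl]
  obtain ⟨V, hV⟩ : ∃ V, V = ∫⁻ x, ENNReal.ofReal ((H x - g x) ^ 2 / g x) *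
    ∫⁻ y, ∫⁻ θ, p (θ, x) * r (θ, y) ∂π ∂ν ∂μ := ⟨_, rfl⟩
  obtain ⟨B, hB⟩ : ∃ B, B = ∫⁻ θ, ENNReal.ofReal (h θ) * ∫⁻ y, r (θ, y) ∂ν ∂π := ⟨_, rfl⟩
  obtain ⟨A, hA_def⟩ : ∃ A, A =
    ∫⁻ θ, ENNReal.ofReal (h θ) * ∫⁻ x, p (θ, x) * ∫⁻ y, q (x, y) ∂ν ∂μ ∂π := ⟨_, rfl⟩
  obtain ⟨A', hA'_def⟩ : ∃ A', A' =
    ∫⁻ θ, ENNReal.ofReal (h θ) * ∫⁻ x, p (θ, x) * ∫⁻ y, q' (x, y) ∂ν ∂μ ∂π := ⟨_, rfl⟩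
  obtain ⟨S, hS⟩ : ∃ S, S = ∫⁻ θ, ENNReal.ofReal (h θ) * logSumRisk μ ν p r q q' θ ∂π := ⟨_, rfl⟩
  obtain ⟨T, hT⟩ : ∃ T, T = ∫⁻ θ, ENNReal.ofReal (h θ) * gapRisk μ ν p r q q' θ ∂π := ⟨_, rfl⟩
  obtain ⟨k, hk⟩ : ∃ k, k = ∫⁻ θ, ENNReal.ofReal (h θ) * κ θ ∂π := ⟨_, rfl⟩
  rw [← hV, ← hT, ← hk]
  rw [← hB] at hb
  rw [← hA_def] at hA
  rw [← hA'_def] at hA'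
  have mh : Measurable fun θ => ENNReal.ofReal (h θ) := hh.ennreal_ofReal
  have mg : Measurable fun x => ENNReal.ofReal (g x) := hg.ennreal_ofReal
  have mG : Measurable fun θ => ENNReal.ofReal (h θ) * gapRisk μ ν p r q q' θ :=
    mh.mul (measurable_gapRisk hp hr hq hq')
  have mL : Measurable fun θ => ENNReal.ofReal (h θ) * logSumRisk μ ν p r q q' θ :=
    mh.mul (measurable_logSumRisk hp hr hq hq')
  have mk : Measurable fun θ => ENNReal.ofReal (h θ) * κ θ := mh.mul hκ
  have mB : Measurable fun θ => ENNReal.ofReal (h θ) * ∫⁻ y, r (θ, y) ∂ν :=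
    mh.mul hr.lintegral_prod_right'
  have mass {f : X × Y → ℝ≥0∞} (hf : Measurable f) : Measurable fun θ =>
      ENNReal.ofReal (h θ) * ∫⁻ x, p (θ, x) * ∫⁻ y, f (x, y) ∂ν ∂μ := by
    have m1 : Measurable fun x => ∫⁻ y, f (x, y) ∂ν := hf.lintegral_prod_right'
    have m2 : Measurable fun z : Θ × X => p z * ∫⁻ y, f (z.2, y) ∂ν :=
      hp.mul (m1.comp measurable_snd)
    exact mh.mul m2.lintegral_prod_right'
  -- Integrating out the parameter turns $h$ into its posterior mean $g(x)$. This is what forces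
  -- $c=g$ in Young's inequality: the mass terms of the divergence identity then match the linear
  -- terms.
  have mass_eq {f : X × Y → ℝ≥0∞} (hf : Measurable f) :
      ∫⁻ θ, ENNReal.ofReal (h θ) * ∫⁻ x, p (θ, x) * ∫⁻ y, f (x, y) ∂ν ∂μ ∂π =
      ∫⁻ x, ∫⁻ y, ENNReal.ofReal (g x) * ((∫⁻ θ, p (θ, x) ∂π) * f (x, y)) ∂ν ∂μ := by
    have m1 : Measurable fun x => ∫⁻ y, f (x, y) ∂ν := hf.lintegral_prod_right'
    have m2 : Measurable fun z : Θ × X =>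
        ENNReal.ofReal (h z.1) * (p z * ∫⁻ y, f (z.2, y) ∂ν) :=
      (mh.comp measurable_fst).mul (hp.mul (m1.comp measurable_snd))
    have e1 : ∀ θ, ENNReal.ofReal (h θ) * ∫⁻ x, p (θ, x) * ∫⁻ y, f (x, y) ∂ν ∂μ =
        ∫⁻ x, ENNReal.ofReal (h θ) * (p (θ, x) * ∫⁻ y, f (x, y) ∂ν) ∂μ := fun θ => by
      rw [lintegral_const_mul _ (by fun_prop)]
    simp_rw [e1]
    rw [lintegral_lintegral_swap m2.aemeasurable]
    refine lintegral_congr_ae ?_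
    filter_upwards [hgZ] with x hx
    have e2 : ∀ θ, ENNReal.ofReal (h θ) * (p (θ, x) * ∫⁻ y, f (x, y) ∂ν) =
        ENNReal.ofReal (h θ) * p (θ, x) * ∫⁻ y, f (x, y) ∂ν := fun θ => (mul_assoc _ _ _).symm
    simp_rw [e2]
    rw [lintegral_mul_const _ (by fun_prop), hx, lintegral_const_mul _ (by fun_prop),
      lintegral_const_mul _ (by fun_prop), mul_assoc]
  -- the identity, integrated against the weight `h`
  have step1 : 2 * l * B + A' + 2 * T ≤ 2 * S + k + A := by
    have : ∀ᵐ θ ∂π, 2 * l * (ENNReal.ofReal (h θ) * ∫⁻ y, r (θ, y) ∂ν) +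
        ENNReal.ofReal (h θ) * ∫⁻ x, p (θ, x) * ∫⁻ y, q' (x, y) ∂ν ∂μ +
        2 * (ENNReal.ofReal (h θ) * gapRisk μ ν p r q q' θ) ≤
        2 * (ENNReal.ofReal (h θ) * logSumRisk μ ν p r q q' θ) + ENNReal.ofReal (h θ) * κ θ +
        ENNReal.ofReal (h θ) * ∫⁻ x, p (θ, x) * ∫⁻ y, q (x, y) ∂ν ∂μ := by
      filter_upwards [hp1, hr0, hR, hR'] with θ h1 h3 h4 h5
      have key := two_mul_logSumRisk_add_klRisk hp hr hq hq' hq0 hq'0 h3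
      rw [h1, one_mul, ← hl] at key
      have h6 : 2 * l * ∫⁻ y, r (θ, y) ∂ν + ∫⁻ x, p (θ, x) * ∫⁻ y, q' (x, y) ∂ν ∂μ +
          2 * gapRisk μ ν p r q q' θ ≤ 2 * logSumRisk μ ν p r q q' θ + κ θ +
          ∫⁻ x, p (θ, x) * ∫⁻ y, q (x, y) ∂ν ∂μ := by
        refine (ENNReal.add_le_add_iff_right h4.ne).1 ?_
        calc _ = 2 * l * ∫⁻ y, r (θ, y) ∂ν + klRisk μ ν p r q θ +
              ∫⁻ x, p (θ, x) * ∫⁻ y, q' (x, y) ∂ν ∂μ + 2 * gapRisk μ ν p r q q' θ := by ring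
          _ = 2 * logSumRisk μ ν p r q q' θ + klRisk μ ν p r q' θ +
              ∫⁻ x, p (θ, x) * ∫⁻ y, q (x, y) ∂ν ∂μ := key.symm
          _ ≤ 2 * logSumRisk μ ν p r q q' θ + (klRisk μ ν p r q θ + κ θ) +
              ∫⁻ x, p (θ, x) * ∫⁻ y, q (x, y) ∂ν ∂μ := by gcongr
          _ = _ := by ring
      calc _ = ENNReal.ofReal (h θ) * (2 * l * ∫⁻ y, r (θ, y) ∂ν +
            ∫⁻ x, p (θ, x) * ∫⁻ y, q' (x, y) ∂ν ∂μ + 2 * gapRisk μ ν p r q q' θ) := by ring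
        _ ≤ _ := mul_le_mul_right h6 _
        _ = _ := by ring
    have := lintegral_mono_ae this
    rwa [lintegral_add_right _ (mG.const_mul _), lintegral_add_right _ (mass hq'),
      lintegral_add_right _ (mass hq), lintegral_add_right _ mk,
      lintegral_const_mul _ mB, lintegral_const_mul _ mG,
      lintegral_const_mul _ mL, ← hB, ← hT, ← hS, ← hk, ← hA_def, ← hA'_def] at this
  -- Young's inequality, integrated
  have step2 : 2 * S + 2 * A ≤ 2 * V + (A + A') + 2 * l * B := by
    obtain ⟨Q, hQ_def⟩ : ∃ Q : X × Y → ℝ≥0∞, Q = fun z => ∫⁻ θ, p (θ, z.1) * r (θ, z.2) ∂π :=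
      ⟨_, rfl⟩
    have hQ_apply : ∀ x y, ∫⁻ θ, p (θ, x) * r (θ, y) ∂π = Q (x, y) := fun x y => by rw [hQ_def]
    have mQ : Measurable Q := by
      have : Measurable fun z : (X × Y) × Θ => p (z.2, z.1.1) * r (z.2, z.1.2) := by fun_prop
      rw [hQ_def]
      exact this.lintegral_prod_right'
    simp_rw [hQ_apply] at hHQ hQ hV
    have m1 : Measurable fun z : X × Y =>
      ENNReal.ofReal (H z.1) * (Q z * logSum (q z) (q' z)) := by fun_prop
    have m2 : Measurable fun z : X × Y => ENNReal.ofReal (g z.1) * Q z := by fun_prop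
    have m3 : Measurable fun z : X × Y =>
      ENNReal.ofReal ((H z.1 - g z.1) ^ 2 / g z.1) * Q z := by fun_prop
    have m4 : Measurable fun z : X × Y =>
      ENNReal.ofReal (g z.1) * ((1 + q' z / q z) * Q z) := by fun_prop
    have m5 : Measurable fun z : X × Y => ENNReal.ofReal (H z.1) * Q z := by fun_prop
    have hae : ∀ᵐ z ∂(μ.prod ν), (q z ≠ 0 ∧ q z ≠ ∞) ∧ (q' z ≠ 0 ∧ q' z ≠ ∞) := by
      rw [Measure.ae_prod_iff_ae_ae]
      · filter_upwards [hq0, hq'0] with x k1 k2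
        filter_upwards [k1, k2] with y k3 k4 using ⟨k3, k4⟩
      · have a1 : MeasurableSet {z | q z ≠ 0} := hq (measurableSet_singleton 0).compl
        have a2 : MeasurableSet {z | q z ≠ ∞} := hq (measurableSet_singleton ∞).compl
        have a3 : MeasurableSet {z | q' z ≠ 0} := hq' (measurableSet_singleton 0).compl
        have a4 : MeasurableSet {z | q' z ≠ ∞} := hq' (measurableSet_singleton ∞).compl
        exact (a1.inter a2).inter (a3.inter a4)
    have ineq : ∀ᵐ z ∂(μ.prod ν),
        2 * (ENNReal.ofReal (H z.1) * (Q z * logSum (q z) (q' z))) +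
          2 * (ENNReal.ofReal (g z.1) * Q z) ≤
        2 * (ENNReal.ofReal ((H z.1 - g z.1) ^ 2 / g z.1) * Q z) +
          ENNReal.ofReal (g z.1) * ((1 + q' z / q z) * Q z) +
          2 * l * (ENNReal.ofReal (H z.1) * Q z) := by
      filter_upwards [hae] with z hz
      have := two_mul_logSum_le (hH0 z.1) (hg0 z.1) hz.1.1 hz.1.2 hz.2.2
      rw [← hl] at this
      calc _ = Q z * (2 * (ENNReal.ofReal (H z.1) *
            logSum (q z) (q' z)) + 2 * ENNReal.ofReal (g z.1)) := by ring
        _ ≤ _ := mul_le_mul_right this _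
        _ = _ := by ring
    have := lintegral_mono_ae ineq
    rw [lintegral_add_right _ (m2.const_mul _), lintegral_add_right _ (m5.const_mul _),
      lintegral_add_right _ m4, lintegral_const_mul _ m1, lintegral_const_mul _ m2,
      lintegral_const_mul _ m3, lintegral_const_mul _ m5] at this
    -- Terms carrying the intensity $r$ see $h$ only through the mean $H(x)$ biased by $r$, which by
    -- hypothesis is the same for every $y$.
    have weight {f : X × Y → ℝ≥0∞} (hf : Measurable f) :
        ∫⁻ θ, ENNReal.ofReal (h θ) * ∫⁻ x, ∫⁻ y, p (θ, x) * (r (θ, y) * f (x, y)) ∂ν ∂μ ∂π =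
        ∫⁻ z, ENNReal.ofReal (H z.1) * (Q z * f z) ∂(μ.prod ν) := by
      have m0 : Measurable fun z : Θ × X × Y =>
        ENNReal.ofReal (h z.1) * (p (z.1, z.2.1) * (r (z.1, z.2.2) * f z.2)) := by fun_prop
      have m6 : Measurable fun z : X × Y => ENNReal.ofReal (H z.1) * (Q z * f z) := by fun_prop
      have e1 : ∀ θ, ENNReal.ofReal (h θ) * ∫⁻ x, ∫⁻ y, p (θ, x) * (r (θ, y) * f (x, y)) ∂ν ∂μ =
          ∫⁻ x, ∫⁻ y, ENNReal.ofReal (h θ) * (p (θ, x) * (r (θ, y) * f (x, y))) ∂ν ∂μ := fun θ => by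
        have mm : Measurable fun z : X × Y => p (θ, z.1) * (r (θ, z.2) * f z) := by fun_prop
        rw [← lintegral_const_mul _ mm.lintegral_prod_right']
        refine lintegral_congr fun x => ?_
        have mx : Measurable fun y => p (θ, x) * (r (θ, y) * f (x, y)) := by fun_prop
        exact (lintegral_const_mul _ mx).symm
      simp_rw [e1]
      rw [lintegral_rotate m0, lintegral_prod _ m6.aemeasurable]
      refine lintegral_congr_ae ?_
      filter_upwards [hHQ] with x h1
      refine lintegral_congr_ae ?_
      filter_upwards [h1] with y h2
      have e2 : ∀ θ, ENNReal.ofReal (h θ) * (p (θ, x) * (r (θ, y) * f (x, y))) =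
          ENNReal.ofReal (h θ) * (p (θ, x) * r (θ, y)) * f (x, y) := fun θ => by ring
      simp_rw [e2]
      rw [lintegral_mul_const _ (by fun_prop), h2, mul_assoc]
    have e1 : ∫⁻ z, ENNReal.ofReal (H z.1) * (Q z * logSum (q z) (q' z)) ∂(μ.prod ν) = S :=
      (weight (by fun_prop)).symm.trans hS.symm
    have e2 : ∫⁻ z, ENNReal.ofReal (g z.1) * Q z ∂(μ.prod ν) = A := by
      rw [lintegral_prod _ m2.aemeasurable, hA_def, mass_eq hq]
      refine lintegral_congr_ae ?_
      filter_upwards [hQ] with x h1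
      refine lintegral_congr_ae ?_
      filter_upwards [h1] with y h2
      rw [h2]
    have e3 : ∫⁻ z, ENNReal.ofReal ((H z.1 - g z.1) ^ 2 / g z.1) * Q z ∂(μ.prod ν) = V := by
      rw [lintegral_prod _ m3.aemeasurable, hV]
      refine lintegral_congr fun x => ?_
      have mx : Measurable fun y => Q (x, y) := by fun_prop
      exact lintegral_const_mul (ENNReal.ofReal ((H x - g x) ^ 2 / g x)) mx
    have e4 : ∫⁻ z, ENNReal.ofReal (g z.1) * ((1 + q' z / q z) * Q z) ∂(μ.prod ν) = A + A' := by
      have m7 : Measurable fun z : X × Y =>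
          ENNReal.ofReal (g z.1) * ((∫⁻ θ, p (θ, z.1) ∂π) * q z) := by
        have : Measurable fun x => ∫⁻ θ, p (θ, x) ∂π := hp.lintegral_prod_left'
        fun_prop
      rw [lintegral_prod _ m4.aemeasurable, hA_def, hA'_def, mass_eq hq, mass_eq hq',
        ← lintegral_add_left m7.lintegral_prod_right']
      refine lintegral_congr_ae ?_
      filter_upwards [hQ, hq0] with x h1 h0
      have m8 : Measurable fun y => ENNReal.ofReal (g x) * ((∫⁻ θ, p (θ, x) ∂π) * q (x, y)) := by
        fun_prop
      rw [← lintegral_add_left m8]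
      refine lintegral_congr_ae ?_
      filter_upwards [h1, h0] with y h4 h5
      rw [h4, ← mul_add, ← mul_add, mul_left_comm (1 + _), add_mul, one_mul,
        ENNReal.div_mul_cancel h5.1 h5.2]
    have e5 : ∫⁻ z, ENNReal.ofReal (H z.1) * Q z ∂(μ.prod ν) = B := by
      have := weight (f := fun _ => 1) measurable_const
      simp only [mul_one] at this
      rw [← this, hB]
      refine lintegral_congr_ae ?_
      filter_upwards [hp1] with θ h1
      have : ∀ x, ∫⁻ y, p (θ, x) * r (θ, y) ∂ν = p (θ, x) * ∫⁻ y, r (θ, y) ∂ν := fun x =>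
        lintegral_const_mul _ (by fun_prop)
      simp_rw [this]
      rw [lintegral_mul_const _ (by fun_prop), h1, one_mul]
    rwa [e1, e2, e3, e4, e5] at this
  -- Adding the two inequalities, the terms in $B$, $A$ and $A'$ balance. Cancelling them requires
  -- their finiteness; for $A'$ this is the reason for capping the competitor later.
  refine (ENNReal.add_le_add_iff_right (a := 2 * l * B + A' + 2 * A) (by finiteness)).1 ?_
  calc 2 * T + (2 * l * B + A' + 2 * A) = 2 * l * B + A' + 2 * T + 2 * A := by ring
    _ ≤ 2 * S + k + A + 2 * A := by gcongr
    _ = 2 * S + 2 * A + (k + A) := by ring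
    _ ≤ 2 * V + (A + A') + 2 * l * B + (k + A) := by gcongr
    _ = _ := by ring

end Cores

/-! ### Posterior means as jointly measurable densities. -/

section PosteriorMean

variable {Θ X Y : Type*} [MeasurableSpace Θ] {π : Measure Θ} {p : Θ × X → ℝ≥0∞}
  {r : Θ × Y → ℝ≥0∞}

/-- The posterior mean of `r (θ, y)` given `x`, for the prior `π` and the likelihood `p`. -/
noncomputable def posteriorMean (π : Measure Θ) (p : Θ × X → ℝ≥0∞) (r : Θ × Y → ℝ≥0∞)
    (z : X × Y) : ℝ≥0∞ :=
  (∫⁻ θ, p (θ, z.1) ∂π)⁻¹ * ∫⁻ θ, p (θ, z.1) * r (θ, z.2) ∂π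

lemma lintegral_mul_eq_mul_posteriorMean {x : X} (hZ : ∫⁻ θ, p (θ, x) ∂π ≠ 0)
    (hZ' : ∫⁻ θ, p (θ, x) ∂π ≠ ∞) (y : Y) :
    ∫⁻ θ, p (θ, x) * r (θ, y) ∂π = (∫⁻ θ, p (θ, x) ∂π) * posteriorMean π p r (x, y) := by
  rw [posteriorMean, ← mul_assoc, ENNReal.mul_inv_cancel hZ hZ', one_mul]

variable [MeasurableSpace X] [MeasurableSpace Y] {ν : Measure Y}

lemma measurable_posteriorMean [SFinite π] (hp : Measurable p) (hr : Measurable r) :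
    Measurable (posteriorMean π p r) := by
  have m1 : Measurable fun x => ∫⁻ θ, p (θ, x) ∂π := hp.lintegral_prod_left'
  have m2 : Measurable fun z : (X × Y) × Θ => p (z.2, z.1.1) * r (z.2, z.1.2) := by fun_prop
  have m3 : Measurable fun z : X × Y => ∫⁻ θ, p (θ, z.1) * r (θ, z.2) ∂π := m2.lintegral_prod_right'
  exact (m1.comp measurable_fst).inv.mul m3

lemma lintegral_posteriorMean [SFinite π] [SFinite ν] (hp : Measurable p) (hr : Measurable r)
    (x : X) : ∫⁻ y, posteriorMean π p r (x, y) ∂ν =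
      (∫⁻ θ, p (θ, x) ∂π)⁻¹ * ∫⁻ θ, p (θ, x) * ∫⁻ y, r (θ, y) ∂ν ∂π := by
  have m1 : Measurable fun z : Y × Θ => p (z.2, x) * r (z.2, z.1) := by fun_prop
  have m2 : Measurable fun y => ∫⁻ θ, p (θ, x) * r (θ, y) ∂π := m1.lintegral_prod_right'
  simp only [posteriorMean]
  rw [lintegral_const_mul _ m2, lintegral_lintegral_swap m1.aemeasurable]
  congr 1
  exact lintegral_congr fun θ => lintegral_const_mul _ (by fun_prop)

/-- By exchanging the order of the almost everywhere quantifiers, for almost every $y$ the factor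
$r(\theta,y)$ is nonzero for almost every $\theta$; a zero integral would then force the normalizing
constant to be zero. -/
lemma ae_posteriorMean_ne_zero [SFinite π] [SFinite ν] (hp : Measurable p) (hr : Measurable r)
    (hr0 : ∀ᵐ θ ∂π, ∀ᵐ y ∂ν, r (θ, y) ≠ 0) {x : X} (hZ : ∫⁻ θ, p (θ, x) ∂π ≠ 0)
    (hZ' : ∫⁻ θ, p (θ, x) ∂π ≠ ∞) : ∀ᵐ y ∂ν, posteriorMean π p r (x, y) ≠ 0 := by
  have h1 : ∀ᵐ y ∂ν, ∀ᵐ θ ∂π, r (θ, y) ≠ 0 :=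
    (Measure.ae_ae_comm (p := fun θ y => r (θ, y) ≠ 0) (hr (measurableSet_singleton 0).compl)).1 hr0
  filter_upwards [h1] with y hy h0
  rw [posteriorMean, mul_eq_zero, ENNReal.inv_eq_zero, or_iff_right hZ',
    lintegral_eq_zero_iff (by fun_prop)] at h0
  refine hZ ((lintegral_eq_zero_iff (by fun_prop)).2 ?_)
  filter_upwards [h0, hy] with θ h2 h3
  exact (mul_eq_zero.1 h2).resolve_right h3

lemma measurable_withDensity_prodMk [SFinite ν] {q : X × Y → ℝ≥0∞} (hq : Measurable q) :
    Measurable fun x => ν.withDensity fun y => q (x, y) := by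
  refine Measure.measurable_of_measurable_coe _ fun s hs => ?_
  simp_rw [withDensity_apply _ hs]
  exact hq.lintegral_prod_right'

end PosteriorMean

/-! ### The kernel mixture model and its marginals. -/

section Model

variable {X : Type*} [MeasurableSpace X] {ν : Measure X} {k : X → X → ℝ≥0}
  {D : Measure (ProbabilityMeasure X)} {a s t : ℝ}

lemma measurable_mixture (hk : IsKernelFunction ν k) :
    Measurable fun z : ProbabilityMeasure X × X => mixture k z.1 z.2 := by
  -- The tautological kernel, integrating against the mixing measure itself; joint measurability of
  -- the mixture is then measurability of a parametric integral.
  let κ : Kernel (ProbabilityMeasure X × X) X :=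
    ⟨fun z => (z.1 : Measure X), measurable_subtype_coe.comp measurable_fst⟩
  have : IsMarkovKernel κ := ⟨fun z => z.1.2⟩
  have hm : Measurable fun z : (ProbabilityMeasure X × X) × X => (k z.1.2 z.2 : ℝ≥0∞) :=
    (hk.measurable.comp (by fun_prop :
      Measurable fun z : (ProbabilityMeasure X × X) × X => (z.1.2, z.2))).coe_nnreal_ennreal
  exact hm.lintegral_kernel_prod_right' (κ := κ)

lemma measurable_mixture_right (hk : IsKernelFunction ν k) (m : ProbabilityMeasure X) :
    Measurable (mixture k m) := (measurable_mixture hk).comp measurable_prodMk_left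

lemma poissonDensity_eq_poissonPdf {w : ℝ} (hsw : 0 ≤ s * w) {f : X → ℝ≥0∞} (hf : Measurable f)
    (h1 : ∫⁻ y, f y ∂ν = 1) (x : Config X) :
    poissonDensity s w f x = poissonPdf ν (fun y => ENNReal.ofReal (s * w) * f y) x := by
  unfold poissonDensity poissonPdf
  rw [lintegral_const_mul _ hf, h1, mul_one, ENNReal.toReal_ofReal hsw, Finset.prod_mul_distrib,
    Finset.prod_const, Finset.card_univ, Fintype.card_fin, ← ENNReal.ofReal_pow hsw,
    ENNReal.ofReal_mul (by positivity), ENNReal.ofReal_div_of_pos (by positivity),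
    ENNReal.ofReal_natCast, div_eq_mul_inv]
  ring

lemma measurable_poissonDensity_mixture (hk : IsKernelFunction ν k) (s : ℝ) :
    Measurable fun z : (ℝ × ProbabilityMeasure X) × Config X =>
      poissonDensity s z.1.1 (mixture k z.1.2) z.2 := by
  have : Measurable fun z : Config X × (ℝ × ProbabilityMeasure X) =>
      poissonDensity s z.2.1 (mixture k z.2.2) z.1 := by
    refine measurable_of_sigma_prod fun n => ?_
    show Measurable fun z : (Fin n → X) × (ℝ × ProbabilityMeasure X) =>
      (∏ i, mixture k z.2.2 (z.1 i)) *
        ENNReal.ofReal ((s * z.2.1) ^ n / (Nat.factorial n : ℝ) * Real.exp (-(s * z.2.1)))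
    have h1 : Measurable fun z : (Fin n → X) × (ℝ × ProbabilityMeasure X) =>
        ∏ i, mixture k z.2.2 (z.1 i) :=
      Finset.measurable_prod _ fun i _ => (measurable_mixture hk).comp (by fun_prop :
        Measurable fun z : (Fin n → X) × (ℝ × ProbabilityMeasure X) => (z.2.2, z.1 i))
    have h2 : Measurable fun z : (Fin n → X) × (ℝ × ProbabilityMeasure X) =>
        ENNReal.ofReal ((s * z.2.1) ^ n / (Nat.factorial n : ℝ) * Real.exp (-(s * z.2.1))) := by
      fun_prop
    exact h1.mul h2
  exact this.comp measurable_swap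

lemma measurable_intensity (hk : IsKernelFunction ν k) :
    Measurable fun z : (ℝ × ProbabilityMeasure X) × X => intensity k z.1 z.2 := by
  have h1 : Measurable fun z : (ℝ × ProbabilityMeasure X) × X => mixture k z.1.2 z.2 :=
    (measurable_mixture hk).comp (by fun_prop :
      Measurable fun z : (ℝ × ProbabilityMeasure X) × X => (z.1.2, z.2))
  unfold intensity
  fun_prop

/-- The improper prior `w ^ (a - 1) dw` on the total mass. -/
noncomputable def massPrior (a : ℝ) : Measure ℝ :=
  (volume.restrict (Ioi (0 : ℝ))).withDensity fun w => ENNReal.ofReal (w ^ (a - 1))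

instance (a : ℝ) : SFinite (massPrior a) := by unfold massPrior; infer_instance

lemma ae_massPrior_pos (a : ℝ) : ∀ᵐ w ∂(massPrior a), 0 < w :=
  (withDensity_absolutelyContinuous _ _).ae_le (ae_restrict_mem measurableSet_Ioi)

lemma lintegral_massPrior {F : ℝ → ℝ≥0∞} (hF : Measurable F) :
    ∫⁻ w, F w ∂(massPrior a) = ∫⁻ w in Ioi (0 : ℝ), ENNReal.ofReal (w ^ (a - 1)) * F w := by
  unfold massPrior
  rw [lintegral_withDensity_eq_lintegral_mul _ (by fun_prop) hF]
  rfl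

lemma ae_prior_iff_imp [SFinite D] {P : ProbabilityMeasure X → Prop} (hP : ∀ᵐ m ∂D, P m) :
    ∀ᵐ θ ∂((massPrior a).prod D), 0 < θ.1 ∧ P θ.2 :=
  (Measure.quasiMeasurePreserving_fst.ae (ae_massPrior_pos a)).and
    (Measure.quasiMeasurePreserving_snd.ae hP)

/-- The likelihood is a Poisson weight in $w$ times a product of mixture densities in $m$, so the
two coordinates stay independent under the posterior, and the law of $w$ depends on $x$ through the
count only. -/
lemma lintegral_prior_mul_poissonDensity [SFinite D] (hk : IsKernelFunction ν k)
    {F : ℝ → ℝ≥0∞} (hF : Measurable F) {G : ProbabilityMeasure X → ℝ≥0∞} (hG : Measurable G)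
    (x : Config X) :
    ∫⁻ θ, F θ.1 * (poissonDensity s θ.1 (mixture k θ.2) x * G θ.2) ∂((massPrior a).prod D) =
      (∫⁻ w in Ioi (0 : ℝ), F w * ENNReal.ofReal (gammaWeight a s x.1 w)) *
        ∫⁻ m, (∏ i, mixture k m (x.2 i)) * G m ∂D := by
  have m1 : Measurable fun m => ∏ i, mixture k m (x.2 i) :=
    Finset.measurable_prod _ fun i _ => (measurable_mixture hk).comp (by fun_prop :
        Measurable fun m : ProbabilityMeasure X => (m, x.2 i))
  have m2 : Measurable fun w : ℝ => F w * ENNReal.ofReal (poissonWeight (s * w) x.1) :=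
    hF.mul ((measurable_poissonWeight _).comp (by fun_prop)).ennreal_ofReal
  have e : ∀ θ : ℝ × ProbabilityMeasure X,
      F θ.1 * (poissonDensity s θ.1 (mixture k θ.2) x * G θ.2) =
      F θ.1 * ENNReal.ofReal (poissonWeight (s * θ.1) x.1) *
        ((∏ i, mixture k θ.2 (x.2 i)) * G θ.2) := fun θ => by
    unfold poissonDensity poissonWeight; ring
  simp_rw [e]
  rw [lintegral_prod_mul (f := fun w : ℝ => F w * ENNReal.ofReal (poissonWeight (s * w) x.1))
    (g := fun m => (∏ i, mixture k m (x.2 i)) * G m) m2.aemeasurable (m1.mul hG).aemeasurable,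
    lintegral_massPrior m2]
  congr 1
  refine setLIntegral_congr_fun measurableSet_Ioi fun w hw => ?_
  have hw0 : (0 : ℝ) < w := hw
  simp only [gammaWeight]
  rw [ENNReal.ofReal_mul (Real.rpow_nonneg hw0.le _)]
  ring

lemma lintegral_prior_poissonDensity [SFinite D] (hk : IsKernelFunction ν k) (ha : 0 < a)
    (hs : 0 < s) (x : Config X) :
    ∫⁻ θ, poissonDensity s θ.1 (mixture k θ.2) x ∂((massPrior a).prod D) =
      ENNReal.ofReal (gammaMass a s x.1) * ∫⁻ m, ∏ i, mixture k m (x.2 i) ∂D := by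
  have := lintegral_prior_mul_poissonDensity (a := a) (D := D) (s := s) hk (F := fun _ => 1)
    (G := fun _ => 1) measurable_const measurable_const x
  simp only [one_mul, mul_one] at this
  rw [this, gammaMass, ofReal_integral_eq_lintegral_ofReal (integrableOn_gammaWeight ha hs _)]
  exact (ae_restrict_mem measurableSet_Ioi).mono fun w hw => gammaWeight_nonneg hs _ hw

lemma lintegral_posterior {π : Measure (ℝ × ProbabilityMeasure X)} (hk : IsKernelFunction ν k)
    {F : ℝ × ProbabilityMeasure X → ℝ≥0∞} (hF : Measurable F) (x : Config X) :
    ∫⁻ θ, F θ ∂(posterior k s π x) =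
      (∫⁻ θ, poissonDensity s θ.1 (mixture k θ.2) x ∂π)⁻¹ *
        ∫⁻ θ, poissonDensity s θ.1 (mixture k θ.2) x * F θ ∂π := by
  have hm : Measurable fun θ : ℝ × ProbabilityMeasure X =>
      poissonDensity s θ.1 (mixture k θ.2) x :=
    (measurable_poissonDensity_mixture hk s).comp measurable_prodMk_right
  rw [posterior, lintegral_smul_measure, lintegral_withDensity_eq_lintegral_mul _ hm hF]
  rfl

lemma bayesPredictive_eq {π : Measure (ℝ × ProbabilityMeasure X)} (hk : IsKernelFunction ν k)
    (x : Config X) :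
    bayesPredictive ν k s t π x = (configMeasure ν).withDensity fun y => posteriorMean π
      (fun z : (ℝ × ProbabilityMeasure X) × Config X => poissonDensity s z.1.1 (mixture k z.1.2) z.2)
      (fun z : (ℝ × ProbabilityMeasure X) × Config X => poissonDensity t z.1.1 (mixture k z.1.2) z.2)
      (x, y) := by
  unfold bayesPredictive
  congr 1
  ext y
  exact lintegral_posterior hk
    ((measurable_poissonDensity_mixture hk t).comp measurable_prodMk_right) x

lemma bayesEstimator_eq {π : Measure (ℝ × ProbabilityMeasure X)} (hk : IsKernelFunction ν k)
    (x : Config X) :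
    bayesEstimator ν k s π x = ν.withDensity fun y => posteriorMean π
      (fun z : (ℝ × ProbabilityMeasure X) × Config X => poissonDensity s z.1.1 (mixture k z.1.2) z.2)
      (fun z : (ℝ × ProbabilityMeasure X) × X => intensity k z.1 z.2) (x, y) := by
  unfold bayesEstimator
  congr 1
  ext y
  exact lintegral_posterior hk ((measurable_intensity hk).comp measurable_prodMk_right) x

variable [SigmaFinite ν]

lemma lintegral_mixture (hk : IsKernelFunction ν k) (m : ProbabilityMeasure X) :
    ∫⁻ y, mixture k m y ∂ν = 1 := by
  unfold mixture
  rw [lintegral_lintegral_swap]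
  · simp [hk.lintegral_eq_one]
  · exact hk.measurable.coe_nnreal_ennreal.aemeasurable

lemma lintegral_intensity (hk : IsKernelFunction ν k) (θ : ℝ × ProbabilityMeasure X) :
    ∫⁻ y, intensity k θ y ∂ν = ENNReal.ofReal θ.1 := by
  unfold intensity
  rw [lintegral_const_mul _ (measurable_mixture_right hk _), lintegral_mixture hk, mul_one]

/-- Finiteness holds because the mixed product density has integral one over each $U^n$; positivity
because, by exchanging almost everywhere quantifiers, the product is nonzero for almost every $m$.
-/
lemma ae_lintegral_prod_mixture [IsProbabilityMeasure D] (hk : IsKernelFunction ν k)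
    (h0 : ∀ᵐ m ∂D, ∀ᵐ y ∂ν, mixture k m y ≠ 0) :
    ∀ᵐ x ∂(configMeasure ν), ∫⁻ m, ∏ i, mixture k m (x.2 i) ∂D ≠ 0 ∧
      ∫⁻ m, ∏ i, mixture k m (x.2 i) ∂D ≠ ∞ := by
  refine ae_configMeasure fun n => ?_
  have m1 : Measurable fun z : ProbabilityMeasure X × (Fin n → X) =>
      ∏ i, mixture k z.1 (z.2 i) :=
    Finset.measurable_prod _ fun i _ => (measurable_mixture hk).comp (by fun_prop :
      Measurable fun z : ProbabilityMeasure X × (Fin n → X) => (z.1, z.2 i))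
  have c1 : ∀ᵐ z ∂(Measure.pi fun _ : Fin n => ν), ∫⁻ m, ∏ i, mixture k m (z i) ∂D < ∞ := by
    refine ae_lt_top m1.lintegral_prod_left' ?_
    have : ∫⁻ z, ∫⁻ m, ∏ i, mixture k m (z i) ∂D ∂(Measure.pi fun _ : Fin n => ν) = 1 := by
      rw [← lintegral_lintegral_swap m1.aemeasurable]
      simp_rw [fun m => lintegral_fin_prod_eq_prod (μ := ν) (n := n)
        (fun _ => measurable_mixture_right hk m), lintegral_mixture hk]
      simp
    rw [this]
    exact ENNReal.one_ne_top
  have c2 : ∀ᵐ z ∂(Measure.pi fun _ : Fin n => ν), ∀ᵐ m ∂D, ∏ i, mixture k m (z i) ≠ 0 := by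
    refine (Measure.ae_ae_comm
      (p := fun (m : ProbabilityMeasure X) (z : Fin n → X) => ∏ i, mixture k m (z i) ≠ 0)
      (m1 (measurableSet_singleton 0).compl)).1 ?_
    filter_upwards [h0] with m hm
    filter_upwards [ae_pi_forall (n := n) hm] with z hz
    exact Finset.prod_ne_zero_iff.2 fun i _ => hz i
  filter_upwards [c1, c2] with z h1 h2
  refine ⟨fun h3 => ?_, h1.ne⟩
  have m2 : Measurable fun m => ∏ i, mixture k m (z i) := m1.comp measurable_prodMk_right
  rw [lintegral_eq_zero_iff m2] at h3
  obtain ⟨m, h4, h5⟩ := (h2.and h3).exists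
  exact h4 h5

lemma ae_lintegral_prior_poissonDensity [IsProbabilityMeasure D] (hk : IsKernelFunction ν k)
    (h0 : ∀ᵐ m ∂D, ∀ᵐ y ∂ν, mixture k m y ≠ 0) (ha : 0 < a) (hs : 0 < s) :
    ∀ᵐ x ∂(configMeasure ν),
      ∫⁻ θ, poissonDensity s θ.1 (mixture k θ.2) x ∂((massPrior a).prod D) ≠ 0 ∧
      ∫⁻ θ, poissonDensity s θ.1 (mixture k θ.2) x ∂((massPrior a).prod D) ≠ ∞ := by
  filter_upwards [ae_lintegral_prod_mixture hk h0] with x hx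
  rw [lintegral_prior_poissonDensity hk ha hs]
  exact ⟨mul_ne_zero (by simpa using gammaMass_pos ha hs _) hx.1,
    ENNReal.mul_ne_top ENNReal.ofReal_ne_top hx.2⟩

lemma lintegral_poissonDensity (hk : IsKernelFunction ν k) (hs : 0 < s)
    {θ : ℝ × ProbabilityMeasure X} (hθ : 0 < θ.1) :
    ∫⁻ x, poissonDensity s θ.1 (mixture k θ.2) x ∂(configMeasure ν) = 1 := by
  simp_rw [poissonDensity_eq_poissonPdf (ν := ν) (mul_pos hs hθ).le
    (measurable_mixture_right hk θ.2) (lintegral_mixture hk θ.2)]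
  have hm := measurable_mixture_right hk θ.2
  refine lintegral_poissonPdf (by fun_prop) ?_
  rw [lintegral_const_mul _ hm, lintegral_mixture hk]
  simp

lemma ae_mixture_ne_top (hk : IsKernelFunction ν k) (m : ProbabilityMeasure X) :
    ∀ᵐ y ∂ν, mixture k m y ≠ ∞ :=
  (ae_lt_top (measurable_mixture_right hk m) (by simp [lintegral_mixture hk])).mono
    fun _ h => h.ne

lemma ae_poissonDensity_ne (hk : IsKernelFunction ν k) (hs : 0 < s)
    {θ : ℝ × ProbabilityMeasure X} (hθ : 0 < θ.1) (h0 : ∀ᵐ y ∂ν, mixture k θ.2 y ≠ 0) :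
    ∀ᵐ x ∂(configMeasure ν), poissonDensity s θ.1 (mixture k θ.2) x ≠ 0 ∧
      poissonDensity s θ.1 (mixture k θ.2) x ≠ ∞ := by
  filter_upwards [ae_configMeasure_forall h0, ae_configMeasure_forall (ae_mixture_ne_top hk θ.2)]
    with x h1 h2
  have : 0 < s * θ.1 := mul_pos hs hθ
  unfold poissonDensity
  refine ⟨mul_ne_zero (Finset.prod_ne_zero_iff.2 fun i _ => h1 i) ?_,
    ENNReal.mul_ne_top (ENNReal.prod_ne_top fun i _ => h2 i) ENNReal.ofReal_ne_top⟩
  rw [Ne, ENNReal.ofReal_eq_zero, not_le]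
  positivity

lemma ae_intensity_ne (hk : IsKernelFunction ν k) {θ : ℝ × ProbabilityMeasure X} (hθ : 0 < θ.1)
    (h0 : ∀ᵐ y ∂ν, mixture k θ.2 y ≠ 0) :
    ∀ᵐ y ∂ν, intensity k θ y ≠ 0 ∧ intensity k θ y ≠ ∞ := by
  filter_upwards [h0, ae_mixture_ne_top hk θ.2] with y h1 h2
  exact ⟨mul_ne_zero (by simpa using hθ) h1, ENNReal.mul_ne_top ENNReal.ofReal_ne_top h2⟩

lemma poissonProcess_smul_intensity (hk : IsKernelFunction ν k) (hs : 0 < s)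
    {θ : ℝ × ProbabilityMeasure X} (hθ : 0 < θ.1) :
    poissonProcess (ENNReal.ofReal s • ν.withDensity (intensity k θ)) =
      (configMeasure ν).withDensity (poissonDensity s θ.1 (mixture k θ.2)) := by
  have hm := measurable_mixture_right hk θ.2
  have e : ENNReal.ofReal s • ν.withDensity (intensity k θ) =
      ν.withDensity fun y => ENNReal.ofReal (s * θ.1) * mixture k θ.2 y := by
    have hi : Measurable (intensity k θ) := (measurable_intensity hk).comp measurable_prodMk_left
    rw [← withDensity_smul _ hi]
    congr 1
    ext y
    simp only [Pi.smul_apply, smul_eq_mul, intensity]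
    rw [ENNReal.ofReal_mul hs.le, mul_assoc]
  rw [e, poissonProcess_withDensity (by fun_prop)]
  · congr 1
    ext x
    exact (poissonDensity_eq_poissonPdf (mul_pos hs hθ).le hm (lintegral_mixture hk _) x).symm
  · rw [lintegral_const_mul _ hm, lintegral_mixture hk]
    simp

end Model

/-! ### Jointly measurable densities for decision rules. -/

section KernelDensity

variable {X Y : Type*} [MeasurableSpace X] [MeasurableSpace Y]
  [MeasurableSpace.CountablyGenerated Y] {ρ : Measure Y} {g : Y → ℝ≥0∞}

/-- A measurable family of finite measures dominated by a reference measure has jointly measurable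
densities. -/
lemma exists_measurable_density (hg : Measurable g) (hg0 : ∀ y, g y ≠ 0)
    (hg1 : ∫⁻ y, g y ∂ρ ≠ ∞) {δ : X → Measure Y} (hδ : Measurable δ) :
    ∃ q : X × Y → ℝ≥0∞, Measurable q ∧
      ∀ x, δ x univ ≠ ∞ → δ x ≪ ρ → δ x = ρ.withDensity fun y => q (x, y) := by
  have hmass : Measurable fun x => δ x univ := Measure.measurable_coe MeasurableSet.univ |>.comp hδ
  have hfin : IsFiniteMeasure (ρ.withDensity g) := isFiniteMeasure_withDensity hg1
  let η : Kernel X Y := Kernel.const X (ρ.withDensity g)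
  -- Dividing by one plus the total mass makes a finite kernel of total mass at most one, also at
  -- points where the measure is infinite, since there the factor is $0$.
  have hκm : Measurable fun x => (1 + δ x univ)⁻¹ • δ x := by
    refine Measure.measurable_of_measurable_coe _ fun s hs => ?_
    have h1 : Measurable fun x => δ x s := (Measure.measurable_coe hs).comp hδ
    have h2 : Measurable fun x => (1 + δ x univ)⁻¹ * δ x s := by fun_prop
    exact h2
  let κ : Kernel X Y := ⟨fun x => (1 + δ x univ)⁻¹ • δ x, hκm⟩
  have hκ_apply : ∀ x, κ x = (1 + δ x univ)⁻¹ • δ x := fun _ => rfl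
  have hκ : IsFiniteKernel κ := by
    refine ⟨1, ENNReal.one_lt_top, fun x => ?_⟩
    rw [hκ_apply, Measure.smul_apply, smul_eq_mul, mul_comm, ← div_eq_mul_inv]
    exact ENNReal.div_le_of_le_mul (by rw [one_mul]; exact le_add_self)
  have hrn : Measurable fun z : X × Y => κ.rnDeriv η z.1 z.2 := Kernel.measurable_rnDeriv κ η
  refine ⟨fun z => (1 + δ z.1 univ) * (g z.2 * κ.rnDeriv η z.1 z.2), by fun_prop, fun x hx hac => ?_⟩
  -- As $g$ vanishes nowhere, the finite measure $g\rho$ dominates $\rho$ and can serve as reference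
  -- measure for the kernel derivative.
  have hρ : ρ ≪ ρ.withDensity g := by
    refine withDensity_absolutelyContinuous' hg.aemeasurable (ae_of_all _ hg0)
  have hac' : κ x ≪ η x := by
    rw [hκ_apply]
    exact (Measure.smul_absolutelyContinuous.trans hac).trans hρ
  have h1 := Kernel.withDensity_rnDeriv_eq hac'
  rw [Kernel.withDensity_apply _ (Kernel.measurable_rnDeriv κ η)] at h1
  have h2 : Measurable (κ.rnDeriv η x) := hrn.comp measurable_prodMk_left
  have h3 : η x = ρ.withDensity g := rfl
  rw [h3, ← withDensity_mul _ hg h2] at h1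
  have h4 : (1 + δ x univ) * (1 + δ x univ)⁻¹ = 1 :=
    ENNReal.mul_inv_cancel (by simp) (by finiteness)
  calc δ x = (1 + δ x univ) • κ x := by rw [hκ_apply, smul_smul, h4, one_smul]
    _ = (1 + δ x univ) • ρ.withDensity (g * κ.rnDeriv η x) := by rw [h1]
    _ = ρ.withDensity ((1 + δ x univ) • (g * κ.rnDeriv η x)) :=
      (withDensity_smul _ (hg.mul h2)).symm
    _ = _ := rfl

lemma exists_measurable_density_of_sigmaFinite [SigmaFinite ρ] {δ : X → Measure Y}
    (hδ : Measurable δ) : ∃ q : X × Y → ℝ≥0∞, Measurable q ∧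
      ∀ x, δ x univ ≠ ∞ → δ x ≪ ρ → δ x = ρ.withDensity fun y => q (x, y) := by
  obtain ⟨g, h1, h2, h3⟩ := exists_pos_lintegral_lt_of_sigmaFinite ρ one_ne_zero
  exact exists_measurable_density h2.coe_nnreal_ennreal
    (fun y => by simpa using (h1 y).ne')
    (h3.trans ENNReal.one_lt_top).ne hδ

/-- A nowhere vanishing integrable function on the configuration space is supplied by the Poisson
density of a nowhere vanishing integrable intensity. -/
lemma exists_measurable_density_configMeasure {X' V : Type*} [MeasurableSpace X']
    [MeasurableSpace V] [StandardBorelSpace V] {ν : Measure V} [SigmaFinite ν]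
    {δ : X' → Measure (Config V)} (hδ : Measurable δ) :
    ∃ q : X' × Config V → ℝ≥0∞, Measurable q ∧ ∀ x, δ x univ ≠ ∞ → δ x ≪ configMeasure ν →
      δ x = (configMeasure ν).withDensity fun y => q (x, y) := by
  obtain ⟨g, h1, h2, h3⟩ := exists_pos_lintegral_lt_of_sigmaFinite ν one_ne_zero
  have : MeasurableSpace.CountablyGenerated (Config V) := countablyGenerated_sigma
  have hg := h2.coe_nnreal_ennreal
  have hg1 : ∫⁻ x, (g x : ℝ≥0∞) ∂ν ≠ ∞ := (h3.trans ENNReal.one_lt_top).ne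
  refine exists_measurable_density (g := poissonPdf ν fun x => g x) (measurable_poissonPdf hg)
    (fun y => poissonPdf_ne_zero fun i => by simpa using (h1 _).ne') ?_ hδ
  rw [lintegral_poissonPdf hg hg1]
  exact ENNReal.one_ne_top

end KernelDensity

/-! ### Risks up to null sets, and Blyth weights for the prior. -/

section Prior

variable {X : Type*} [MeasurableSpace X] {ν : Measure X} [SigmaFinite ν]

lemma poissonProcess_absolutelyContinuous {κ : Measure X} [IsFiniteMeasure κ] (hκ : κ ≪ ν) :
    poissonProcess κ ≪ configMeasure ν := by
  have h1 := Measure.withDensity_rnDeriv_eq κ ν hκ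
  rw [← h1, poissonProcess_withDensity (Measure.measurable_rnDeriv _ _)]
  · exact withDensity_absolutelyContinuous _ _
  · rw [← setLIntegral_univ, ← withDensity_apply _ MeasurableSet.univ, h1]
    exact measure_ne_top _ _

lemma predictionRisk_congr_ae {s t : ℝ} {κ : Measure X} [IsFiniteMeasure κ] (hκ : κ ≪ ν)
    {δ δ' : Config X → Measure (Config X)} (h : ∀ᵐ x ∂(configMeasure ν), δ x = δ' x) :
    predictionRisk s t κ δ = predictionRisk s t κ δ' := by
  have : IsFiniteMeasure (ENNReal.ofReal s • κ) :=
    Measure.smul_finite κ ENNReal.ofReal_ne_top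
  refine lintegral_congr_ae ((poissonProcess_absolutelyContinuous
    (Measure.smul_absolutelyContinuous.trans hκ)).ae_le ?_)
  filter_upwards [h] with x hx
  rw [hx]

lemma estimationRisk_congr_ae {s t : ℝ} {κ : Measure X} [IsFiniteMeasure κ] (hκ : κ ≪ ν)
    {δ δ' : Config X → Measure X} (h : ∀ᵐ x ∂(configMeasure ν), δ x = δ' x) :
    estimationRisk s t κ δ = estimationRisk s t κ δ' := by
  have : IsFiniteMeasure (ENNReal.ofReal s • κ) :=
    Measure.smul_finite κ ENNReal.ofReal_ne_top
  refine lintegral_congr_ae ((poissonProcess_absolutelyContinuous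
    (Measure.smul_absolutelyContinuous.trans hκ)).ae_le ?_)
  filter_upwards [h] with x hx
  rw [hx]

variable {k : X → X → ℝ≥0} {D : Measure (ProbabilityMeasure X)} {a s t : ℝ}

lemma lintegral_poissonDensity_mul (hk : IsKernelFunction ν k) (hs : 0 < s)
    {θ : ℝ × ProbabilityMeasure X} (hθ : 0 < θ.1) (ψ : ℕ → ℝ≥0∞) :
    ∫⁻ x, poissonDensity s θ.1 (mixture k θ.2) x * ψ x.1 ∂(configMeasure ν) =
      ∑' n, ENNReal.ofReal (poissonWeight (s * θ.1) n) * ψ n := by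
  have hm := measurable_mixture_right hk θ.2
  have hsw := (mul_pos hs hθ).le
  have e : ∫⁻ y, ENNReal.ofReal (s * θ.1) * mixture k θ.2 y ∂ν = ENNReal.ofReal (s * θ.1) := by
    rw [lintegral_const_mul _ hm, lintegral_mixture hk, mul_one]
  simp_rw [poissonDensity_eq_poissonPdf (ν := ν) hsw hm (lintegral_mixture hk θ.2)]
  rw [lintegral_poissonPdf_mul (by fun_prop) (by simp [e]), e, ENNReal.toReal_ofReal hsw]

lemma lintegral_prior_eq [IsProbabilityMeasure D] {F : ℝ → ℝ≥0∞} (hF : Measurable F) :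
    ∫⁻ θ, F θ.1 ∂((massPrior a).prod D) =
      ∫⁻ w in Ioi (0 : ℝ), ENNReal.ofReal (w ^ (a - 1)) * F w := by
  have hF' : Measurable fun θ : ℝ × ProbabilityMeasure X => F θ.1 := hF.comp measurable_fst
  rw [lintegral_prod _ hF'.aemeasurable, ← lintegral_massPrior hF]
  simp

lemma prior_Ioc_ne_zero [IsProbabilityMeasure D] (a : ℝ) :
    ((massPrior a).prod D) {θ | θ.1 ∈ Ioc (0 : ℝ) 1} ≠ 0 := by
  have hm : MeasurableSet (Ioc (0 : ℝ) 1) := measurableSet_Ioc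
  have h : (massPrior a).prod D {θ | θ.1 ∈ Ioc (0 : ℝ) 1} = massPrior a (Ioc 0 1) := by
    rw [show {θ : ℝ × ProbabilityMeasure X | θ.1 ∈ Ioc (0 : ℝ) 1} = Ioc (0 : ℝ) 1 ×ˢ univ by
      ext; simp, Measure.prod_prod, measure_univ, mul_one]
  rw [h, massPrior, Ne, withDensity_apply_eq_zero (by fun_prop)]
  intro h0
  rw [Measure.restrict_apply' measurableSet_Ioi] at h0
  have : Ioc (0 : ℝ) 1 ⊆ {w | ENNReal.ofReal (w ^ (a - 1)) ≠ 0} ∩ Ioc 0 1 ∩ Ioi 0 := fun w hw =>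
    ⟨⟨by simpa using Real.rpow_pos_of_pos hw.1 _, hw⟩, hw.1⟩
  simpa using measure_mono_null this h0

/-- The comparison function is $c(x)=h((n+1)/s)$. Everything depends on $x$ only through the count,
so the cost in the model is `weightCost`. -/
lemma exists_blyth_weights [IsProbabilityMeasure D] (hk : IsKernelFunction ν k) (ha : 0 < a)
    (ha1 : a ≤ 1) (hs : 0 < s) {ε : ℝ} (hε : 0 < ε) :
    ∃ (h : ℝ × ProbabilityMeasure X → ℝ) (c : Config X → ℝ), Measurable h ∧ Measurable c ∧
      (∀ θ, 0 ≤ h θ) ∧ (∀ x, 0 < c x) ∧ (∀ θ ∈ {θ | θ.1 ∈ Ioc (0 : ℝ) 1}, 1 / 3 ≤ h θ) ∧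
      ∫⁻ θ, ENNReal.ofReal (h θ) ∂((massPrior a).prod D) ≠ ∞ ∧
      ∫⁻ θ, ∫⁻ x, poissonDensity s θ.1 (mixture k θ.2) x *
        ENNReal.ofReal ((h θ - c x) ^ 2 / c x) ∂(configMeasure ν) ∂((massPrior a).prod D) ≤
          ENNReal.ofReal ε := by
  obtain ⟨h, hh, hV⟩ := exists_isBlythWeight_weightCost_lt ha ha1 hs hε
  have hm := hh.measurable
  refine ⟨fun θ => h θ.1, fun x => h ((x.1 + 1) / s), by fun_prop,
    measurable_comp_fst fun n : ℕ => h ((n + 1) / s),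
    fun θ => (hh.pos _).le, fun x => hh.pos _, fun θ hθ => hh.lower _ hθ, ?_, ?_⟩
  · rw [lintegral_prior_eq (F := fun w => ENNReal.ofReal (h w)) (by fun_prop)]
    refine (lt_of_le_of_lt (setLIntegral_mono' measurableSet_Ioi fun w hw => ?_)
      hh.integrable).ne
    have hw0 : (0 : ℝ) < w := hw
    gcongr
    nlinarith [hh.pos w]
  · refine le_trans (le_of_eq ?_) hV.le
    rw [weightCost, ← lintegral_prior_eq (D := D) (F := fun w =>
      ∑' n : ℕ, ENNReal.ofReal (poissonWeight (s * w) n) *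
        ENNReal.ofReal ((h w - h ((n + 1) / s)) ^ 2 / h ((n + 1) / s)))]
    · refine lintegral_congr_ae ?_
      filter_upwards [Measure.quasiMeasurePreserving_fst.ae (ae_massPrior_pos a)] with θ hθ
      exact lintegral_poissonDensity_mul hk hs hθ fun n =>
        ENNReal.ofReal ((h θ.1 - h ((n + 1) / s)) ^ 2 / h ((n + 1) / s))
    · refine Measurable.tsum fun n => ?_
      have := measurable_poissonWeight n
      fun_prop

end Prior

/-! ### Admissibility in prediction. -/

section Prediction

variable {X : Type*} [MeasurableSpace X] {ν : Measure X}
  {k : X → X → ℝ≥0} {D : Measure (ProbabilityMeasure X)} {a s t : ℝ}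

lemma ae_mixture_ne_zero {Λ : Set (Measure X)} (hΛ : IsParameterSpace ν Λ)
    (hk : IsKernelFunction ν k) {m : ProbabilityMeasure X}
    (hm : ν.withDensity (mixture k m) ∈ Λ) : ∀ᵐ y ∂ν, mixture k m y ≠ 0 := by
  have h := (hΛ.subset hm).2.2
  have h2 : ν.withDensity (fun _ => 1) ≪ ν.withDensity (mixture k m) := by
    rw [withDensity_const, one_smul]; exact h
  exact ae_ne_zero_of_withDensity_absolutelyContinuous measurable_const
    (measurable_mixture_right hk m) (by simp) h2

lemma withDensity_intensity_mem {Λ : Set (Measure X)} (hΛ : IsParameterSpace ν Λ)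
    (hk : IsKernelFunction ν k) {θ : ℝ × ProbabilityMeasure X} (hθ : 0 < θ.1)
    (hm : ν.withDensity (mixture k θ.2) ∈ Λ) : ν.withDensity (intensity k θ) ∈ Λ := by
  have := hΛ.smul_mem _ hm θ.1.toNNReal (by simpa using hθ)
  have e : ν.withDensity (intensity k θ) = θ.1.toNNReal • ν.withDensity (mixture k θ.2) := by
    change ν.withDensity (ENNReal.ofReal θ.1 • mixture k θ.2) = _
    rw [withDensity_smul _ (measurable_mixture_right hk _)]
    rfl
  rwa [e]

variable [SigmaFinite ν]

lemma isFiniteMeasure_withDensity_poissonDensity (hk : IsKernelFunction ν k) (ht : 0 < t)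
    {θ : ℝ × ProbabilityMeasure X} (hθ : 0 < θ.1) : IsFiniteMeasure
      ((configMeasure ν).withDensity (poissonDensity t θ.1 (mixture k θ.2))) :=
  isFiniteMeasure_withDensity (by simp [lintegral_poissonDensity hk ht hθ])

/-- The expectation over the observations with parameter `θ`, written with densities. -/
lemma lintegral_poissonProcess_eq (hk : IsKernelFunction ν k) (hs : 0 < s)
    {θ : ℝ × ProbabilityMeasure X} (hθ : 0 < θ.1) {F G : Config X → ℝ≥0∞} (hG : Measurable G)
    (h : ∀ᵐ x ∂(configMeasure ν), F x = G x) :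
    ∫⁻ x, F x ∂(poissonProcess (ENNReal.ofReal s • ν.withDensity (intensity k θ))) =
      ∫⁻ x, poissonDensity s θ.1 (mixture k θ.2) x * G x ∂(configMeasure ν) := by
  have hm : Measurable (poissonDensity s θ.1 (mixture k θ.2)) :=
    (measurable_poissonDensity_mixture hk s).comp measurable_prodMk_left
  rw [poissonProcess_smul_intensity hk hs hθ,
    lintegral_congr_ae ((withDensity_absolutelyContinuous _ _).ae_le h),
    lintegral_withDensity_eq_lintegral_mul _ hm hG]
  rfl

lemma predictionRisk_eq_klRisk (hk : IsKernelFunction ν k) (hs : 0 < s) (ht : 0 < t)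
    {θ : ℝ × ProbabilityMeasure X} (hθ : 0 < θ.1) (h0 : ∀ᵐ y ∂ν, mixture k θ.2 y ≠ 0)
    {q : Config X × Config X → ℝ≥0∞} (hq : Measurable q)
    (hq0 : ∀ᵐ x ∂(configMeasure ν), ∀ᵐ y ∂(configMeasure ν), q (x, y) ≠ 0 ∧ q (x, y) ≠ ∞)
    (hq1 : ∀ᵐ x ∂(configMeasure ν), ∫⁻ y, q (x, y) ∂(configMeasure ν) = 1)
    {δ : Config X → Measure (Config X)}
    (hδ : ∀ᵐ x ∂(configMeasure ν), δ x = (configMeasure ν).withDensity fun y => q (x, y)) :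
    predictionRisk s t (ν.withDensity (intensity k θ)) δ =
      klRisk (configMeasure ν) (configMeasure ν)
        (fun z : (ℝ × ProbabilityMeasure X) × Config X =>
          poissonDensity s z.1.1 (mixture k z.1.2) z.2)
        (fun z : (ℝ × ProbabilityMeasure X) × Config X =>
          poissonDensity t z.1.1 (mixture k z.1.2) z.2) q θ := by
  have hr : Measurable (poissonDensity t θ.1 (mixture k θ.2)) :=
    (measurable_poissonDensity_mixture hk t).comp measurable_prodMk_left
  have mG : Measurable fun z : Config X × Config X =>
      klTerm (poissonDensity t θ.1 (mixture k θ.2) z.2) (q z) := by fun_prop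
  have := isFiniteMeasure_withDensity_poissonDensity hk ht hθ
  have hr0 := ae_poissonDensity_ne hk ht hθ h0
  have h : ∀ᵐ x ∂(configMeasure ν),
      klDiv (poissonProcess (ENNReal.ofReal t • ν.withDensity (intensity k θ))) (δ x) =
        ∫⁻ y, klTerm (poissonDensity t θ.1 (mixture k θ.2) y) (q (x, y)) ∂(configMeasure ν) := by
    filter_upwards [hδ, hq0, hq1] with x h1 h2 h3
    have hqx : Measurable fun y => q (x, y) := hq.comp measurable_prodMk_left
    have : IsFiniteMeasure ((configMeasure ν).withDensity fun y => q (x, y)) :=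
      isFiniteMeasure_withDensity (by simp [h3])
    rw [h1, poissonProcess_smul_intensity hk ht hθ]
    exact klDiv_withDensity_withDensity hr hqx (hr0.mono fun _ h => h.1)
      (hr0.mono fun _ h => h.2) (h2.mono fun _ h => h.1) (h2.mono fun _ h => h.2)
  rw [klRisk_eq (measurable_poissonDensity_mixture hk t) hq]
  exact lintegral_poissonProcess_eq hk hs hθ mG.lintegral_prod_right' h

/-- A predictive density may vanish on part of some $U^m$. Where it does so on a set of positive
measure the divergence is infinite, and a finite risk at a single parameter with nonvanishing
likelihood confines such $x$ to a null set. -/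
lemma ae_density_ne_zero_of_predictionRisk (hk : IsKernelFunction ν k) (hs : 0 < s) (ht : 0 < t)
    {θ : ℝ × ProbabilityMeasure X} (hθ : 0 < θ.1) (h0 : ∀ᵐ y ∂ν, mixture k θ.2 y ≠ 0)
    {q : Config X × Config X → ℝ≥0∞} (hq : Measurable q) {δ : Config X → Measure (Config X)}
    (hδ : ∀ᵐ x ∂(configMeasure ν), δ x = (configMeasure ν).withDensity fun y => q (x, y))
    (hR : predictionRisk s t (ν.withDensity (intensity k θ)) δ ≠ ∞) :
    ∀ᵐ x ∂(configMeasure ν), ∀ᵐ y ∂(configMeasure ν), q (x, y) ≠ 0 := by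
  have hp : Measurable (poissonDensity s θ.1 (mixture k θ.2)) :=
    (measurable_poissonDensity_mixture hk s).comp measurable_prodMk_left
  have hr : Measurable (poissonDensity t θ.1 (mixture k θ.2)) :=
    (measurable_poissonDensity_mixture hk t).comp measurable_prodMk_left
  have hz : MeasurableSet {z : Config X × Config X | q z = 0} := hq (measurableSet_singleton 0)
  have hN : Measurable fun x => configMeasure ν {y | q (x, y) = 0} := measurable_measure_prodMk_left hz
  have hB : MeasurableSet {x | configMeasure ν {y | q (x, y) = 0} ≠ 0} :=
    hN (measurableSet_singleton 0).compl
  have hinf : ∀ᵐ x ∂(configMeasure ν), {x | configMeasure ν {y | q (x, y) = 0} ≠ 0}.indicator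
      (fun _ => ∞) x ≤ klDiv (poissonProcess (ENNReal.ofReal t • ν.withDensity (intensity k θ)))
        (δ x) := by
    filter_upwards [hδ] with x h1
    refine indicator_apply_le' (fun hx => ?_) fun _ => zero_le
    rw [top_le_iff]
    refine klDiv_of_not_ac fun h2 => hx ?_
    rw [h1, poissonProcess_smul_intensity hk ht hθ] at h2
    have hqx : Measurable fun y => q (x, y) := hq.comp measurable_prodMk_left
    have h3 := ae_ne_zero_of_withDensity_absolutelyContinuous hr hqx
      ((ae_poissonDensity_ne hk ht hθ h0).mono fun _ h => h.1) h2
    simpa [ae_iff] using h3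
  have hle : ∫⁻ x, poissonDensity s θ.1 (mixture k θ.2) x *
      {x | configMeasure ν {y | q (x, y) = 0} ≠ 0}.indicator (fun _ => ∞) x
        ∂(configMeasure ν) ≤ predictionRisk s t (ν.withDensity (intensity k θ)) δ := by
    rw [← lintegral_poissonProcess_eq hk hs hθ (measurable_const.indicator hB) (ae_of_all _ fun _ => rfl)]
    unfold predictionRisk
    refine lintegral_mono_ae ?_
    rw [poissonProcess_smul_intensity hk hs hθ]
    exact (withDensity_absolutelyContinuous _ _).ae_le hinf
  have hmeas : Measurable fun x => poissonDensity s θ.1 (mixture k θ.2) x *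
      {x | configMeasure ν {y | q (x, y) = 0} ≠ 0}.indicator (fun _ => ∞) x :=
    hp.mul (measurable_const.indicator hB)
  filter_upwards [ae_lt_top hmeas (ne_top_of_le_ne_top hR hle), ae_poissonDensity_ne hk hs hθ h0]
    with x h1 h2
  rw [ae_iff]
  by_contra h3
  rw [indicator_of_mem (by simpa using h3), ENNReal.mul_top h2.1] at h1
  exact lt_irrefl _ h1

/-- Admissibility of the Bayesian predictive density, for a general dominating measure. -/
theorem isAdmissible_bayesPredictive [StandardBorelSpace X] [IsProbabilityMeasure D] (hν : ν ≠ 0)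
    (hk : IsKernelFunction ν k) {Λ : Set (Measure X)} (hΛ : IsParameterSpace ν Λ)
    (hDΛ : ∀ᵐ m ∂D, ν.withDensity (mixture k m) ∈ Λ) (hs : 0 < s) (ht : 0 < t) (ha : 0 < a)
    (ha1 : a ≤ 1)
    (hR : ∀ᵐ θ ∂((massPrior a).prod D), predictionRisk s t (ν.withDensity (intensity k θ))
      (bayesPredictive ν k s t ((massPrior a).prod D)) < ∞) :
    IsAdmissible Λ (decisionRules ν (predictiveMeasures ν)) (predictionRisk s t)
      (bayesPredictive ν k s t ((massPrior a).prod D)) := by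
  obtain ⟨π, hπ⟩ : ∃ π, π = (massPrior a).prod D := ⟨_, rfl⟩
  have hsf : SFinite π := by rw [hπ]; infer_instance
  obtain ⟨p, hp_def⟩ : ∃ p : (ℝ × ProbabilityMeasure X) × Config X → ℝ≥0∞, p = fun z =>
    poissonDensity s z.1.1 (mixture k z.1.2) z.2 := ⟨_, rfl⟩
  obtain ⟨r, hr_def⟩ : ∃ r : (ℝ × ProbabilityMeasure X) × Config X → ℝ≥0∞, r = fun z =>
    poissonDensity t z.1.1 (mixture k z.1.2) z.2 := ⟨_, rfl⟩
  have hp : Measurable p := hp_def ▸ measurable_poissonDensity_mixture hk s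
  have hr : Measurable r := hr_def ▸ measurable_poissonDensity_mixture hk t
  have hgood : ∀ᵐ θ ∂π, 0 < θ.1 ∧ ν.withDensity (mixture k θ.2) ∈ Λ := by
    rw [hπ]; exact ae_prior_iff_imp hDΛ
  have hp1 : ∀ᵐ θ ∂π, ∫⁻ x, p (θ, x) ∂(configMeasure ν) = 1 := hgood.mono fun θ h => by
    rw [hp_def]; exact lintegral_poissonDensity hk hs h.1
  have hr1 : ∀ᵐ θ ∂π, ∫⁻ x, r (θ, x) ∂(configMeasure ν) = 1 := hgood.mono fun θ h => by
    rw [hr_def]; exact lintegral_poissonDensity hk ht h.1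
  have hp0 : ∀ᵐ θ ∂π, ∀ᵐ x ∂(configMeasure ν), p (θ, x) ≠ 0 := hgood.mono fun θ h => by
    rw [hp_def]
    exact (ae_poissonDensity_ne hk hs h.1 (ae_mixture_ne_zero hΛ hk h.2)).mono fun _ h => h.1
  have hr0 : ∀ᵐ θ ∂π, ∀ᵐ x ∂(configMeasure ν), r (θ, x) ≠ 0 ∧ r (θ, x) ≠ ∞ :=
    hgood.mono fun θ h => by
      rw [hr_def]
      exact ae_poissonDensity_ne hk ht h.1 (ae_mixture_ne_zero hΛ hk h.2)
  have hZ : ∀ᵐ x ∂(configMeasure ν), ∫⁻ θ, p (θ, x) ∂π ≠ 0 ∧ ∫⁻ θ, p (θ, x) ∂π ≠ ∞ := by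
    rw [hp_def, hπ]
    exact ae_lintegral_prior_poissonDensity hk
      (hDΛ.mono fun m hm => ae_mixture_ne_zero hΛ hk hm) ha hs
  obtain ⟨q, hq_def⟩ : ∃ q, q = posteriorMean π p r := ⟨_, rfl⟩
  have hq : Measurable q := hq_def ▸ measurable_posteriorMean hp hr
  have hδ : bayesPredictive ν k s t π =
      fun x => (configMeasure ν).withDensity fun y => q (x, y) := by
    ext1 x
    rw [hq_def, hp_def, hr_def]
    exact bayesPredictive_eq hk x
  have hq1 : ∀ᵐ x ∂(configMeasure ν), ∫⁻ y, q (x, y) ∂(configMeasure ν) = 1 := by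
    filter_upwards [hZ] with x hx
    rw [hq_def, lintegral_posteriorMean hp hr, lintegral_congr_ae
      (f := fun θ => p (θ, x) * ∫⁻ y, r (θ, y) ∂(configMeasure ν)) (g := fun θ => p (θ, x))
      (hr1.mono fun θ h => by change p (θ, x) * _ = _; rw [h, mul_one]), ENNReal.inv_mul_cancel hx.1 hx.2]
  have hq0 : ∀ᵐ x ∂(configMeasure ν), ∀ᵐ y ∂(configMeasure ν), q (x, y) ≠ 0 ∧ q (x, y) ≠ ∞ := by
    filter_upwards [hZ, hq1] with x hx h1
    have hqx : Measurable fun y => q (x, y) := hq.comp measurable_prodMk_left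
    have h2 := ae_posteriorMean_ne_zero hp hr (hr0.mono fun θ h => h.mono fun _ h => h.1) hx.1 hx.2
    rw [← hq_def] at h2
    filter_upwards [h2, ae_lt_top hqx (by simp [h1])] with y h3 h4 using ⟨h3, h4.ne⟩
  rw [← hπ] at hR ⊢
  refine ⟨⟨?_, ?_⟩, ?_⟩
  · rw [hδ]
    exact measurable_withDensity_prodMk hq
  · filter_upwards [hq0, hq1] with x h0 h1
    have hqx : Measurable fun y => q (x, y) := hq.comp measurable_prodMk_left
    rw [hδ]
    refine ⟨⟨?_⟩, withDensity_absolutelyContinuous _ _, fun m => ?_⟩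
    · rw [withDensity_apply _ MeasurableSet.univ, Measure.restrict_univ, h1]
    · intro hm
      rw [withDensity_apply_eq_zero hqx] at hm
      -- The density is nonzero almost everywhere, so giving no probability to $U^m$ would make
      -- $U^m$ null; but its reference measure is $\nu(U)^m\ne0$.
      have h2 : configMeasure ν {y | y.1 = m} = 0 := by
        refine measure_mono_null (t := ({y | q (x, y) ≠ 0} ∩ {y | y.1 = m}) ∪ {y | ¬ q (x, y) ≠ 0})
          (fun y hy => ?_) (measure_union_null hm (ae_iff.1 (h0.mono fun _ h => h.1)))
        by_cases h : q (x, y) = 0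
        · exact Or.inr (by simpa using h)
        · exact Or.inl ⟨h, hy⟩
      rw [configMeasure_fst_eq] at h2
      exact hν (Measure.measure_univ_eq_zero.1 (eq_zero_of_pow_eq_zero h2))
  · rintro ⟨δ', ⟨hδ'm, hδ'a⟩, hle, κ, hκ, hlt⟩
    obtain ⟨q', hq', hq'δ⟩ := exists_measurable_density_configMeasure (ν := ν) hδ'm
    have hδ' : ∀ᵐ x ∂(configMeasure ν),
        δ' x = (configMeasure ν).withDensity fun y => q' (x, y) :=
      hδ'a.mono fun x h => have := h.1; hq'δ x (measure_ne_top _ _) h.2.1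
    have hq'1 : ∀ᵐ x ∂(configMeasure ν), ∫⁻ y, q' (x, y) ∂(configMeasure ν) = 1 := by
      filter_upwards [hδ', hδ'a] with x h1 h2
      have := h2.1.measure_univ
      rwa [h1, withDensity_apply _ MeasurableSet.univ, Measure.restrict_univ] at this
    have hle' : ∀ᵐ θ ∂π, predictionRisk s t (ν.withDensity (intensity k θ)) δ' ≤
        predictionRisk s t (ν.withDensity (intensity k θ)) (bayesPredictive ν k s t π) :=
      hgood.mono fun θ h => hle _ (withDensity_intensity_mem hΛ hk h.1 h.2)
    have hne : NeZero π := ⟨fun h => prior_Ioc_ne_zero (D := D) a (by rw [← hπ, h]; simp)⟩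
    -- One parameter at which the Bayes risk, hence the competitor's risk, is finite; it rules out
    -- zeros of the competitor's density.
    obtain ⟨θ₀, hθ₀, hRθ₀, hleθ₀⟩ := (hgood.and (hR.and hle')).exists
    have hq'0 : ∀ᵐ x ∂(configMeasure ν), ∀ᵐ y ∂(configMeasure ν),
        q' (x, y) ≠ 0 ∧ q' (x, y) ≠ ∞ := by
      filter_upwards [ae_density_ne_zero_of_predictionRisk hk hs ht hθ₀.1
        (ae_mixture_ne_zero hΛ hk hθ₀.2) hq' hδ' (hleθ₀.trans_lt hRθ₀).ne, hq'1] with x h1 h2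
      have hqx : Measurable fun y => q' (x, y) := hq'.comp measurable_prodMk_left
      filter_upwards [h1, ae_lt_top hqx (by simp [h2])] with y h3 h4 using ⟨h3, h4.ne⟩
    have e1 : ∀ᵐ θ ∂π, predictionRisk s t (ν.withDensity (intensity k θ))
        (bayesPredictive ν k s t π) = klRisk (configMeasure ν) (configMeasure ν) p r q θ :=
      hgood.mono fun θ h => by
        rw [hp_def, hr_def]
        exact predictionRisk_eq_klRisk hk hs ht h.1 (ae_mixture_ne_zero hΛ hk h.2) hq hq0 hq1
          (ae_of_all _ fun x => by rw [hδ])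
    have e2 : ∀ᵐ θ ∂π, predictionRisk s t (ν.withDensity (intensity k θ)) δ' =
        klRisk (configMeasure ν) (configMeasure ν) p r q' θ :=
      hgood.mono fun θ h => by
        rw [hp_def, hr_def]
        exact predictionRisk_eq_klRisk hk hs ht h.1 (ae_mixture_ne_zero hΛ hk h.2) hq' hq'0 hq'1 hδ'
    have heq : ∀ᵐ x ∂(configMeasure ν), ∀ᵐ y ∂(configMeasure ν), q' (x, y) = q (x, y) := by
      have hA : MeasurableSet {θ : ℝ × ProbabilityMeasure X | θ.1 ∈ Ioc (0 : ℝ) 1} :=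
        measurable_fst measurableSet_Ioc
      refine eq_of_klRisk_le hp hr hq hq' hp1 hr1 hp0 hr0 hq0 hq'0 hq1 hq'1 ?_ ?_ ?_ hA
        (hπ ▸ prior_Ioc_ne_zero a) fun ε hε => ?_
      · filter_upwards [hZ] with x hx
        exact ae_of_all _ fun y => by
          rw [hq_def, lintegral_mul_eq_mul_posteriorMean hx.1 hx.2]
      · filter_upwards [hR, e1] with θ h1 h2
        rwa [← h2]
      · filter_upwards [hle', e1, e2] with θ h1 h2 h3
        rwa [← h2, ← h3]
      · rw [hπ, hp_def]
        exact exists_blyth_weights hk ha ha1 hs hε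
    -- Every intensity in $\Lambda$ is dominated by $\nu$, so almost everywhere equal rules have
    -- equal risk also at parameters that are not kernel mixtures. This contradicts the strict
    -- inequality.
    have hκf := (hΛ.subset hκ).1
    refine hlt.ne (predictionRisk_congr_ae (hΛ.subset hκ).2.1 ?_)
    filter_upwards [hδ', heq] with x h1 h2
    rw [h1, hδ]
    exact withDensity_congr_ae h2

end Prediction

/-! ### The effect of capping the total mass of an estimate. -/

section Cap

lemma klTerm_mul_left {c p q : ℝ≥0∞} (hc : c ≠ 0) (hc_top : c ≠ ∞) :
    klTerm (c * p) (c * q) = c * klTerm p q := by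
  have h := ENNReal.toReal_pos hc hc_top
  unfold klTerm
  rw [ENNReal.toReal_mul, ENNReal.toReal_mul, mul_div_mul_left _ _ h.ne',
    ← ENNReal.ofReal_toReal hc_top, ← ENNReal.ofReal_mul h.le, ENNReal.ofReal_toReal hc_top]
  congr 1
  ring

lemma klTerm_mul_right_add {p q c : ℝ≥0∞} (hp : p ≠ 0) (hp_top : p ≠ ∞) (hq : q ≠ 0) (hq_top : q ≠ ∞)
    (hc : c ≠ 0) (hc1 : c ≤ 1) :
    klTerm p (q * c) + q = klTerm p q + p * ENNReal.ofReal (-Real.log c.toReal) + q * c := by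
  have hc_top : c ≠ ∞ := ne_top_of_le_ne_top ENNReal.one_ne_top hc1
  obtain ⟨P, hP⟩ : ∃ P, P = p.toReal := ⟨_, rfl⟩
  obtain ⟨Q, hQ⟩ : ∃ Q, Q = q.toReal := ⟨_, rfl⟩
  obtain ⟨C, hC⟩ : ∃ C, C = c.toReal := ⟨_, rfl⟩
  have hP0 : 0 < P := hP ▸ ENNReal.toReal_pos hp hp_top
  have hQ0 : 0 < Q := hQ ▸ ENNReal.toReal_pos hq hq_top
  have hC0 : 0 < C := hC ▸ ENNReal.toReal_pos hc hc_top
  have hC1 : C ≤ 1 := hC ▸ ENNReal.toReal_le_of_le_ofReal zero_le_one (by simpa using hc1)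
  have n1 := mul_log_div_sub_add_nonneg hP0 hQ0
  have n2 := mul_log_div_sub_add_nonneg hP0 (mul_pos hQ0 hC0)
  have n3 : 0 ≤ -Real.log C := by have := Real.log_nonpos hC0.le hC1; linarith
  unfold klTerm
  rw [ENNReal.toReal_mul, ← hP, ← hQ, ← hC, ← ENNReal.ofReal_toReal hp_top,
    ← ENNReal.ofReal_toReal hq_top, ← ENNReal.ofReal_toReal hc_top, ← hP, ← hQ, ← hC,
    ← ENNReal.ofReal_mul hP0.le, ← ENNReal.ofReal_mul hQ0.le, ← ENNReal.ofReal_add n2 hQ0.le,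
    ← ENNReal.ofReal_add n1 (by positivity), ← ENNReal.ofReal_add (by positivity) (by positivity)]
  congr 1
  rw [Real.log_div hP0.ne' hQ0.ne', Real.log_div hP0.ne' (by positivity),
    Real.log_mul hQ0.ne' hC0.ne']
  ring

/-- With $u=m/b$ this bounds the change $w\log(m/b)+b-m$ of the loss when a mass $m\ge b$ is reduced
to $b$. If $b\le2w$, it is the argument of `young_real`; if $b\ge2w$, the bound $\log u\le u-1$ is
enough. -/
lemma mul_log_add_le {w b u : ℝ} (hw : 0 < w) (hb : 0 < b) (hu : 1 ≤ u) :
    w * Real.log u + b ≤ w ^ 2 / b + u * b := by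
  have hu0 : 0 < u := by linarith
  have hsq : 0 ≤ w ^ 2 / b := by positivity
  rcases le_total b (2 * w) with h | h
  · have h1 := Real.log_le_sub_one_of_pos (show 0 < u * b / w by positivity)
    have h2 := Real.log_le_sub_one_of_pos (show 0 < w / b by positivity)
    have h3 : Real.log u = Real.log (u * b / w) + Real.log (w / b) := by
      rw [← Real.log_mul (by positivity) (by positivity)]
      congr 1
      field_simp
    have h4 : w * Real.log u ≤ w * (u * b / w - 1 + (w / b - 1)) := by
      rw [h3]; gcongr
    have h5 : w * (u * b / w - 1 + (w / b - 1)) = u * b - 2 * w + w ^ 2 / b := by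
      field_simp; ring
    linarith
  · have h1 := Real.log_le_sub_one_of_pos hu0
    nlinarith

variable {X : Type*} [MeasurableSpace X] {ν : Measure X} {f e : X → ℝ≥0∞}

/-- Capping the total mass of an estimate at `b` increases the loss by at most `w ^ 2 / b`, where `w`
is the total mass of the true intensity. -/
lemma lintegral_klTerm_cap_le (hf : Measurable f) (he : Measurable e)
    (hf0 : ∀ᵐ y ∂ν, f y ≠ 0 ∧ f y ≠ ∞) (he0 : ∀ᵐ y ∂ν, e y ≠ 0 ∧ e y ≠ ∞) {w b : ℝ} (hw : 0 < w)
    (hb : 0 < b) (hF : ∫⁻ y, f y ∂ν = ENNReal.ofReal w) (hE : ∫⁻ y, e y ∂ν ≠ ∞)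
    (hE0 : ∫⁻ y, e y ∂ν ≠ 0) :
    ∫⁻ y, klTerm (f y) (e y * min 1 (ENNReal.ofReal b / ∫⁻ y, e y ∂ν)) ∂ν ≤
      ∫⁻ y, klTerm (f y) (e y) ∂ν + ENNReal.ofReal (w ^ 2 / b) := by
  obtain ⟨M, hM⟩ : ∃ M, M = ∫⁻ y, e y ∂ν := ⟨_, rfl⟩
  rw [← hM] at hE hE0 ⊢
  rcases le_total 1 (ENNReal.ofReal b / M) with h | h
  · rw [min_eq_left h]
    simp only [mul_one]
    exact le_self_add
  · rw [min_eq_right h]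
    obtain ⟨c, hc⟩ : ∃ c, c = ENNReal.ofReal b / M := ⟨_, rfl⟩
    rw [← hc] at h ⊢
    have hc0 : c ≠ 0 := by
      rw [hc]; exact (ENNReal.div_pos (by simpa using hb) hE).ne'
    have key : ∀ᵐ y ∂ν, klTerm (f y) (e y * c) + e y =
        klTerm (f y) (e y) + f y * ENNReal.ofReal (-Real.log c.toReal) + e y * c := by
      filter_upwards [hf0, he0] with y h1 h2
      exact klTerm_mul_right_add h1.1 h1.2 h2.1 h2.2 hc0 h
    have key2 := lintegral_congr_ae key
    rw [lintegral_add_right _ he, lintegral_add_right _ (he.mul_const c),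
      lintegral_add_right _ (hf.mul_const _), lintegral_mul_const _ hf, lintegral_mul_const _ he,
      hF, ← hM] at key2
    have hMc : M * c = ENNReal.ofReal b := by rw [hc, ENNReal.mul_div_cancel hE0 hE]
    obtain ⟨m, hm⟩ : ∃ m, m = M.toReal := ⟨_, rfl⟩
    have hm0 : 0 < m := hm ▸ ENNReal.toReal_pos hE0 hE
    have hMm : M = ENNReal.ofReal m := by rw [hm, ENNReal.ofReal_toReal hE]
    have hcr : c.toReal = b / m := by
      rw [hc, hMm, ← ENNReal.ofReal_div_of_pos hm0, ENNReal.toReal_ofReal (by positivity)]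
    have hbm : b ≤ m := by
      have : c.toReal ≤ 1 := ENNReal.toReal_le_of_le_ofReal zero_le_one (by simpa using h)
      rwa [hcr, div_le_one hm0] at this
    have hlog : 0 ≤ Real.log (m / b) := Real.log_nonneg ((one_le_div hb).2 hbm)
    have hneg : -Real.log c.toReal = Real.log (m / b) := by
      rw [hcr, Real.log_div hb.ne' hm0.ne', Real.log_div hm0.ne' hb.ne']; ring
    rw [hMc, hneg] at key2
    refine (ENNReal.add_le_add_iff_right hE).1 (key2.trans_le ?_)
    rw [add_assoc, add_assoc]
    refine add_le_add le_rfl ?_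
    rw [hMm, ← ENNReal.ofReal_mul hw.le, ← ENNReal.ofReal_add (by positivity) hb.le,
      ← ENNReal.ofReal_add (by positivity) hm0.le]
    refine ENNReal.ofReal_le_ofReal ?_
    have := mul_log_add_le hw hb ((one_le_div hb).2 hbm)
    rwa [div_mul_cancel₀ _ hb.ne'] at this

/-- Since $p_n/(n+1)=p_{n+1}/\mu$, the sum is $\mu^{-1}P(N\ge1)$. -/
lemma tsum_poissonWeight_div_succ_le {μ : ℝ} (hμ : 0 < μ) :
    ∑' n : ℕ, ENNReal.ofReal (poissonWeight μ n) * ENNReal.ofReal (1 / (n + 1)) ≤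
      ENNReal.ofReal (1 / μ) := by
  have e : ∀ n : ℕ, ENNReal.ofReal (poissonWeight μ n) * ENNReal.ofReal (1 / (n + 1)) =
      ENNReal.ofReal (1 / μ) * ENNReal.ofReal (poissonWeight μ (n + 1)) := fun n => by
    rw [← ENNReal.ofReal_mul (poissonWeight_nonneg hμ.le n), ← ENNReal.ofReal_mul (by positivity)]
    congr 1
    unfold poissonWeight
    rw [Nat.factorial_succ]
    push_cast
    field_simp
    ring
  simp_rw [e]
  rw [ENNReal.tsum_mul_left]
  calc _ ≤ ENNReal.ofReal (1 / μ) * ∑' n, ENNReal.ofReal (poissonWeight μ n) := by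
        refine mul_le_mul_right ?_ _
        exact ENNReal.tsum_comp_le_tsum_of_injective (add_left_injective 1)
          (fun n => ENNReal.ofReal (poissonWeight μ n))
    _ = _ := by rw [tsum_ofReal_poissonWeight hμ.le, mul_one]

end Cap

/-! ### Admissibility in estimation. -/

section Estimation

variable {X : Type*} [MeasurableSpace X] {ν : Measure X}
  {k : X → X → ℝ≥0} {D : Measure (ProbabilityMeasure X)} {a s t : ℝ} {h : ℝ → ℝ}

lemma lintegral_ofReal_gammaWeight {F : ℝ → ℝ} (hs : 0 < s) (hF : ∀ w, 0 < w → 0 ≤ F w) (n : ℕ)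
    (hi : IntegrableOn (fun w => F w * gammaWeight a s n w) (Ioi 0)) :
    ∫⁻ w in Ioi (0 : ℝ), ENNReal.ofReal (F w) * ENNReal.ofReal (gammaWeight a s n w) =
      ENNReal.ofReal (∫ w in Ioi (0 : ℝ), F w * gammaWeight a s n w) := by
  rw [ofReal_integral_eq_lintegral_ofReal hi]
  · refine setLIntegral_congr_fun measurableSet_Ioi fun w hw => ?_
    exact (ENNReal.ofReal_mul (hF w hw)).symm
  · exact (ae_restrict_mem measurableSet_Ioi).mono fun w hw =>
      mul_nonneg (hF w hw) (gammaWeight_nonneg hs _ hw)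

lemma lintegral_prior_weight [IsProbabilityMeasure D] (hk : IsKernelFunction ν k) (ha : 0 < a)
    (hs : 0 < s) (hh : IsBlythWeight a h) {G : ProbabilityMeasure X → ℝ≥0∞} (hG : Measurable G)
    (x : Config X) :
    ∫⁻ θ, ENNReal.ofReal (h θ.1) * (poissonDensity s θ.1 (mixture k θ.2) x * G θ.2)
        ∂((massPrior a).prod D) =
      ENNReal.ofReal (gammaMean a s h x.1) *
        ∫⁻ θ, poissonDensity s θ.1 (mixture k θ.2) x * G θ.2 ∂((massPrior a).prod D) := by
  have h1 := lintegral_prior_mul_poissonDensity (a := a) (D := D) (s := s) hk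
    (F := fun w => ENNReal.ofReal (h w)) hh.measurable.ennreal_ofReal hG x
  have h2 := lintegral_prior_mul_poissonDensity (a := a) (D := D) (s := s) hk
    (F := fun _ => ENNReal.ofReal 1) measurable_const hG x
  have hM := gammaMass_pos ha hs x.1
  rw [lintegral_ofReal_gammaWeight hs (fun w _ => (hh.pos w).le) _
    (hh.integrable_mul (integrableOn_gammaWeight ha hs _))] at h1
  rw [lintegral_ofReal_gammaWeight hs (fun _ _ => zero_le_one) _
    (by simpa using integrableOn_gammaWeight ha hs x.1)] at h2
  simp only [ENNReal.ofReal_one, one_mul] at h2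
  rw [h1, h2, ← mul_assoc, ← gammaMass, ← ENNReal.ofReal_mul' hM.le, gammaMean,
    div_mul_cancel₀ _ hM.ne']

/-- The intensity carries a factor $w$, so averaging $h$ over the gamma posterior gives the
size-biased mean; the mixture factor is independent of $w$ and does not affect it. -/
lemma lintegral_prior_size_biased_weight [IsProbabilityMeasure D] (hk : IsKernelFunction ν k)
    (ha : 0 < a) (hs : 0 < s) (hh : IsBlythWeight a h) {G : ProbabilityMeasure X → ℝ≥0∞}
    (hG : Measurable G) (x : Config X) :
    ∫⁻ θ, ENNReal.ofReal (h θ.1) * (poissonDensity s θ.1 (mixture k θ.2) x *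
        (ENNReal.ofReal θ.1 * G θ.2)) ∂((massPrior a).prod D) =
      ENNReal.ofReal (gammaSizeBiasedMean a s h x.1) *
        ∫⁻ θ, poissonDensity s θ.1 (mixture k θ.2) x * (ENNReal.ofReal θ.1 * G θ.2)
          ∂((massPrior a).prod D) := by
  have h1 := lintegral_prior_mul_poissonDensity (a := a) (D := D) (s := s) hk
    (F := fun w => ENNReal.ofReal (h w * w)) (by have := hh.measurable; fun_prop) hG x
  have h2 := lintegral_prior_mul_poissonDensity (a := a) (D := D) (s := s) hk
    (F := fun w => ENNReal.ofReal w) (by fun_prop) hG x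
  have hi := integrableOn_mul_gammaWeight ha hs x.1
  have hM : 0 < ∫ w in Ioi (0 : ℝ), w * gammaWeight a s x.1 w := by
    rw [integral_mul_gammaWeight ha hs]
    have := gammaMass_pos ha hs x.1
    positivity
  rw [lintegral_ofReal_gammaWeight hs (fun w hw => mul_nonneg (hh.pos w).le hw.le) _
    (by simp only [mul_assoc]; exact hh.integrable_mul hi)] at h1
  rw [lintegral_ofReal_gammaWeight hs (fun _ hw => hw.le) _ hi] at h2
  have e1 : ∀ θ : ℝ × ProbabilityMeasure X, ENNReal.ofReal (h θ.1) *
      (poissonDensity s θ.1 (mixture k θ.2) x * (ENNReal.ofReal θ.1 * G θ.2)) =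
      ENNReal.ofReal (h θ.1 * θ.1) * (poissonDensity s θ.1 (mixture k θ.2) x * G θ.2) := fun θ => by
    rw [ENNReal.ofReal_mul (hh.pos _).le]; ring
  have e2 : ∀ θ : ℝ × ProbabilityMeasure X, poissonDensity s θ.1 (mixture k θ.2) x *
      (ENNReal.ofReal θ.1 * G θ.2) = ENNReal.ofReal θ.1 *
        (poissonDensity s θ.1 (mixture k θ.2) x * G θ.2) := fun θ => by ring
  simp_rw [e1, e2]
  rw [h1, h2, ← mul_assoc, ← ENNReal.ofReal_mul' hM.le, gammaSizeBiasedMean,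
    div_mul_cancel₀ _ hM.ne']
  simp only [mul_assoc]

lemma lintegral_prior_mul_mass [IsProbabilityMeasure D] (hk : IsKernelFunction ν k) (ha : 0 < a)
    (hs : 0 < s) (x : Config X) :
    ∫⁻ θ, poissonDensity s θ.1 (mixture k θ.2) x * ENNReal.ofReal θ.1 ∂((massPrior a).prod D) =
      ENNReal.ofReal (∫ w in Ioi (0 : ℝ), w * gammaWeight a s x.1 w) *
        ∫⁻ m, ∏ i, mixture k m (x.2 i) ∂D := by
  have h2 := lintegral_prior_mul_poissonDensity (a := a) (D := D) (s := s) hk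
    (F := fun w => ENNReal.ofReal w) (G := fun _ => 1) (by fun_prop) measurable_const x
  rw [lintegral_ofReal_gammaWeight hs (fun _ hw => hw.le) _
    (integrableOn_mul_gammaWeight ha hs x.1)] at h2
  simp only [mul_one] at h2
  rw [← h2]
  exact lintegral_congr fun θ => mul_comm _ _

/-- The mixed product densities integrate to one over each $U^n$, which reduces integrals over
configurations to sums over the count. -/
lemma lintegral_mul_lintegral_prod_mixture [SigmaFinite ν] [IsProbabilityMeasure D] (hk : IsKernelFunction ν k)
    (ψ : ℕ → ℝ≥0∞) :
    ∫⁻ x, ψ x.1 * ∫⁻ m, ∏ i, mixture k m (x.2 i) ∂D ∂(configMeasure ν) = ∑' n, ψ n := by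
  have hm : ∀ n, Measurable fun z : ProbabilityMeasure X × (Fin n → X) =>
      ∏ i, mixture k z.1 (z.2 i) := fun n =>
    Finset.measurable_prod _ fun i _ => (measurable_mixture hk).comp (by fun_prop :
      Measurable fun z : ProbabilityMeasure X × (Fin n → X) => (z.1, z.2 i))
  have hmx : Measurable fun x : Config X => ∫⁻ m, ∏ i, mixture k m (x.2 i) ∂D :=
    measurable_of_sigma fun n => show Measurable fun z : Fin n → X =>
      ∫⁻ m, ∏ i, mixture k m (z i) ∂D from (hm n).lintegral_prod_left'
  have hψ : Measurable fun x : Config X => ψ x.1 * ∫⁻ m, ∏ i, mixture k m (x.2 i) ∂D :=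
    (measurable_comp_fst ψ).mul hmx
  rw [lintegral_configMeasure hψ]
  congr 1
  ext n
  have : ∫⁻ z, ∫⁻ m, ∏ i, mixture k m (z i) ∂D ∂(Measure.pi fun _ : Fin n => ν) = 1 := by
    rw [← lintegral_lintegral_swap (hm n).aemeasurable]
    simp_rw [fun m => lintegral_fin_prod_eq_prod (μ := ν) (n := n)
      (fun _ => measurable_mixture_right hk m), lintegral_mixture hk]
    simp
  calc _ = ∫⁻ z, ψ n * ∫⁻ m, ∏ i, mixture k m (z i) ∂D ∂(Measure.pi fun _ : Fin n => ν) := rfl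
    _ = ψ n := by rw [lintegral_const_mul _ (hm n).lintegral_prod_left', this, mul_one]

end Estimation

section Estimation

variable {X : Type*} [MeasurableSpace X] {ν : Measure X} {k : X → X → ℝ≥0}
  {D : Measure (ProbabilityMeasure X)} {a s t : ℝ} {h : ℝ → ℝ}

lemma IsBlythWeight.lintegral_prior_lt_top [IsProbabilityMeasure D] (hh : IsBlythWeight a h) :
    ∫⁻ θ, ENNReal.ofReal (h θ.1) * ENNReal.ofReal (1 + θ.1) ∂((massPrior a).prod D) < ∞ := by
  have hm := hh.measurable
  rw [lintegral_prior_eq (F := fun w => ENNReal.ofReal (h w) * ENNReal.ofReal (1 + w))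
    (by fun_prop)]
  refine lt_of_eq_of_lt ?_ hh.integrable
  refine lintegral_congr fun w => ?_
  rw [← ENNReal.ofReal_mul (hh.pos w).le, mul_comm (h w)]

lemma smul_withDensity_eq {c : ℝ≥0∞} {f : X → ℝ≥0∞} (hf : Measurable f) :
    c • ν.withDensity f = ν.withDensity fun y => c * f y := (withDensity_smul _ hf).symm

/-- The density `q` with its total mass capped at `K (n + 1)`, where `n` is the number of observed
points. -/
noncomputable def capDensity (ν : Measure X) (K : ℝ) (q : Config X × X → ℝ≥0∞)
    (z : Config X × X) : ℝ≥0∞ :=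
  q z * min 1 (ENNReal.ofReal (K * (z.1.1 + 1)) / ∫⁻ y, q (z.1, y) ∂ν)

lemma capDensity_ne {K : ℝ} (hK : 0 < K) {q : Config X × X → ℝ≥0∞} {z : Config X × X}
    (hq : q z ≠ 0 ∧ q z ≠ ∞) (hM : ∫⁻ y, q (z.1, y) ∂ν ≠ ∞) :
    capDensity ν K q z ≠ 0 ∧ capDensity ν K q z ≠ ∞ := by
  have h1 : 0 < K * (z.1.1 + 1) := by positivity
  have h2 : min 1 (ENNReal.ofReal (K * (z.1.1 + 1)) / ∫⁻ y, q (z.1, y) ∂ν) ≠ 0 :=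
    (lt_min one_pos (ENNReal.div_pos (by simpa using h1) hM)).ne'
  exact ⟨mul_ne_zero hq.1 h2, ENNReal.mul_ne_top hq.2
    (ne_top_of_le_ne_top ENNReal.one_ne_top (min_le_left _ _))⟩

lemma lintegral_capDensity_le {K : ℝ} {q : Config X × X → ℝ≥0∞} (hq : Measurable q)
    (x : Config X) :
    ∫⁻ y, capDensity ν K q (x, y) ∂ν ≤ ENNReal.ofReal (K * (x.1 + 1)) := by
  have hqx : Measurable fun y => q (x, y) := hq.comp measurable_prodMk_left
  simp only [capDensity]
  rw [lintegral_mul_const _ hqx]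
  refine (mul_le_mul_right (min_le_right _ _) _).trans ?_
  exact ENNReal.mul_div_le

lemma capDensity_eq {K : ℝ} {q : Config X × X → ℝ≥0∞} {x : Config X}
    (hM : ∫⁻ y, q (x, y) ∂ν ≠ ∞) (hM0 : ∫⁻ y, q (x, y) ∂ν ≠ 0)
    (h : ∫⁻ y, q (x, y) ∂ν ≤ ENNReal.ofReal (K * (x.1 + 1))) (y : X) :
    capDensity ν K q (x, y) = q (x, y) := by
  rw [capDensity, min_eq_left, mul_one]
  rwa [ENNReal.le_div_iff_mul_le (Or.inl hM0) (Or.inl hM), one_mul]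

variable [SigmaFinite ν]

/-- A quantity growing at most linearly in the count has expectation $O(1+sw)$, and the weighted
prior integrates $1+w$. -/
lemma IsBlythWeight.lintegral_prior_mul_ne_top [IsProbabilityMeasure D] (hh : IsBlythWeight a h)
    (hk : IsKernelFunction ν k) (hs : 0 < s) {C : ℝ≥0∞} (hC : C ≠ ∞) {ψ : Config X → ℝ≥0∞}
    (hψ : ∀ᵐ x ∂(configMeasure ν), ψ x ≤ C * ENNReal.ofReal (x.1 + 1)) :
    ∫⁻ θ, ENNReal.ofReal (h θ.1) * ∫⁻ x, poissonDensity s θ.1 (mixture k θ.2) x * ψ x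
      ∂(configMeasure ν) ∂((massPrior a).prod D) ≠ ∞ := by
  have hle : ∫⁻ θ, ENNReal.ofReal (h θ.1) * ∫⁻ x, poissonDensity s θ.1 (mixture k θ.2) x * ψ x
      ∂(configMeasure ν) ∂((massPrior a).prod D) ≤ ∫⁻ θ, C * ENNReal.ofReal (s + 1) *
        (ENNReal.ofReal (h θ.1) * ENNReal.ofReal (1 + θ.1)) ∂((massPrior a).prod D) := by
    refine lintegral_mono_ae ?_
    filter_upwards [Measure.quasiMeasurePreserving_fst.ae (ae_massPrior_pos a)] with θ hθ
    have hw : 0 < θ.1 := hθ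
    have h1 : ∫⁻ x, poissonDensity s θ.1 (mixture k θ.2) x * ψ x ∂(configMeasure ν) ≤
        C * ENNReal.ofReal (s * θ.1 + 1) := by
      calc _ ≤ ∫⁻ x, poissonDensity s θ.1 (mixture k θ.2) x * (C * ENNReal.ofReal (x.1 + 1))
            ∂(configMeasure ν) :=
            lintegral_mono_ae (hψ.mono fun x hx => mul_le_mul_right hx _)
        _ = ∑' n : ℕ, ENNReal.ofReal (poissonWeight (s * θ.1) n) * (C * ENNReal.ofReal (n + 1)) :=
            lintegral_poissonDensity_mul hk hs hw fun n => C * ENNReal.ofReal (n + 1)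
        _ = C * ∑' n : ℕ, ENNReal.ofReal (poissonWeight (s * θ.1) n) * ENNReal.ofReal (n + 1) := by
            rw [← ENNReal.tsum_mul_left]
            exact tsum_congr fun n => by ring
        _ ≤ _ := by
            refine mul_le_mul_right (tsum_ofReal_poissonWeight_mul_le (by positivity)
              (fun n => by positivity) (fun n => le_rfl) ?_) _
            exact hasSum_of_eq ((hasSum_nat_mul_poissonWeight _).add (hasSum_poissonWeight _))
              (fun n => by ring) rfl
    have h2 : ENNReal.ofReal (s * θ.1 + 1) ≤ ENNReal.ofReal (s + 1) * ENNReal.ofReal (1 + θ.1) := by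
      rw [← ENNReal.ofReal_mul (by positivity)]
      exact ENNReal.ofReal_le_ofReal (by nlinarith)
    calc _ ≤ ENNReal.ofReal (h θ.1) *
          (C * (ENNReal.ofReal (s + 1) * ENNReal.ofReal (1 + θ.1))) := by
          refine mul_le_mul_right (h1.trans (mul_le_mul_right h2 _)) _
      _ = _ := by ring
  refine ne_top_of_le_ne_top ?_ hle
  rw [lintegral_const_mul' _ _ (by finiteness)]
  exact ENNReal.mul_ne_top (by finiteness) hh.lintegral_prior_lt_top.ne

/-- The divergence of Poisson processes is the integrated `klTerm` of their intensities, which is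
homogeneous of degree one; hence the factor $t$. -/
lemma estimationRisk_eq_mul_klRisk (hk : IsKernelFunction ν k) (hs : 0 < s) (ht : 0 < t)
    {θ : ℝ × ProbabilityMeasure X} (hθ : 0 < θ.1) (h0 : ∀ᵐ y ∂ν, mixture k θ.2 y ≠ 0)
    {q : Config X × X → ℝ≥0∞} (hq : Measurable q)
    (hq0 : ∀ᵐ x ∂(configMeasure ν), ∀ᵐ y ∂ν, q (x, y) ≠ 0 ∧ q (x, y) ≠ ∞)
    (hq1 : ∀ᵐ x ∂(configMeasure ν), ∫⁻ y, q (x, y) ∂ν ≠ ∞)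
    {δ : Config X → Measure X}
    (hδ : ∀ᵐ x ∂(configMeasure ν), δ x = ν.withDensity fun y => q (x, y)) :
    estimationRisk s t (ν.withDensity (intensity k θ)) δ =
      ENNReal.ofReal t * klRisk (configMeasure ν) ν
        (fun z : (ℝ × ProbabilityMeasure X) × Config X =>
          poissonDensity s z.1.1 (mixture k z.1.2) z.2)
        (fun z : (ℝ × ProbabilityMeasure X) × X => intensity k z.1 z.2) q θ := by
  have hi : Measurable (intensity k θ) := (measurable_intensity hk).comp measurable_prodMk_left
  have mG : Measurable fun z : Config X × X => klTerm (intensity k θ z.2) (q z) := by fun_prop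
  have hi0 := ae_intensity_ne hk hθ h0
  have ht0 : ENNReal.ofReal t ≠ 0 := by simpa using ht
  have h : ∀ᵐ x ∂(configMeasure ν),
      klDiv (poissonProcess (ENNReal.ofReal t • ν.withDensity (intensity k θ)))
        (poissonProcess (ENNReal.ofReal t • δ x)) =
        ENNReal.ofReal t * ∫⁻ y, klTerm (intensity k θ y) (q (x, y)) ∂ν := by
    filter_upwards [hδ, hq0, hq1] with x h1 h2 h3
    have hqx : Measurable fun y => q (x, y) := hq.comp measurable_prodMk_left
    have mx : Measurable fun y => klTerm (intensity k θ y) (q (x, y)) := by fun_prop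
    rw [h1, smul_withDensity_eq hi, smul_withDensity_eq hqx,
      klDiv_poissonProcess (by fun_prop) (by fun_prop), ← lintegral_const_mul _ mx]
    · exact lintegral_congr fun y => klTerm_mul_left ht0 ENNReal.ofReal_ne_top
    · rw [lintegral_const_mul _ hi, lintegral_intensity hk]; finiteness
    · rw [lintegral_const_mul _ hqx]; finiteness
    · exact hi0.mono fun y hy => mul_ne_zero ht0 hy.1
    · exact h2.mono fun y hy => mul_ne_zero ht0 hy.1
  rw [klRisk_eq (measurable_intensity hk) hq]
  refine (lintegral_poissonProcess_eq hk hs hθ (mG.lintegral_prod_right'.const_mul _) h).trans ?_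
  have hp : Measurable (poissonDensity s θ.1 (mixture k θ.2)) :=
    (measurable_poissonDensity_mixture hk s).comp measurable_prodMk_left
  have mI : Measurable fun x => poissonDensity s θ.1 (mixture k θ.2) x *
    ∫⁻ y, klTerm (intensity k θ y) (q (x, y)) ∂ν := hp.mul mG.lintegral_prod_right'
  rw [← lintegral_const_mul _ mI]
  exact lintegral_congr fun x => by ring

lemma measurable_capDensity {K : ℝ} {q : Config X × X → ℝ≥0∞} (hq : Measurable q) :
    Measurable (capDensity ν K q) := by
  have h1 : Measurable fun x : Config X => ENNReal.ofReal (K * (x.1 + 1)) :=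
    measurable_comp_fst fun n : ℕ => ENNReal.ofReal (K * (n + 1))
  have h2 : Measurable fun x => ∫⁻ y, q (x, y) ∂ν := hq.lintegral_prod_right'
  exact hq.mul (measurable_const.min ((h1.comp measurable_fst).div (h2.comp measurable_fst)))

/-- A cap at $K(n+1)$ costs at most $w^2/(K(n+1))$ for each count, and $E[1/(N+1)]\le1/(sw)$ under
the sampling law. The increase is thus linear in $w$ and integrable against the weighted prior. -/
lemma klRisk_capDensity_le (hk : IsKernelFunction ν k) (hs : 0 < s)
    {θ : ℝ × ProbabilityMeasure X} (hθ : 0 < θ.1) (h0 : ∀ᵐ y ∂ν, mixture k θ.2 y ≠ 0)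
    {q : Config X × X → ℝ≥0∞} (hq : Measurable q)
    (hq0 : ∀ᵐ x ∂(configMeasure ν), ∀ᵐ y ∂ν, q (x, y) ≠ 0 ∧ q (x, y) ≠ ∞)
    (hq1 : ∀ᵐ x ∂(configMeasure ν), ∫⁻ y, q (x, y) ∂ν ≠ 0 ∧ ∫⁻ y, q (x, y) ∂ν ≠ ∞)
    {K : ℝ} (hK : 0 < K) :
    klRisk (configMeasure ν) ν
        (fun z : (ℝ × ProbabilityMeasure X) × Config X =>
          poissonDensity s z.1.1 (mixture k z.1.2) z.2)
        (fun z : (ℝ × ProbabilityMeasure X) × X => intensity k z.1 z.2) (capDensity ν K q) θ ≤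
      klRisk (configMeasure ν) ν
        (fun z : (ℝ × ProbabilityMeasure X) × Config X =>
          poissonDensity s z.1.1 (mixture k z.1.2) z.2)
        (fun z : (ℝ × ProbabilityMeasure X) × X => intensity k z.1 z.2) q θ +
      ENNReal.ofReal (θ.1 / (s * K)) := by
  have hi : Measurable (intensity k θ) := (measurable_intensity hk).comp measurable_prodMk_left
  have hp : Measurable (poissonDensity s θ.1 (mixture k θ.2)) :=
    (measurable_poissonDensity_mixture hk s).comp measurable_prodMk_left
  have mG : Measurable fun z : Config X × X => klTerm (intensity k θ z.2) (q z) := by fun_prop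
  have mI : Measurable fun x => poissonDensity s θ.1 (mixture k θ.2) x *
    ∫⁻ y, klTerm (intensity k θ y) (q (x, y)) ∂ν := hp.mul mG.lintegral_prod_right'
  have hi0 := ae_intensity_ne hk hθ h0
  rw [klRisk_eq (measurable_intensity hk) hq,
    klRisk_eq (measurable_intensity hk) (measurable_capDensity hq)]
  have hw := hθ
  calc _ ≤ ∫⁻ x, (poissonDensity s θ.1 (mixture k θ.2) x *
        ∫⁻ y, klTerm (intensity k θ y) (q (x, y)) ∂ν + poissonDensity s θ.1 (mixture k θ.2) x *
          (ENNReal.ofReal (θ.1 ^ 2 / K) * ENNReal.ofReal (1 / (x.1 + 1)))) ∂(configMeasure ν) := by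
        refine lintegral_mono_ae ?_
        filter_upwards [hq0, hq1] with x h1 h2
        have hqx : Measurable fun y => q (x, y) := hq.comp measurable_prodMk_left
        have hb : 0 < K * ((x.1 : ℝ) + 1) := by positivity
        have h3 := lintegral_klTerm_cap_le hi hqx hi0 h1 hw hb (lintegral_intensity hk θ) h2.2 h2.1
        have e : ENNReal.ofReal (θ.1 ^ 2 / (K * ((x.1 : ℝ) + 1))) =
            ENNReal.ofReal (θ.1 ^ 2 / K) * ENNReal.ofReal (1 / (x.1 + 1)) := by
          rw [← ENNReal.ofReal_mul (by positivity)]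
          congr 1
          field_simp
        rw [e] at h3
        rw [← mul_add]
        exact mul_le_mul_right h3 _
    _ = ∫⁻ x, poissonDensity s θ.1 (mixture k θ.2) x *
        ∫⁻ y, klTerm (intensity k θ y) (q (x, y)) ∂ν ∂(configMeasure ν) +
        ∑' n : ℕ, ENNReal.ofReal (poissonWeight (s * θ.1) n) *
          (ENNReal.ofReal (θ.1 ^ 2 / K) * ENNReal.ofReal (1 / (n + 1))) := by
        rw [lintegral_add_left mI]
        congr 1
        exact lintegral_poissonDensity_mul hk hs hw fun n =>
          ENNReal.ofReal (θ.1 ^ 2 / K) * ENNReal.ofReal (1 / (n + 1))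
    _ ≤ _ := by
        refine add_le_add le_rfl ?_
        simp_rw [mul_left_comm _ (ENNReal.ofReal (θ.1 ^ 2 / K))]
        rw [ENNReal.tsum_mul_left]
        refine (mul_le_mul_right (tsum_poissonWeight_div_succ_le (mul_pos hs hw)) _).trans_eq ?_
        rw [← ENNReal.ofReal_mul (by positivity)]
        congr 1
        field_simp

end Estimation

section Estimation

variable {X : Type*} [MeasurableSpace X] {ν : Measure X} [SigmaFinite ν] {k : X → X → ℝ≥0}
  {D : Measure (ProbabilityMeasure X)} {a s t : ℝ} {h : ℝ → ℝ}

/-- The cost of a Blyth weight in the estimation problem. -/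
lemma IsBlythWeight.lintegral_size_bias_cost_le [IsProbabilityMeasure D] (hh : IsBlythWeight a h)
    (hk : IsKernelFunction ν k) (ha : 0 < a) (ha1 : a ≤ 1) (hs : 0 < s) :
    ∫⁻ x, ENNReal.ofReal ((gammaSizeBiasedMean a s h x.1 - gammaMean a s h x.1) ^ 2 /
        gammaMean a s h x.1) * ∫⁻ y, ∫⁻ θ, poissonDensity s θ.1 (mixture k θ.2) x * intensity k θ y
          ∂((massPrior a).prod D) ∂ν ∂(configMeasure ν) ≤
      ENNReal.ofReal (16 / s) * weightCost a s h := by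
  refine le_trans (le_of_eq ?_) (hh.tsum_size_bias_cost_le ha ha1 hs)
  rw [← lintegral_mul_lintegral_prod_mixture (ν := ν) (D := D) hk]
  refine lintegral_congr fun x => ?_
  have mp : Measurable fun θ : ℝ × ProbabilityMeasure X => poissonDensity s θ.1 (mixture k θ.2) x :=
    (measurable_poissonDensity_mixture hk s).comp measurable_prodMk_right
  have mi : Measurable fun z : X × (ℝ × ProbabilityMeasure X) => intensity k z.2 z.1 :=
    (measurable_intensity hk).comp measurable_swap
  have mz : Measurable fun z : X × (ℝ × ProbabilityMeasure X) =>
      poissonDensity s z.2.1 (mixture k z.2.2) x * intensity k z.2 z.1 :=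
    (mp.comp measurable_snd).mul mi
  have e : ∫⁻ y, ∫⁻ θ, poissonDensity s θ.1 (mixture k θ.2) x * intensity k θ y
      ∂((massPrior a).prod D) ∂ν = ∫⁻ θ, poissonDensity s θ.1 (mixture k θ.2) x *
        ENNReal.ofReal θ.1 ∂((massPrior a).prod D) := by
    rw [lintegral_lintegral_swap mz.aemeasurable]
    refine lintegral_congr fun θ => ?_
    have mθ : Measurable (intensity k θ) := (measurable_intensity hk).comp measurable_prodMk_left
    rw [lintegral_const_mul _ mθ, lintegral_intensity hk]
  have hI : 0 ≤ ∫ w in Ioi (0 : ℝ), w * gammaWeight a s x.1 w := by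
    rw [integral_mul_gammaWeight ha hs]
    have := gammaMass_pos ha hs x.1
    positivity
  rw [e, lintegral_prior_mul_mass hk ha hs, ← mul_assoc, mul_comm (ENNReal.ofReal _),
    ENNReal.ofReal_mul hI]

/-- The comparison of the generalized Bayes estimator with a capped competitor. -/
lemma IsBlythWeight.lintegral_mul_gapRisk_capDensity_le [IsProbabilityMeasure D]
    (hh : IsBlythWeight a h) (hk : IsKernelFunction ν k) (ha : 0 < a) (ha1 : a ≤ 1) (hs : 0 < s)
    (h0 : ∀ᵐ m ∂D, ∀ᵐ y ∂ν, mixture k m y ≠ 0)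
    {p : (ℝ × ProbabilityMeasure X) × Config X → ℝ≥0∞}
    (hp_def : p = fun z => poissonDensity s z.1.1 (mixture k z.1.2) z.2)
    {r : (ℝ × ProbabilityMeasure X) × X → ℝ≥0∞} (hr_def : r = fun z => intensity k z.1 z.2)
    {q q' : Config X × X → ℝ≥0∞} (hq_def : q = posteriorMean ((massPrior a).prod D) p r)
    (hq0 : ∀ᵐ x ∂(configMeasure ν), ∀ᵐ y ∂ν, q (x, y) ≠ 0 ∧ q (x, y) ≠ ∞)
    (hqmass : ∀ᵐ x ∂(configMeasure ν), ∫⁻ y, q (x, y) ∂ν = ENNReal.ofReal ((x.1 + a) / s))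
    (hq' : Measurable q')
    (hq'0 : ∀ᵐ x ∂(configMeasure ν), ∀ᵐ y ∂ν, q' (x, y) ≠ 0 ∧ q' (x, y) ≠ ∞)
    (hq'1 : ∀ᵐ x ∂(configMeasure ν), ∫⁻ y, q' (x, y) ∂ν ≠ 0 ∧ ∫⁻ y, q' (x, y) ∂ν ≠ ∞)
    (hR : ∀ᵐ θ ∂((massPrior a).prod D), klRisk (configMeasure ν) ν p r q θ < ∞)
    (hR' : ∀ᵐ θ ∂((massPrior a).prod D),
      klRisk (configMeasure ν) ν p r q' θ ≤ klRisk (configMeasure ν) ν p r q θ)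
    {K : ℝ} (hK : 0 < K) :
    2 * ∫⁻ θ, ENNReal.ofReal (h θ.1) * gapRisk (configMeasure ν) ν p r q (capDensity ν K q') θ
        ∂((massPrior a).prod D) ≤
      2 * (ENNReal.ofReal (16 / s) * weightCost a s h) + ENNReal.ofReal (1 / (s * K)) *
        ∫⁻ θ, ENNReal.ofReal (h θ.1) * ENNReal.ofReal (1 + θ.1) ∂((massPrior a).prod D) := by
  have hp : Measurable p := hp_def ▸ measurable_poissonDensity_mixture hk s
  have hr : Measurable r := hr_def ▸ measurable_intensity hk
  have hq : Measurable q := hq_def ▸ measurable_posteriorMean hp hr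
  have hm := hh.measurable
  have hgood : ∀ᵐ θ ∂((massPrior a).prod D), 0 < θ.1 ∧ ∀ᵐ y ∂ν, mixture k θ.2 y ≠ 0 :=
    ae_prior_iff_imp h0
  have hZ : ∀ᵐ x ∂(configMeasure ν), ∫⁻ θ, p (θ, x) ∂((massPrior a).prod D) ≠ 0 ∧
      ∫⁻ θ, p (θ, x) ∂((massPrior a).prod D) ≠ ∞ := by
    rw [hp_def]
    exact ae_lintegral_prior_poissonDensity hk h0 ha hs
  have mmix : ∀ y, Measurable fun m : ProbabilityMeasure X => mixture k m y := fun y =>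
    (measurable_mixture hk).comp measurable_prodMk_right
  have hκ : Measurable fun θ : ℝ × ProbabilityMeasure X => ENNReal.ofReal (θ.1 / (s * K)) := by
    fun_prop
  have key := two_mul_lintegral_mul_gapRisk_le (π := (massPrior a).prod D) (μ := configMeasure ν)
    (ν := ν) (h := fun θ => h θ.1) (H := fun x : Config X => gammaSizeBiasedMean a s h x.1)
    (g := fun x : Config X => gammaMean a s h x.1)
    hp hr hq (measurable_capDensity (K := K) hq')
    (hgood.mono fun θ h => by rw [hp_def]; exact lintegral_poissonDensity hk hs h.1)
    (hgood.mono fun θ h => by rw [hr_def]; exact ae_intensity_ne hk h.1 h.2) hq0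
    (by
      filter_upwards [hq'0, hq'1] with x h1 h2
      filter_upwards [h1] with y h3 using capDensity_ne hK h3 h2.2)
    (hZ.mono fun x hx => ae_of_all _ fun y => by
      rw [hq_def, lintegral_mul_eq_mul_posteriorMean hx.1 hx.2])
    hR hκ
    (by
      filter_upwards [hgood, hR'] with θ h1 h2
      rw [hp_def, hr_def] at h2 ⊢
      exact (klRisk_capDensity_le hk hs h1.1 h1.2 hq' hq'0 hq'1 hK).trans (by gcongr))
    (by fun_prop) (measurable_comp_fst _) (measurable_comp_fst _)
    (fun x => hh.gammaSizeBiasedMean_nonneg hs _) (fun x => hh.gammaMean_pos ha ha1 hs _)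
    (ae_of_all _ fun x => by
      have := lintegral_prior_weight (D := D) hk ha hs hh (G := fun _ => 1) measurable_const x
      simp only [mul_one] at this
      rw [hp_def]
      exact this)
    (ae_of_all _ fun x => ae_of_all _ fun y => by
      rw [hp_def, hr_def]
      exact lintegral_prior_size_biased_weight (D := D) hk ha hs hh (mmix y) x)
    (by
      refine ne_top_of_le_ne_top hh.lintegral_prior_lt_top.ne
        (lintegral_mono fun θ => mul_le_mul_right ?_ _)
      rw [hr_def]
      simp only
      rw [lintegral_intensity hk]
      exact ENNReal.ofReal_le_ofReal (by linarith))
    (by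
      rw [hp_def]
      refine hh.lintegral_prior_mul_ne_top hk hs (C := ENNReal.ofReal (1 / s))
        ENNReal.ofReal_ne_top ?_
      filter_upwards [hqmass] with x hx
      rw [hx, ← ENNReal.ofReal_mul (by positivity)]
      refine ENNReal.ofReal_le_ofReal ?_
      rw [div_mul_eq_mul_div, one_mul]
      gcongr)
    (by
      rw [hp_def]
      refine hh.lintegral_prior_mul_ne_top hk hs (C := ENNReal.ofReal K)
        ENNReal.ofReal_ne_top (ae_of_all _ fun x => ?_)
      rw [← ENNReal.ofReal_mul hK.le]
      exact lintegral_capDensity_le hq' x)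
  refine key.trans (add_le_add (mul_le_mul_right ?_ _) ?_)
  · rw [hp_def, hr_def]
    exact hh.lintegral_size_bias_cost_le hk ha ha1 hs
  · rw [← lintegral_const_mul' _ _ ENNReal.ofReal_ne_top]
    refine lintegral_mono_ae (hgood.mono fun θ hθ => ?_)
    have hw := hθ.1
    have hsK : 0 < s * K := mul_pos hs hK
    have e : ENNReal.ofReal (θ.1 / (s * K)) ≤
        ENNReal.ofReal (1 / (s * K)) * ENNReal.ofReal (1 + θ.1) := by
      rw [← ENNReal.ofReal_mul (by positivity)]
      refine ENNReal.ofReal_le_ofReal ?_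
      rw [div_mul_eq_mul_div, one_mul]
      gcongr
      linarith
    calc _ ≤ ENNReal.ofReal (h θ.1) *
          (ENNReal.ofReal (1 / (s * K)) * ENNReal.ofReal (1 + θ.1)) := mul_le_mul_right e _
      _ = _ := by ring

end Estimation

section Estimation

variable {X : Type*} [MeasurableSpace X] {ν : Measure X} [SigmaFinite ν] {k : X → X → ℝ≥0}
  {D : Measure (ProbabilityMeasure X)} {a s t : ℝ}

/-- Admissibility of the generalized Bayes estimator, for a general dominating measure. -/
theorem isAdmissible_bayesEstimator [StandardBorelSpace X] [IsProbabilityMeasure D] (hν : ν ≠ 0)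
    (hk : IsKernelFunction ν k) {Λ : Set (Measure X)} (hΛ : IsParameterSpace ν Λ)
    (hDΛ : ∀ᵐ m ∂D, ν.withDensity (mixture k m) ∈ Λ) (hs : 0 < s) (ht : 0 < t) (ha : 0 < a)
    (ha1 : a ≤ 1)
    (hR : ∀ᵐ θ ∂((massPrior a).prod D), estimationRisk s t (ν.withDensity (intensity k θ))
      (bayesEstimator ν k s ((massPrior a).prod D)) < ∞) :
    IsAdmissible Λ (decisionRules ν (finiteEquivMeasures ν)) (estimationRisk s t)
      (bayesEstimator ν k s ((massPrior a).prod D)) := by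
  obtain ⟨π, hπ⟩ : ∃ π, π = (massPrior a).prod D := ⟨_, rfl⟩
  have hsf : SFinite π := by rw [hπ]; infer_instance
  obtain ⟨p, hp_def⟩ : ∃ p : (ℝ × ProbabilityMeasure X) × Config X → ℝ≥0∞, p = fun z =>
    poissonDensity s z.1.1 (mixture k z.1.2) z.2 := ⟨_, rfl⟩
  obtain ⟨r, hr_def⟩ : ∃ r : (ℝ × ProbabilityMeasure X) × X → ℝ≥0∞, r = fun z =>
    intensity k z.1 z.2 := ⟨_, rfl⟩
  have hp : Measurable p := hp_def ▸ measurable_poissonDensity_mixture hk s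
  have hr : Measurable r := hr_def ▸ measurable_intensity hk
  have h0 : ∀ᵐ m ∂D, ∀ᵐ y ∂ν, mixture k m y ≠ 0 := hDΛ.mono fun m hm => ae_mixture_ne_zero hΛ hk hm
  have hgood : ∀ᵐ θ ∂π, 0 < θ.1 ∧ ν.withDensity (mixture k θ.2) ∈ Λ := by
    rw [hπ]; exact ae_prior_iff_imp hDΛ
  have hr0 : ∀ᵐ θ ∂π, ∀ᵐ y ∂ν, r (θ, y) ≠ 0 ∧ r (θ, y) ≠ ∞ := hgood.mono fun θ h => by
    rw [hr_def]; exact ae_intensity_ne hk h.1 (ae_mixture_ne_zero hΛ hk h.2)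
  have hZ : ∀ᵐ x ∂(configMeasure ν), ∫⁻ θ, p (θ, x) ∂π ≠ 0 ∧ ∫⁻ θ, p (θ, x) ∂π ≠ ∞ := by
    rw [hp_def, hπ]; exact ae_lintegral_prior_poissonDensity hk h0 ha hs
  obtain ⟨q, hq_def⟩ : ∃ q, q = posteriorMean π p r := ⟨_, rfl⟩
  have hq : Measurable q := hq_def ▸ measurable_posteriorMean hp hr
  have hδ : bayesEstimator ν k s π = fun x => ν.withDensity fun y => q (x, y) := by
    ext1 x
    rw [hq_def, hp_def, hr_def]
    exact bayesEstimator_eq hk x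
  -- The mass of the estimate is the posterior mean of $w$, that is, the mean $(n+a)/s$ of its gamma
  -- law.
  have hqmass : ∀ᵐ x ∂(configMeasure ν), ∫⁻ y, q (x, y) ∂ν = ENNReal.ofReal ((x.1 + a) / s) := by
    filter_upwards [ae_lintegral_prod_mixture hk h0] with x hx
    have hM := gammaMass_pos ha hs x.1
    have h1 := lintegral_prior_mul_mass (D := D) hk ha hs x
    have h2 := lintegral_prior_poissonDensity (D := D) hk ha hs x
    rw [hq_def, lintegral_posteriorMean hp hr, hp_def, hr_def, hπ]
    simp_rw [lintegral_intensity hk]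
    rw [h1, h2, integral_mul_gammaWeight ha hs, ENNReal.ofReal_mul (by positivity), mul_assoc,
      mul_left_comm, ENNReal.inv_mul_cancel, mul_one]
    · exact mul_ne_zero (by simpa using hM) hx.1
    · exact ENNReal.mul_ne_top ENNReal.ofReal_ne_top hx.2
  have hq0 : ∀ᵐ x ∂(configMeasure ν), ∀ᵐ y ∂ν, q (x, y) ≠ 0 ∧ q (x, y) ≠ ∞ := by
    filter_upwards [hZ, hqmass] with x hx h1
    have hqx : Measurable fun y => q (x, y) := hq.comp measurable_prodMk_left
    have h2 := ae_posteriorMean_ne_zero hp hr (hr0.mono fun θ h => h.mono fun _ h => h.1) hx.1 hx.2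
    rw [← hq_def] at h2
    filter_upwards [h2, ae_lt_top hqx (by simp [h1])] with y h3 h4 using ⟨h3, h4.ne⟩
  rw [← hπ] at hR ⊢
  refine ⟨⟨?_, ?_⟩, ?_⟩
  · rw [hδ]
    exact measurable_withDensity_prodMk hq
  · filter_upwards [hq0, hqmass] with x h1 h2
    have hqx : Measurable fun y => q (x, y) := hq.comp measurable_prodMk_left
    rw [hδ]
    exact ⟨isFiniteMeasure_withDensity (by simp [h2]), withDensity_absolutelyContinuous _ _,
      withDensity_absolutelyContinuous' hqx.aemeasurable (h1.mono fun _ h => h.1)⟩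
  · rintro ⟨δ', ⟨hδ'm, hδ'a⟩, hle, κ, hκ, hlt⟩
    obtain ⟨q', hq', hq'δ⟩ := exists_measurable_density_of_sigmaFinite (ρ := ν) hδ'm
    have hδ' : ∀ᵐ x ∂(configMeasure ν), δ' x = ν.withDensity fun y => q' (x, y) :=
      hδ'a.mono fun x h => have := h.1; hq'δ x (measure_ne_top _ _) h.2.1
    have hq'1 : ∀ᵐ x ∂(configMeasure ν), ∫⁻ y, q' (x, y) ∂ν ≠ 0 ∧ ∫⁻ y, q' (x, y) ∂ν ≠ ∞ := by
      filter_upwards [hδ', hδ'a] with x h1 h2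
      have hf := h2.1
      have e : δ' x univ = ∫⁻ y, q' (x, y) ∂ν := by
        rw [h1, withDensity_apply _ MeasurableSet.univ, Measure.restrict_univ]
      rw [← e]
      exact ⟨fun h => hν (Measure.measure_univ_eq_zero.1 (h2.2.2 h)), measure_ne_top _ _⟩
    have hq'0 : ∀ᵐ x ∂(configMeasure ν), ∀ᵐ y ∂ν, q' (x, y) ≠ 0 ∧ q' (x, y) ≠ ∞ := by
      filter_upwards [hδ', hδ'a, hq'1] with x h1 h2 h3
      have hqx : Measurable fun y => q' (x, y) := hq'.comp measurable_prodMk_left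
      have h4 : ν.withDensity (fun _ => 1) ≪ ν.withDensity fun y => q' (x, y) := by
        rw [withDensity_const, one_smul, ← h1]; exact h2.2.2
      filter_upwards [ae_ne_zero_of_withDensity_absolutelyContinuous measurable_const hqx
        (by simp) h4, ae_lt_top hqx h3.2] with y h5 h6 using ⟨h5, h6.ne⟩
    have e1 : ∀ᵐ θ ∂π, estimationRisk s t (ν.withDensity (intensity k θ))
        (bayesEstimator ν k s π) = ENNReal.ofReal t * klRisk (configMeasure ν) ν p r q θ :=
      hgood.mono fun θ h => by
        rw [hp_def, hr_def]
        exact estimationRisk_eq_mul_klRisk hk hs ht h.1 (ae_mixture_ne_zero hΛ hk h.2) hq hq0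
          (hqmass.mono fun x hx => by simp [hx]) (ae_of_all _ fun x => by rw [hδ])
    have e2 : ∀ᵐ θ ∂π, estimationRisk s t (ν.withDensity (intensity k θ)) δ' =
        ENNReal.ofReal t * klRisk (configMeasure ν) ν p r q' θ :=
      hgood.mono fun θ h => by
        rw [hp_def, hr_def]
        exact estimationRisk_eq_mul_klRisk hk hs ht h.1 (ae_mixture_ne_zero hΛ hk h.2) hq' hq'0
          (hq'1.mono fun x hx => hx.2) hδ'
    have ht0 : ENNReal.ofReal t ≠ 0 := by simpa using ht
    have hR1 : ∀ᵐ θ ∂π, klRisk (configMeasure ν) ν p r q θ < ∞ := by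
      filter_upwards [hR, e1] with θ h1 h2
      rw [h2] at h1
      exact (ENNReal.mul_lt_top_iff.1 h1).elim (fun h => h.2) fun h => h.elim
        (fun h => absurd h ht0) fun h => by simp [h]
    have hR2 : ∀ᵐ θ ∂π, klRisk (configMeasure ν) ν p r q' θ ≤
        klRisk (configMeasure ν) ν p r q θ := by
      filter_upwards [hgood, e1, e2] with θ h1 h2 h3
      have h4 := hle _ (withDensity_intensity_mem hΛ hk h1.1 h1.2)
      rw [h2, h3] at h4
      exact (ENNReal.mul_le_mul_iff_right ht0 ENNReal.ofReal_ne_top).1 h4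
    have mass : Measurable fun x => ∫⁻ y, q' (x, y) ∂ν := hq'.lintegral_prod_right'
    have heq : ∀ᵐ x ∂(configMeasure ν), ∀ᵐ y ∂ν, q' (x, y) = q (x, y) := by
      -- equality where the total mass of the competitor is at most `K₀` times `n + 1`
      have hset : ∀ K₀ : ℕ, ∀ᵐ x ∂(configMeasure ν),
          ∫⁻ y, q' (x, y) ∂ν ≤ ENNReal.ofReal (K₀ * (x.1 + 1)) →
            ∀ᵐ y ∂ν, q' (x, y) = q (x, y) := by
        intro K₀
        obtain ⟨S, hS_def⟩ : ∃ S : Set (Config X), S =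
          {x | ∫⁻ y, q' (x, y) ∂ν ≤ ENNReal.ofReal (K₀ * (x.1 + 1))} := ⟨_, rfl⟩
        have hS : MeasurableSet S := by
          rw [hS_def]
          exact measurableSet_le mass (measurable_comp_fst fun n : ℕ => ENNReal.ofReal (K₀ * (n + 1)))
        have hA : MeasurableSet {θ : ℝ × ProbabilityMeasure X | θ.1 ∈ Ioc (0 : ℝ) 1} :=
          measurable_fst measurableSet_Ioc
        -- On $S$ a cap with $K\ge K_0$ changes nothing, so there the gap of the competitor itself
        -- is controlled by that of its capped version, with a bound that can be made small by
        -- taking $K$ large.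
        have hgap : ∀ K : ℝ, K₀ ≤ K → ∀ θ, gapRisk ((configMeasure ν).restrict S) ν p r q q' θ ≤
            gapRisk (configMeasure ν) ν p r q (capDensity ν K q') θ := by
          intro K hK θ
          unfold gapRisk
          refine le_trans (le_of_eq (setLIntegral_congr_fun_ae hS ?_)) (setLIntegral_le_lintegral S _)
          filter_upwards [hq'1] with x h1 hx
          rw [hS_def] at hx
          refine lintegral_congr fun y => ?_
          rw [capDensity_eq h1.2 h1.1 (hx.trans (ENNReal.ofReal_le_ofReal (by gcongr)))]
        obtain ⟨θ, ⟨h1, h2⟩, h3⟩ := exists_eq_zero_of_lintegral_mul_lt (π := π) hA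
          (hπ ▸ prior_Ioc_ne_zero a)
          (measurable_gapRisk (μ := (configMeasure ν).restrict S) (ν := ν) hp hr hq hq')
          (hgood.and hr0) fun ε hε => by
            -- The weight is chosen first, with $\frac{16}{s}\cdot\frac{\varepsilon
            -- s}{32}=\frac{\varepsilon}{2}$. The cap $K$ follows, large enough that the risk
            -- increase $B/(sK)$ is at most $\varepsilon$; the finite constant $B$ depends on $h$.
            obtain ⟨h, hh, hV⟩ := exists_isBlythWeight_weightCost_lt (s := s)
              (ε := ε * s / 32) ha ha1 hs (by positivity)
            obtain ⟨B, hB⟩ : ∃ B, B = ∫⁻ θ, ENNReal.ofReal (h θ.1) * ENNReal.ofReal (1 + θ.1)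
              ∂((massPrior a).prod D) := ⟨_, rfl⟩
            have hB_top : B ≠ ∞ := hB ▸ hh.lintegral_prior_lt_top.ne
            obtain ⟨K, hK⟩ : ∃ K : ℝ, K = max (max (K₀ : ℝ) 1) (B.toReal / (s * ε)) := ⟨_, rfl⟩
            have hK0 : (K₀ : ℝ) ≤ K := hK ▸ (le_max_left _ _).trans (le_max_left _ _)
            have hK1 : 1 ≤ K := hK ▸ (le_max_right _ _).trans (le_max_left _ _)
            have hKB : B.toReal / (s * ε) ≤ K := hK ▸ le_max_right _ _
            have hKpos : 0 < K := one_pos.trans_le hK1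
            refine ⟨fun θ => h θ.1, fun θ hθ => hh.lower _ hθ, ?_⟩
            have hcap := hh.lintegral_mul_gapRisk_capDensity_le hk ha ha1 hs h0 hp_def hr_def
              (hπ ▸ hq_def) hq0 hqmass hq' hq'0 hq'1 (hπ ▸ hR1) (hπ ▸ hR2) hKpos
            rw [← hB, ← hπ] at hcap
            have hb1 : ENNReal.ofReal (16 / s) * weightCost a s h ≤ ENNReal.ofReal (ε / 2) := by
              calc _ ≤ ENNReal.ofReal (16 / s) * ENNReal.ofReal (ε * s / 32) := by gcongr
                _ = _ := by
                  rw [← ENNReal.ofReal_mul (by positivity)]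
                  congr 1
                  field_simp
                  norm_num
            have hb2 : ENNReal.ofReal (1 / (s * K)) * B ≤ ENNReal.ofReal ε := by
              rw [← ENNReal.ofReal_toReal hB_top, ← ENNReal.ofReal_mul (by positivity)]
              refine ENNReal.ofReal_le_ofReal ?_
              rw [div_le_iff₀ (by positivity)] at hKB
              rw [div_mul_eq_mul_div, one_mul, div_le_iff₀ (by positivity)]
              linarith
            have hb3 : 2 * ∫⁻ θ, ENNReal.ofReal (h θ.1) *
                gapRisk ((configMeasure ν).restrict S) ν p r q q' θ ∂π ≤ 2 * ENNReal.ofReal ε := by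
              calc _ ≤ 2 * ∫⁻ θ, ENNReal.ofReal (h θ.1) *
                    gapRisk (configMeasure ν) ν p r q (capDensity ν K q') θ ∂π := by
                    refine mul_le_mul_right (lintegral_mono fun θ => ?_) _
                    exact mul_le_mul_right (hgap K hK0 θ) _
                _ ≤ 2 * ENNReal.ofReal (ε / 2) + ENNReal.ofReal ε :=
                    hcap.trans (add_le_add (mul_le_mul_right hb1 _) hb2)
                _ = _ := by
                    rw [show (2 : ℝ≥0∞) = ENNReal.ofReal 2 by simp,
                      ← ENNReal.ofReal_mul zero_le_two, ← ENNReal.ofReal_mul zero_le_two,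
                      ← ENNReal.ofReal_add (by positivity) hε.le]
                    congr 1
                    ring
            exact (ENNReal.mul_le_mul_iff_right (by norm_num) (by norm_num)).1 hb3
        have h4 := eq_of_gapRisk_eq_zero (μ := (configMeasure ν).restrict S) hp hr hq hq'
          (ae_restrict_of_ae hq0) (ae_restrict_of_ae hq'0)
          (ae_restrict_of_ae (by
            rw [hp_def]
            exact (ae_poissonDensity_ne hk hs h1.1 (ae_mixture_ne_zero hΛ hk h1.2)).mono
              fun _ h => h.1))
          (h2.mono fun _ h => h.1) h3
        rw [ae_restrict_iff' hS, hS_def] at h4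
        exact h4
      filter_upwards [ae_all_iff.2 hset, hq'1] with x h1 h2
      -- The mass of the competitor is finite at almost every $x$, so countably many values of $K_0$
      -- cover almost all observations.
      obtain ⟨K₀, hK₀⟩ := exists_nat_ge (∫⁻ y, q' (x, y) ∂ν).toReal
      refine h1 K₀ ?_
      rw [← ENNReal.ofReal_toReal h2.2]
      refine ENNReal.ofReal_le_ofReal (hK₀.trans ?_)
      nlinarith [Nat.cast_nonneg (α := ℝ) K₀, Nat.cast_nonneg (α := ℝ) x.1,
        mul_nonneg (Nat.cast_nonneg (α := ℝ) K₀) (Nat.cast_nonneg (α := ℝ) x.1)]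
    have hκf := (hΛ.subset hκ).1
    refine hlt.ne (estimationRisk_congr_ae (hΛ.subset hκ).2.1 ?_)
    filter_upwards [hδ', heq] with x h1 h2
    rw [h1, hδ]
    exact withDensity_congr_ae h2

end Estimation

/-! ### The Dirichlet prior and Lebesgue measure on a region. -/

section Dirichlet

variable {X : Type*} [MeasurableSpace X]

lemma isProbabilityMeasure_unitGamma {a : ℝ} (ha : 0 < a) : IsProbabilityMeasure (unitGamma a) := by
  unfold unitGamma
  rw [if_neg ha.ne']
  exact isProbabilityMeasure_gammaMeasure ha one_pos

/-- The defining property for the partition into a single cell compares the total mass of $D$ with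
that of an image of a gamma law with positive shape. -/
lemma IsDirichletProcess.isProbabilityMeasure {α : Measure X} [IsFiniteMeasure α] (hα : α ≠ 0)
    {D : Measure (ProbabilityMeasure X)} (hD : IsDirichletProcess α D) : IsProbabilityMeasure D := by
  have h := hD 1 (fun _ => univ) (fun _ => MeasurableSet.univ)
    (fun i j hij => absurd (Subsingleton.elim i j) hij) (iUnion_const univ)
  have hpos : 0 < (α univ).toReal :=
    ENNReal.toReal_pos (fun h => hα (Measure.measure_univ_eq_zero.1 h)) (measure_ne_top _ _)
  have := isProbabilityMeasure_unitGamma hpos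
  have hm : Measurable fun (m : ProbabilityMeasure X) (_ : Fin 1) =>
      ((m : Measure X) univ).toReal :=
    measurable_pi_lambda _ fun _ =>
      ((Measure.measurable_coe MeasurableSet.univ).comp measurable_subtype_coe).ennreal_toReal
  have hm' : Measurable fun (g : Fin 1 → ℝ) (i : Fin 1) => g i / ∑ j, g j := by fun_prop
  have h2 := congrArg (fun μ => μ univ) h
  simp only [dirichletDist] at h2
  rw [Measure.map_apply hm MeasurableSet.univ, Measure.map_apply hm' MeasurableSet.univ] at h2
  exact ⟨by simpa using h2⟩

end Dirichlet

lemma sigmaFinite_lebesgue {d : ℕ} {U : Set (EuclideanSpace ℝ (Fin d))} (hU : MeasurableSet U) :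
    SigmaFinite (lebesgue U) := by
  refine SigmaFinite.of_map _ (f := Subtype.val) measurable_subtype_coe.aemeasurable ?_
  rw [(MeasurableEmbedding.subtype_coe hU).map_comap]
  infer_instance

/-- For the zero measure the kernel could not integrate to one at any point, so the space would be
empty and carry no nonzero $\alpha$. -/
lemma IsKernelFunction.ne_zero {X : Type*} [MeasurableSpace X] {ν : Measure X} {k : X → X → ℝ≥0}
    (hk : IsKernelFunction ν k) {α : Measure X} (hα : α ≠ 0) : ν ≠ 0 := by
  rintro rfl
  have : IsEmpty X := ⟨fun u => by simpa using hk.lintegral_eq_one u⟩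
  exact hα (Measure.eq_zero_of_isEmpty α)

end PoissonAdmissibility

theorem theorem5 {d : ℕ} (U : Set (EuclideanSpace ℝ (Fin d))) (hU : MeasurableSet U)
    -- the kernel function
    (k : U → U → ℝ≥0) (hk : IsKernelFunction (lebesgue U) k)
    -- the parameter space
    (Λ : Set (Measure U)) (hΛ : IsParameterSpace (lebesgue U) Λ)
    -- the Dirichlet process with parameter `α`, whose kernel mixtures lie in the parameter space
    (α : Measure U) [IsFiniteMeasure α] (hα : α ≠ 0)
    (D : Measure (ProbabilityMeasure U)) (hD : IsDirichletProcess α D)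
    (hDΛ : ∀ᵐ m ∂D, (lebesgue U).withDensity (mixture k m) ∈ Λ)
    (s t : ℝ) (hs : 0 < s) (ht : 0 < t)
    (γ : ℝ) (hγ₁ : (α Set.univ).toReal - 1 ≤ γ) (hγ₂ : γ < (α Set.univ).toReal) :
    -- prediction
    ((∀ᵐ θ ∂(improperPrior α γ D),
        predictionRisk s t ((lebesgue U).withDensity (intensity k θ))
          (bayesPredictive (lebesgue U) k s t (improperPrior α γ D)) < ∞) →
      IsAdmissible Λ
        (decisionRules (lebesgue U) (predictiveMeasures (lebesgue U)))
        (predictionRisk s t)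
        (bayesPredictive (lebesgue U) k s t (improperPrior α γ D))) ∧
    -- estimation
    ((∀ᵐ θ ∂(improperPrior α γ D),
        estimationRisk s t ((lebesgue U).withDensity (intensity k θ))
          (bayesEstimator (lebesgue U) k s (improperPrior α γ D)) < ∞) →
      IsAdmissible Λ
        (decisionRules (lebesgue U) (finiteEquivMeasures (lebesgue U)))
        (estimationRisk s t)
        (bayesEstimator (lebesgue U) k s (improperPrior α γ D))) := by
  have := hD.isProbabilityMeasure hα
  have := sigmaFinite_lebesgue hU
  have := hU.standardBorel
  have hν := hk.ne_zero hα
  -- The two bounds on $\gamma$ become $0<a\le1$ for $a=|\alpha|-\gamma$, and `improperPrior`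
  -- unfolds to the product of `massPrior a` and $D$.
  have ha : 0 < (α Set.univ).toReal - γ := sub_pos.2 hγ₂
  have ha1 : (α Set.univ).toReal - γ ≤ 1 := by linarith
  exact ⟨isAdmissible_bayesPredictive hν hk hΛ hDΛ hs ht ha ha1,
    isAdmissible_bayesEstimator hν hk hΛ hDΛ hs ht ha ha1⟩
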